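/- Let $G$ be a finite-dimensional (real or complex) Lie group with Lie algebra $L$, and let $H_1,\dots,H_d$ be a basis of $L$ with dual basis $X^1,\dots,X^d$ of $L^*$. Let $\rho\colon L\to\mathrm{End}(L)$, $x\triangleright v=\rho(x)v$, be a left action (a Lie algebra representation) of $L$ on its own underlying vector space, not necessarily the adjoint one, which is the differential at the identity of a smooth linear action $a\triangleright v$ of $G$ on $L$. Let $\varphi\colon G\to L$ be a smooth group 1-cocycle, that is, $$\varphi(ba)=\varphi(a)+a^{-1}\triangleright\varphi(b)\qquad(a,b\in G).$$ Regard $\varphi$, through the exponential map of $G$, as the map $x\mapsto\varphi(\exp x)$ on a neighbourhood of the origin of $L$, suppose that it is invertible near the origin, and let $\psi$ be its local inverse, so that $\psi(\varphi(\exp x))=x$ and $\varphi(\exp\psi(y))=y$ for $x,y\in L$ near $0$. Write $\psi^\nu$ for the coordinates of $\psi$ in the basis $H_\nu$, and $\psi^\nu(X)$ for the Taylor series of $\psi^\nu$ at $0$ in the variables $X^1,\dots,X^d$. Let $L\triangleright L^*$ be the semidirect sum of $L$ and the abelian Lie algebra $L^*$, on which $L$ acts by the conjugate action $(x\triangleright\xi)(v)=-\xi(x\triangleright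 v)$. Let $U=U(L\triangleright L^*)$ be its universal enveloping Hopf algebra, with coproduct $\Delta$ and counit $\varepsilon$ for which the elements of $L\triangleright L^*$ are primitive, graded by giving $L$ degree $0$ and $L^*$ degree $1$; let $U\hat\otimes U$ and $U\hat\otimes U\hat\otimes U$ denote the completions of the tensor powers of $U$ with respect to the total degree, whose elements are the formal sums $\sum_{n\ge0}a_n$ with $a_n$ homogeneous of degree $n$. Then $$\Phi=\exp\Bigl(-\sum_\nu\psi^\nu(X)\otimes H_\nu\Bigr)\in U\hat\otimes U$$ is a twisting cocycle for $U$: it is invertible in $U\hat\otimes U$ and satisfies $$(\Delta\otimes\mathrm{id})(\Phi)\,\Phi_{12}=(\mathrm{id}\otimes\Delta)(\Phi)\,\Phi_{23},\qquad(\varepsilon\otimes\mathrm{id})(\Phi)=(\mathrm{id}\otimes\varepsilon)(\Phi)=1 .$$ -/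

import Mathlib

open scoped Manifold ContDiff Topology TensorProduct

attribute [local instance 100] LieRing.ofAssociativeRing

/-! ### Universal enveloping algebras as bialgebras -/

namespace UniversalEnvelopingAlgebra

section

variable (K : Type*) (L : Type*) [CommRing K] [LieRing L] [LieAlgebra K L]

/-- The map `x ↦ x ⊗ 1 + 1 ⊗ x` from a Lie algebra to `U(L) ⊗ U(L)`. -/
noncomputable def primitiveHom :
    L →ₗ⁅K⁆ UniversalEnvelopingAlgebra K L ⊗[K] UniversalEnvelopingAlgebra K L where
  toFun x := ι K x ⊗ₜ[K] 1 + 1 ⊗ₜ[K] ι K x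
  map_add' x y := by
    simp only [map_add, TensorProduct.add_tmul, TensorProduct.tmul_add]
    abel
  map_smul' c x := by
    simp only [map_smul, TensorProduct.smul_tmul', TensorProduct.tmul_smul, smul_add,
      RingHom.id_apply]
  map_lie' {x y} := by
    simp only [LieHom.map_lie, LieRing.of_associative_ring_bracket, mul_add, add_mul,
      Algebra.TensorProduct.tmul_mul_tmul, one_mul, mul_one, TensorProduct.sub_tmul,
      TensorProduct.tmul_sub]
    abel

/-- The coproduct of `U(L)`: elements of `L` are primitive. -/
noncomputable def comulHom : UniversalEnvelopingAlgebra K L →ₐ[K]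
    UniversalEnvelopingAlgebra K L ⊗[K] UniversalEnvelopingAlgebra K L :=
  lift K (primitiveHom K L)

/-- The counit of `U(L)`: it vanishes on `L`. -/
noncomputable def counitHom : UniversalEnvelopingAlgebra K L →ₐ[K] K :=
  lift K (0 : L →ₗ⁅K⁆ K)

theorem comulHom_ι (x : L) :
    comulHom K L (ι K x) = ι K x ⊗ₜ[K] 1 + 1 ⊗ₜ[K] ι K x :=
  lift_ι_apply K (primitiveHom K L) x

theorem counitHom_ι (x : L) : counitHom K L (ι K x) = 0 :=
  lift_ι_apply K (0 : L →ₗ⁅K⁆ K) x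

theorem algHom_ext_of_ι {A : Type*} [Ring A] [Algebra K A]
    {f g : UniversalEnvelopingAlgebra K L →ₐ[K] A} (h : ∀ x, f (ι K x) = g (ι K x)) : f = g := by
  apply hom_ext
  ext x
  exact h x

/-- The standard bialgebra structure of `U(L)`. -/
noncomputable instance instBialgebra : Bialgebra K (UniversalEnvelopingAlgebra K L) :=
  Bialgebra.ofAlgHom (comulHom K L) (counitHom K L)
    (by
      apply algHom_ext_of_ι
      intro x
      simp [comulHom_ι, TensorProduct.add_tmul, TensorProduct.tmul_add,
        Algebra.TensorProduct.one_def, -ι_apply]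
      abel)
    (by
      apply algHom_ext_of_ι
      intro x
      simp [comulHom_ι, counitHom_ι, -ι_apply])
    (by
      apply algHom_ext_of_ι
      intro x
      simp [comulHom_ι, counitHom_ι, -ι_apply])

end

end UniversalEnvelopingAlgebra

/-! ### The semidirect sum of `L` and the abelian Lie algebra `L*` -/

/-- The dual space of `L`, regarded as an abelian Lie algebra. -/
def AbelianDual (K L : Type*) [CommRing K] [AddCommGroup L] [Module K L] : Type _ :=
  Module.Dual K L

namespace AbelianDual

section

variable (K L : Type*) [CommRing K] [AddCommGroup L] [Module K L]

noncomputable instance : AddCommGroup (AbelianDual K L) :=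
  inferInstanceAs (AddCommGroup (Module.Dual K L))

noncomputable instance : Module K (AbelianDual K L) :=
  inferInstanceAs (Module K (Module.Dual K L))

/-- The bracket on `L*` is zero. -/
noncomputable instance : LieRing (AbelianDual K L) where
  bracket _ _ := 0
  add_lie _ _ _ := (add_zero _).symm
  lie_add _ _ _ := (add_zero _).symm
  lie_self _ := rfl
  leibniz_lie _ _ _ := (add_zero _).symm

noncomputable instance : LieAlgebra K (AbelianDual K L) where
  lie_smul t _ _ := (smul_zero t).symm

/-- The identification of the dual space with the underlying space of `AbelianDual`. -/
noncomputable def ofDual : Module.Dual K L ≃ₗ[K] AbelianDual K L := LinearEquiv.refl K _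

theorem lie_eq_zero (ξ η : AbelianDual K L) : ⁅ξ, η⁆ = 0 := rfl

end

end AbelianDual

section SemidirectSum

variable {K L : Type*} [CommRing K] [LieRing L] [LieAlgebra K L]

/-- The action `x ▷ ξ = - ξ ∘ ρ x` on `L*` which is conjugate to an action `ρ` of `L` on its own
underlying vector space. -/
noncomputable def dualAction (ρ : L →ₗ⁅K⁆ Module.End K L) :
    L →ₗ⁅K⁆ LieDerivation K (AbelianDual K L) (AbelianDual K L) where
  toFun x :=
    { toLinearMap := (AbelianDual.ofDual K L).toLinearMap ∘ₗ
        (-(Module.Dual.transpose (R := K) (ρ x))) ∘ₗ (AbelianDual.ofDual K L).symm.toLinearMap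
      leibniz' := fun a b => by
        simp [AbelianDual.lie_eq_zero] }
  map_add' x y := by
    ext ξ
    refine LinearMap.ext fun v => ?_
    change -(AbelianDual.ofDual K L).symm ξ (ρ (x + y) v) =
      -(AbelianDual.ofDual K L).symm ξ (ρ x v) + -(AbelianDual.ofDual K L).symm ξ (ρ y v)
    simp [add_comm]
  map_smul' c x := by
    ext ξ
    refine LinearMap.ext fun v => ?_
    change -(AbelianDual.ofDual K L).symm ξ (ρ (c • x) v) = c • -(AbelianDual.ofDual K L).symm ξ (ρ x v)
    simp
  map_lie' {x y} := by
    ext ξ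
    rw [LieDerivation.lie_apply]
    refine LinearMap.ext fun v => ?_
    change -(AbelianDual.ofDual K L).symm ξ (ρ ⁅x, y⁆ v) =
      - -(AbelianDual.ofDual K L).symm ξ (ρ y (ρ x v)) - - -(AbelianDual.ofDual K L).symm ξ (ρ x (ρ y v))
    simp [LieRing.of_associative_ring_bracket]

/-- The semidirect sum `L ▷ L*`. -/
abbrev SemidirectDual (ρ : L →ₗ⁅K⁆ Module.End K L) : Type _ :=
  LieAlgebra.SemiDirectSum (AbelianDual K L) L (dualAction ρ)

/-- The universal enveloping algebra `U(L ▷ L*)`. -/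
abbrev USemidirect (ρ : L →ₗ⁅K⁆ Module.End K L) : Type _ :=
  UniversalEnvelopingAlgebra K (SemidirectDual ρ)

/-- The inclusion `L → U(L ▷ L*)`. -/
noncomputable def genH (ρ : L →ₗ⁅K⁆ Module.End K L) : L →ₗ[K] USemidirect ρ :=
  (UniversalEnvelopingAlgebra.ι K : SemidirectDual ρ →ₗ⁅K⁆ USemidirect ρ).toLinearMap ∘ₗ
    (LieAlgebra.SemiDirectSum.inr (dualAction ρ)).toLinearMap

/-- The inclusion `L* → U(L ▷ L*)`. -/
noncomputable def genX (ρ : L →ₗ⁅K⁆ Module.End K L) : Module.Dual K L →ₗ[K] USemidirect ρ :=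
  (UniversalEnvelopingAlgebra.ι K : SemidirectDual ρ →ₗ⁅K⁆ USemidirect ρ).toLinearMap ∘ₗ
    (LieAlgebra.SemiDirectSum.inl (dualAction ρ)).toLinearMap ∘ₗ
      (AbelianDual.ofDual K L).toLinearMap

/-- The component of degree `n` of `U(L ▷ L*)`, for the grading in which `L` has degree `0` and
`L*` has degree `1`: the span of the products of `n` elements of `L*` with an element of `U(L)`. -/
noncomputable def degreePart (ρ : L →ₗ⁅K⁆ Module.End K L) (n : ℕ) :
    Submodule K (USemidirect ρ) :=
  LinearMap.range (genX ρ) ^ n *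
    Subalgebra.toSubmodule (Algebra.adjoin K (Set.range (genH ρ)))

end SemidirectSum

/-! ### Twisting cocycles in a completed tensor square

For a graded bialgebra `H`, an element of the completion of `H ⊗ H` with respect to the degree is a
formal sum `∑ aₙ` with `aₙ` homogeneous of degree `n`. It is encoded as the power series
`∑ aₙ Tⁿ`; the completions of `H` and of `H ⊗ H ⊗ H` are treated in the same way, and a homogeneous
algebra homomorphism extends to the completions coefficientwise. -/

section Twist

variable {K H : Type*} [CommRing K] [Ring H] [Bialgebra K H]

/-- The component of total degree `n` of `H ⊗ H`. -/
def tensorDegreePart (gr : ℕ → Submodule K H) (n : ℕ) : Submodule K (H ⊗[K] H) :=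
  ⨆ p ∈ Finset.HasAntidiagonal.antidiagonal n, Submodule.map₂ (TensorProduct.mk K H H) (gr p.1) (gr p.2)

/-- `Δ ⊗ id`. -/
noncomputable def comulLeft : H ⊗[K] H →ₐ[K] H ⊗[K] (H ⊗[K] H) :=
  (Algebra.TensorProduct.assoc K K K H H H).toAlgHom.comp
    (Algebra.TensorProduct.map (Bialgebra.comulAlgHom K H) (AlgHom.id K H))

/-- `id ⊗ Δ`. -/
noncomputable def comulRight : H ⊗[K] H →ₐ[K] H ⊗[K] (H ⊗[K] H) :=
  Algebra.TensorProduct.map (AlgHom.id K H) (Bialgebra.comulAlgHom K H)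

/-- The embedding `a ⊗ b ↦ a ⊗ b ⊗ 1`. -/
noncomputable def embed₁₂ : H ⊗[K] H →ₐ[K] H ⊗[K] (H ⊗[K] H) :=
  Algebra.TensorProduct.map (AlgHom.id K H) Algebra.TensorProduct.includeLeft

/-- The embedding `a ⊗ b ↦ 1 ⊗ a ⊗ b`. -/
noncomputable def embed₂₃ : H ⊗[K] H →ₐ[K] H ⊗[K] (H ⊗[K] H) :=
  Algebra.TensorProduct.includeRight

/-- `ε ⊗ id`. -/
noncomputable def counitLeft : H ⊗[K] H →ₐ[K] H :=
  (Algebra.TensorProduct.lid K H).toAlgHom.comp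
    (Algebra.TensorProduct.map (Bialgebra.counitAlgHom K H) (AlgHom.id K H))

/-- `id ⊗ ε`. -/
noncomputable def counitRight : H ⊗[K] H →ₐ[K] H :=
  (Algebra.TensorProduct.rid K K H).toAlgHom.comp
    (Algebra.TensorProduct.map (AlgHom.id K H) (Bialgebra.counitAlgHom K H))

/-- The coefficientwise extension of an algebra homomorphism to completions. -/
noncomputable def extend {A B : Type*} [Ring A] [Algebra K A] [Ring B] [Algebra K B]
    (f : A →ₐ[K] B) : PowerSeries A →+* PowerSeries B :=
  PowerSeries.map f.toRingHom

/-- `Φ` is a normalized twisting cocycle in the completion of `H ⊗ H` defined by the grading `gr`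
of `H`: an invertible element that satisfies
`(Δ ⊗ id)(Φ) Φ₁₂ = (id ⊗ Δ)(Φ) Φ₂₃` and `(ε ⊗ id)(Φ) = (id ⊗ ε)(Φ) = 1`. -/
structure IsTwistingCocycle (gr : ℕ → Submodule K H) (Φ : PowerSeries (H ⊗[K] H)) : Prop where
  homogeneous : ∀ n, PowerSeries.coeff n Φ ∈ tensorDegreePart gr n
  invertible : ∃ Ψ : PowerSeries (H ⊗[K] H),
    (∀ n, PowerSeries.coeff n Ψ ∈ tensorDegreePart gr n) ∧ Φ * Ψ = 1 ∧ Ψ * Φ = 1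
  twist : extend comulLeft Φ * extend embed₁₂ Φ = extend comulRight Φ * extend embed₂₃ Φ
  counit_left : extend counitLeft Φ = 1
  counit_right : extend counitRight Φ = 1

end Twist

/-- The exponential `∑ₖ Θᵏ / k!` of a power series `Θ` without constant term over a possibly
noncommutative algebra; the coefficient of degree `n` only involves the powers with `k ≤ n`. -/
noncomputable def formalExp (K : Type*) [Field K] {A : Type*} [Ring A] [Algebra K A]
    (Θ : PowerSeries A) : PowerSeries A :=
  PowerSeries.mk fun n =>
    ∑ k ∈ Finset.range (n + 1), ((k.factorial : K)⁻¹) • PowerSeries.coeff n (Θ ^ k)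

/-! ### Lie groups, the exponential map and group cocycles -/

instance instLEInftyMinSmoothness (𝕜 : Type*) [RCLike 𝕜] : ENat.LEInfty (minSmoothness 𝕜 3) where
  out := by
    rw [minSmoothness_of_isRCLikeNormedField]
    exact ENat.LEInfty.out

section LieGroup

variable {𝕜 : Type*} [RCLike 𝕜] {E : Type*} [NormedAddCommGroup E] [NormedSpace 𝕜 E]
  {G : Type*} [TopologicalSpace G] [ChartedSpace E G] [Group G]

/-- `γ` is the integral curve, starting at `1`, of the left invariant vector field with value `x`
at `1`; that is, the one-parameter subgroup with velocity `x`. -/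
def IsOneParameterSubgroup (x : GroupLieAlgebra 𝓘(𝕜, E) G) (γ : 𝕜 → G) : Prop :=
  γ 0 = 1 ∧ ∀ t : 𝕜, HasMFDerivAt 𝓘(𝕜, 𝕜) 𝓘(𝕜, E) γ t
    ((1 : 𝕜 →L[𝕜] 𝕜).smulRight (mulInvariantVectorField x (γ t)))

open Classical in
/-- The exponential map of a Lie group: the value at `1` of the one-parameter subgroup with
velocity `x` (which exists and is unique in a Lie group). -/
noncomputable def lieExp (x : GroupLieAlgebra 𝓘(𝕜, E) G) : G :=
  if h : ∃ γ : 𝕜 → G, IsOneParameterSubgroup x γ then h.choose 1 else 1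

/-- Smoothness of a map from `G` to a finite-dimensional vector space: all its coordinates are
smooth. -/
def IsSmoothVec (𝕜 E : Type*) [RCLike 𝕜] [NormedAddCommGroup E] [NormedSpace 𝕜 E]
    {G : Type*} [TopologicalSpace G] [ChartedSpace E G]
    {V : Type*} [AddCommGroup V] [Module 𝕜 V] (f : G → V) : Prop :=
  ∀ ξ : Module.Dual 𝕜 V, ContMDiff 𝓘(𝕜, E) 𝓘(𝕜, 𝕜) ∞ fun g => ξ (f g)

variable [CompleteSpace E] [LieGroup 𝓘(𝕜, E) ∞ G]

/-- The smooth action `π` of the group `G` on the vector space `L` has the action `ρ` of the Lie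
algebra `L` as its differential at the identity. -/
structure IntegratesAction
    (ρ : GroupLieAlgebra 𝓘(𝕜, E) G →ₗ⁅𝕜⁆ Module.End 𝕜 (GroupLieAlgebra 𝓘(𝕜, E) G))
    (π : Representation 𝕜 G (GroupLieAlgebra 𝓘(𝕜, E) G)) : Prop where
  smooth : ∀ v, IsSmoothVec 𝕜 E fun g => π g v
  deriv : ∀ (x v : GroupLieAlgebra 𝓘(𝕜, E) G)
    (ξ : Module.Dual 𝕜 (GroupLieAlgebra 𝓘(𝕜, E) G)),
    mfderiv 𝓘(𝕜, E) 𝓘(𝕜, 𝕜) (fun g => ξ (π g v)) 1 x = ξ (ρ x v)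

/-- `φ` is a (smooth) group 1-cocycle: `φ(ba) = φ(a) + a⁻¹ ▷ φ(b)`. -/
structure IsGroupCocycle (π : Representation 𝕜 G (GroupLieAlgebra 𝓘(𝕜, E) G))
    (φ : G → GroupLieAlgebra 𝓘(𝕜, E) G) : Prop where
  smooth : IsSmoothVec 𝕜 E φ
  cocycle : ∀ a b : G, φ (b * a) = φ a + π a⁻¹ (φ b)

/-- The map `φ`, read in exponential coordinates as a map from a neighbourhood of the origin of `L`
to `L`, is invertible near the origin, with inverse `ψ`. -/
structure IsInverseNearOrigin (φ : G → GroupLieAlgebra 𝓘(𝕜, E) G)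
    (ψ : GroupLieAlgebra 𝓘(𝕜, E) G → GroupLieAlgebra 𝓘(𝕜, E) G) : Prop where
  left_inv : ∀ᶠ x in 𝓝 (0 : GroupLieAlgebra 𝓘(𝕜, E) G), ψ (φ (lieExp x)) = x
  right_inv : ∀ᶠ y in 𝓝 (0 : GroupLieAlgebra 𝓘(𝕜, E) G), φ (lieExp (ψ y)) = y

end LieGroup

/-! ### The twisting element -/

section TwistingElement

variable {𝕜 : Type*} [RCLike 𝕜] {L : Type*} [LieRing L] [LieAlgebra 𝕜 L] {d : ℕ}

/-- The coordinate `ψ^ν` of `ψ : L → L`, as a function of the coordinates with respect to the basis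
`b`. -/
noncomputable def coordFun (b : Module.Basis (Fin d) 𝕜 L) (ψ : L → L) (ν : Fin d) :
    (Fin d → 𝕜) → 𝕜 :=
  fun y => b.coord ν (ψ (∑ i, y i • b i))

/-- `ψ^ν(X)`: the Taylor series of `ψ^ν` at the origin, evaluated at the commuting elements `X^μ`
of `U(L ▷ L*)` given by the basis of `L*` that is dual to `b`. Its part of degree `n` is
`(1/n!) ∑ ∂_{i₁} ⋯ ∂_{iₙ} ψ^ν(0) X^{i₁} ⋯ X^{iₙ}`. -/
noncomputable def taylorX (ρ : L →ₗ⁅𝕜⁆ Module.End 𝕜 L) (b : Module.Basis (Fin d) 𝕜 L)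
    (ψ : L → L) (ν : Fin d) : PowerSeries (USemidirect ρ) :=
  PowerSeries.mk fun n => ((n.factorial : 𝕜)⁻¹) • ∑ i : Fin n → Fin d,
    (iteratedFDeriv 𝕜 n (coordFun b ψ ν) 0 fun k => Pi.single (i k) 1) •
      (List.ofFn fun k => genX ρ (b.coord (i k))).prod

/-- `exp(- ∑_ν ψ^ν(X) ⊗ H_ν)`, where `H_ν` are the elements of the basis `b`. -/
noncomputable def twistingElement (ρ : L →ₗ⁅𝕜⁆ Module.End 𝕜 L) (b : Module.Basis (Fin d) 𝕜 L)
    (ψ : L → L) : PowerSeries (USemidirect ρ ⊗[𝕜] USemidirect ρ) :=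
  formalExp 𝕜 (PowerSeries.mk fun n =>
    -∑ ν, PowerSeries.coeff n (taylorX ρ b ψ ν) ⊗ₜ[𝕜] genH ρ (b ν))

end TwistingElement

/-! Let `D` be the differential of `φ` at the identity. The cocycle condition says that `u(t) =
φ(exp tx)` solves `u' = D x - ρ(x) u`. Hence `-φ(exp x)` is the image of the origin under
`exp(-A(x))`, where `A(x) w = ρ(x) w + D x`. Invertibility of `φ` near the origin makes `D`
injective, hence bijective. Then `φ` is a local diffeomorphism that relates left invariant fields to
affine fields, so `D` is a Lie algebra cocycle and `A` is an affine representation of `L`, realised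
linearly on `L × 𝕜`. In these terms `ψ` is characterised by one fact: `exp(-A(ψ(y)))` moves the
origin to `-y`.

With indices for tensor factors, the twist identity reads `exp(-ψ(X₁ + X₂) H₃) exp(-ψ(X₁) H₂) =
exp(-ψ(X₁) (H₂ + H₃)) exp(-ψ(X₂) H₃)`. All exponents have coefficients in the Lie algebra `S` of
sums `f(X₁, X₂) H₂ + g(X₁, X₂) H₃`. Let the third factor act through `A` and evaluate at the origin:
every exponential in `H₃` becomes a displacement by its argument, displacements add up, and the two
sides agree (`twist_congruence`; the interplay of `H₂` with `X₂` is the invariance of the canonical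
element of `L* ⊗ L`, `sum_legX_intertwine`). They also agree when the counit is applied to the third
factor. So they are congruent modulo a left ideal `J`, and `S ∩ J = 0` because `x ↦ A(x) 0 = D x` is
injective (`eq_zero_of_mem_thirdAnnihilator`).

Congruence implies equality by `formalExp_mul_eq_of_sub_mem`: the quotient `W` of the two sides
satisfies `W - 1 ∈ J`, so its logarithmic derivative with respect to the degree lies in `S ∩ J = 0`,
and `W` is the constant `1`. This is the formal counterpart of the fact that near the identity a
group element is determined by the image of the origin when the stabiliser is discrete.

Throughout, the power series variable `T` records the degree in `X`. The analytic identity for `ψ`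
becomes a formal one by comparing expansions in `s` along each line `s ↦ s y`
(`HasExpansion.unique`), and the values `y` are then replaced by commuting elements through a
polynomial ring (`formalExp_mul_originProj`). -/

/-! ### Formal exponentials over noncommutative algebras -/

namespace PowerSeries

section Adic

variable {A : Type*} [Ring A]

/-- A sequence of power series whose `k`-th term is divisible by `T ^ k`. -/
def IsAdic (a : ℕ → PowerSeries A) : Prop :=
  ∀ k n, n < k → coeff n (a k) = 0

/-- The sum of a sequence of power series whose `k`-th term is divisible by `T ^ k`. -/
noncomputable def adicSum (a : ℕ → PowerSeries A) : PowerSeries A :=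
  mk fun n => ∑ k ∈ Finset.range (n + 1), coeff n (a k)

theorem IsAdic.coeff_adicSum {a : ℕ → PowerSeries A} (ha : IsAdic a) {n N : ℕ} (h : n < N) :
    coeff n (adicSum a) = ∑ k ∈ Finset.range N, coeff n (a k) := by
  rw [adicSum, coeff_mk]
  apply Finset.sum_subset
  · intro k hk
    simp only [Finset.mem_range] at hk ⊢
    omega
  · intro k _ hk
    simp only [Finset.mem_range, not_lt] at hk
    exact ha k n (by omega)

theorem IsAdic.coeff_mul_eq_zero {a b : ℕ → PowerSeries A} (ha : IsAdic a) (hb : IsAdic b)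
    {i j n : ℕ} (h : n < i + j) : coeff n (a i * b j) = 0 := by
  rw [coeff_mul]
  apply Finset.sum_eq_zero
  rintro ⟨p, q⟩ hpq
  rw [Finset.HasAntidiagonal.mem_antidiagonal] at hpq
  rcases lt_or_ge p i with hp | hp
  · rw [ha i p hp, zero_mul]
  · rw [hb j q (by simp only at hpq; omega), mul_zero]

theorem IsAdic.mul {a b : ℕ → PowerSeries A} (ha : IsAdic a) (hb : IsAdic b) :
    IsAdic fun m => ∑ p ∈ Finset.HasAntidiagonal.antidiagonal m, a p.1 * b p.2 := by
  intro k n hn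
  rw [map_sum]
  apply Finset.sum_eq_zero
  rintro ⟨p, q⟩ hpq
  rw [Finset.HasAntidiagonal.mem_antidiagonal] at hpq
  exact ha.coeff_mul_eq_zero hb (by simp only at hpq ⊢; omega)

theorem adicSum_mul {a b : ℕ → PowerSeries A} (ha : IsAdic a) (hb : IsAdic b) :
    adicSum a * adicSum b =
      adicSum fun m => ∑ p ∈ Finset.HasAntidiagonal.antidiagonal m, a p.1 * b p.2 := by
  ext n
  have h1 : coeff n (adicSum a * adicSum b) =
      ∑ i ∈ Finset.range (n + 1), ∑ j ∈ Finset.range (n + 1), coeff n (a i * b j) := by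
    rw [coeff_mul]
    have : ∀ p ∈ Finset.HasAntidiagonal.antidiagonal n, coeff p.1 (adicSum a) * coeff p.2 (adicSum b) =
        ∑ i ∈ Finset.range (n + 1), ∑ j ∈ Finset.range (n + 1),
          coeff p.1 (a i) * coeff p.2 (b j) := by
      rintro ⟨p, q⟩ hpq
      rw [Finset.HasAntidiagonal.mem_antidiagonal] at hpq
      simp only at hpq ⊢
      rw [ha.coeff_adicSum (show p < n + 1 by omega), hb.coeff_adicSum (show q < n + 1 by omega),
        Finset.sum_mul_sum]
    rw [Finset.sum_congr rfl this, Finset.sum_comm]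
    refine Finset.sum_congr rfl fun i _ => ?_
    rw [Finset.sum_comm]
    exact Finset.sum_congr rfl fun j _ => (coeff_mul _ _ _).symm
  rw [h1, adicSum, coeff_mk]
  simp only [map_sum]
  rw [← Finset.sum_product', Finset.sum_sigma']
  symm
  -- The triangle `i + j ≤ n` injects into the square `i, j ≤ n`. The remaining pairs contribute
  -- nothing, since the product of the `i`-th and `j`-th terms is divisible by `T ^ (i + j)`.
  apply Finset.sum_of_injOn (fun x : (_ : ℕ) × ℕ × ℕ => x.2)
  · rintro ⟨m, p⟩ h1 ⟨m', p'⟩ h2 h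
    simp only [Finset.coe_sigma, Set.mem_sigma_iff, Finset.mem_coe, Finset.HasAntidiagonal.mem_antidiagonal,
      Finset.mem_range] at h1 h2 h
    subst h
    obtain rfl : m = m' := by omega
    rfl
  · rintro ⟨m, p⟩ h1
    simp only [Finset.coe_sigma, Set.mem_sigma_iff, Finset.mem_coe, Finset.HasAntidiagonal.mem_antidiagonal,
      Finset.mem_range, Finset.coe_product, Set.mem_prod] at h1 ⊢
    omega
  · rintro ⟨i, j⟩ _ h2
    apply ha.coeff_mul_eq_zero hb
    by_contra h
    refine h2 ⟨⟨i + j, (i, j)⟩, ?_, rfl⟩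
    simp
    omega
  · intro x _
    rfl

theorem isAdic_single (y : PowerSeries A) : IsAdic fun k => if k = 0 then y else 0 := by
  intro k n hn
  simp only [if_neg (show k ≠ 0 by omega), map_zero]

theorem adicSum_single (y : PowerSeries A) : adicSum (fun k => if k = 0 then y else 0) = y := by
  ext n
  rw [adicSum, coeff_mk, Finset.sum_eq_single 0]
  · simp
  · intro k _ hk
    simp [hk]
  · simp

theorem coeff_pow_eq_zero {Θ : PowerSeries A} (h : constantCoeff Θ = 0) {n k : ℕ} (hn : n < k) :
    coeff n (Θ ^ k) = 0 := by
  induction k generalizing n with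
  | zero => omega
  | succ k ih =>
    rw [pow_succ, coeff_mul]
    apply Finset.sum_eq_zero
    rintro ⟨p, q⟩ hpq
    rw [Finset.HasAntidiagonal.mem_antidiagonal] at hpq
    rcases lt_or_ge p k with hp | hp
    · rw [ih hp, zero_mul]
    · obtain rfl : q = 0 := by simp only at hpq; omega
      simp only [coeff_zero_eq_constantCoeff]
      rw [h, mul_zero]

end Adic

/-- The power series all of whose coefficients lie in a given submodule. -/
def coeffsIn {K A : Type*} [CommRing K] [Ring A] [Algebra K A] (S : Submodule K A) :
    Submodule K (PowerSeries A) where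
  carrier := {a | ∀ n, coeff n a ∈ S}
  add_mem' ha hb n := by rw [map_add]; exact S.add_mem (ha n) (hb n)
  zero_mem' n := by rw [map_zero]; exact S.zero_mem
  smul_mem' c a ha n := by rw [coeff_smul]; exact S.smul_mem c (ha n)

section

variable {K A : Type*} [CommRing K] [Ring A] [Algebra K A] {S : Submodule K A}

theorem lie_mem_coeffsIn (hS : ∀ x ∈ S, ∀ y ∈ S, x * y - y * x ∈ S) {a b : PowerSeries A}
    (ha : a ∈ coeffsIn S) (hb : b ∈ coeffsIn S) : a * b - b * a ∈ coeffsIn S := by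
  intro n
  -- Reversing the antidiagonal in one of the two products pairs each `aᵢ bⱼ` with `bⱼ aᵢ`, so that
  -- the difference is a sum of commutators of coefficients.
  rw [map_sub, coeff_mul, coeff_mul, ← Finset.Nat.sum_antidiagonal_swap, ← Finset.sum_sub_distrib]
  refine S.sum_mem fun p _ => ?_
  exact hS _ (ha _) _ (hb _)

theorem mul_mem_coeffsIn_of_left (hS : ∀ x, ∀ y ∈ S, x * y ∈ S) (a : PowerSeries A)
    {b : PowerSeries A} (hb : b ∈ coeffsIn S) : a * b ∈ coeffsIn S := by
  intro n
  rw [coeff_mul]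
  exact S.sum_mem fun p _ => hS _ _ (hb _)

theorem adicSum_mem_coeffsIn {a : ℕ → PowerSeries A} (h : ∀ k, a k ∈ coeffsIn S) :
    adicSum a ∈ coeffsIn S := by
  intro n
  rw [adicSum, coeff_mk]
  exact S.sum_mem fun k _ => h k n

end

section Euler

variable {A : Type*} [Ring A]

/-- The Euler operator `T d/dT`. -/
noncomputable def euler (a : PowerSeries A) : PowerSeries A := mk fun n => n • coeff n a

theorem coeff_euler (n : ℕ) (a : PowerSeries A) : coeff n (euler a) = n • coeff n a :=
  coeff_mk _ _

theorem euler_mul (a b : PowerSeries A) : euler (a * b) = euler a * b + a * euler b := by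
  ext n
  rw [map_add, coeff_euler, coeff_mul, coeff_mul, coeff_mul, Finset.smul_sum,
    ← Finset.sum_add_distrib]
  refine Finset.sum_congr rfl ?_
  rintro ⟨p, q⟩ hpq
  rw [Finset.HasAntidiagonal.mem_antidiagonal] at hpq
  simp only at hpq ⊢
  rw [coeff_euler, coeff_euler, ← hpq, add_smul, smul_mul_assoc, mul_smul_comm]

theorem euler_add (a b : PowerSeries A) : euler (a + b) = euler a + euler b := by
  ext n
  simp only [coeff_euler, map_add, smul_add]

theorem euler_one : euler (1 : PowerSeries A) = 0 := by
  ext n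
  rw [coeff_euler, coeff_one]
  split_ifs with h
  · simp [h]
  · simp

theorem euler_mem_coeffsIn {K : Type*} [CommRing K] [Algebra K A] {S : Submodule K A}
    {a : PowerSeries A} (h : a ∈ coeffsIn S) : euler a ∈ coeffsIn S := by
  intro n
  rw [coeff_euler]
  exact S.smul_of_tower_mem n (h n)

end Euler

end PowerSeries

/-! ### The exponential series and its generating series in an auxiliary variable. -/

section FormalExp

open PowerSeries

variable {K : Type*} [Field K] {A B : Type*} [Ring A] [Algebra K A]
  [Ring B] [Algebra K B]

variable (K) in
/-- The terms of the exponential series. -/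
noncomputable def expTerm (Θ : PowerSeries A) (k : ℕ) : PowerSeries A :=
  ((k.factorial : K)⁻¹) • Θ ^ k

theorem formalExp_eq_adicSum (Θ : PowerSeries A) : formalExp K Θ = adicSum (expTerm K Θ) := rfl

theorem isAdic_expTerm {Θ : PowerSeries A} (h : constantCoeff Θ = 0) :
    IsAdic (expTerm K Θ) := by
  intro k n hn
  rw [expTerm, coeff_smul, coeff_pow_eq_zero h hn, smul_zero]

theorem expTerm_zero (Θ : PowerSeries A) : expTerm K Θ 0 = 1 := by
  simp [expTerm]

theorem formalExp_zero : formalExp K (0 : PowerSeries A) = 1 := by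
  rw [formalExp_eq_adicSum, ← adicSum_single (1 : PowerSeries A)]
  congr 1
  ext1 k
  split_ifs with h
  · rw [h, expTerm_zero]
  · rw [expTerm, zero_pow h, smul_zero]

theorem extend_formalExp (f : A →ₐ[K] B) (Θ : PowerSeries A) :
    extend f (formalExp K Θ) = formalExp K (extend f Θ) := by
  ext n
  simp only [extend, formalExp, coeff_map, coeff_mk, map_sum, ← map_pow]
  refine Finset.sum_congr rfl fun k _ => ?_
  exact map_smul f _ _

/-- The generating series of the terms of the exponential series. -/
noncomputable def expGen (K : Type*) [Field K] [Algebra K A] (Θ : PowerSeries A) :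
    PowerSeries (PowerSeries A) :=
  PowerSeries.mk (expTerm K Θ)

variable [CharZero K]

theorem expTerm_succ (Θ : PowerSeries A) (k : ℕ) :
    (k + 1) • expTerm K Θ (k + 1) = Θ * expTerm K Θ k := by
  rw [expTerm, expTerm, mul_smul_comm, pow_succ', ← Nat.cast_smul_eq_nsmul K, smul_smul,
    Nat.factorial_succ]
  congr 1
  have : ((k + 1 : ℕ) : K) ≠ 0 := by exact_mod_cast Nat.succ_ne_zero k
  push_cast at this ⊢
  field_simp

theorem expTerm_succ' (Θ : PowerSeries A) (k : ℕ) :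
    (k + 1) • expTerm K Θ (k + 1) = expTerm K Θ k * Θ := by
  rw [expTerm_succ, expTerm, mul_smul_comm, smul_mul_assoc, (Commute.refl Θ).pow_right k]

/-- With `z` the outer variable, `expGen K Θ` is `exp(zΘ)` and this is its differential equation `z
d/dz exp(zΘ) = zΘ exp(zΘ)`. The outer variable is needed because for noncommuting coefficients the
derivative of `exp(Θ)` in the inner variable `T` has no such simple form. -/
theorem euler_expGen (Θ : PowerSeries A) :
    euler (expGen K Θ) = X * (C Θ * expGen K Θ) := by
  ext1 k
  cases k with
  | zero => simp [coeff_euler]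
  | succ k => rw [coeff_euler, coeff_succ_X_mul, coeff_C_mul, expGen, coeff_mk, coeff_mk,
      expTerm_succ]

theorem euler_expGen' (Θ : PowerSeries A) :
    euler (expGen K Θ) = X * (expGen K Θ * C Θ) := by
  ext1 k
  cases k with
  | zero => simp [coeff_euler]
  | succ k => rw [coeff_euler, coeff_succ_X_mul, coeff_mul_C, expGen, coeff_mk, coeff_mk,
      expTerm_succ']

end FormalExp

/-! ### Exponentials of series with coefficients in a Lie subalgebra. -/

section FormalExpLie

open PowerSeries

variable {K : Type*} [Field K] {A : Type*} [Ring A] [Algebra K A]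

/-- Specialising the outer variable to `1` is multiplicative on series for which the specialisation
converges `T`-adically. Identities for `expGen` thereby descend to `formalExp`. -/
theorem adicSum_coeff_mul {P Q : PowerSeries (PowerSeries A)} (hP : IsAdic fun k => coeff k P)
    (hQ : IsAdic fun k => coeff k Q) :
    adicSum (fun k => coeff k P) * adicSum (fun k => coeff k Q) =
      adicSum fun k => coeff k (P * Q) := by
  rw [adicSum_mul hP hQ]
  simp only [coeff_mul]

theorem IsAdic.coeff_mul {P Q : PowerSeries (PowerSeries A)} (hP : IsAdic fun k => coeff k P)
    (hQ : IsAdic fun k => coeff k Q) : IsAdic fun k => coeff k (P * Q) := by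
  have := hP.mul hQ
  simpa only [← PowerSeries.coeff_mul] using this

theorem isAdic_expGen {Θ : PowerSeries A} (h : constantCoeff Θ = 0) :
    IsAdic fun k => coeff k (expGen K Θ) := by
  simpa only [expGen, coeff_mk] using isAdic_expTerm (K := K) h

theorem adicSum_expGen (Θ : PowerSeries A) :
    adicSum (fun k => coeff k (expGen K Θ)) = formalExp K Θ := by
  simp only [expGen, coeff_mk, formalExp_eq_adicSum]

theorem isAdic_coeff_C (y : PowerSeries A) : IsAdic fun k => coeff k (C y) := by
  simpa only [coeff_C] using isAdic_single y

theorem adicSum_coeff_C (y : PowerSeries A) : adicSum (fun k => coeff k (C y)) = y := by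
  simpa only [coeff_C] using adicSum_single y

theorem constantCoeff_expGen (Θ : PowerSeries A) : constantCoeff (expGen K Θ) = 1 := by
  rw [← coeff_zero_eq_constantCoeff_apply, expGen, coeff_mk, expTerm_zero]

theorem constantCoeff_formalExp (Θ : PowerSeries A) : constantCoeff (formalExp K Θ) = 1 := by
  rw [← coeff_zero_eq_constantCoeff_apply, formalExp, coeff_mk]
  simp

/-- If `Θ y = y Ξ` then `exp(Θ) y = y exp(Ξ)`. -/
theorem formalExp_intertwine {Θ Ξ y : PowerSeries A} (h : Θ * y = y * Ξ) (hΘ : constantCoeff Θ = 0)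
    (hΞ : constantCoeff Ξ = 0) : formalExp K Θ * y = y * formalExp K Ξ := by
  have key : ∀ k, expTerm K Θ k * y = y * expTerm K Ξ k := by
    intro k
    have : Θ ^ k * y = y * Ξ ^ k := by
      induction k with
      | zero => simp
      | succ k ih => rw [pow_succ, mul_assoc, h, ← mul_assoc, ih, mul_assoc, ← pow_succ]
    rw [expTerm, expTerm, smul_mul_assoc, mul_smul_comm, this]
  have h1 : formalExp K Θ * y = adicSum fun k => coeff k (expGen K Θ * C y) := by
    rw [← adicSum_coeff_mul (isAdic_expGen hΘ) (isAdic_coeff_C y), adicSum_expGen, adicSum_coeff_C]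
  have h2 : y * formalExp K Ξ = adicSum fun k => coeff k (C y * expGen K Ξ) := by
    rw [← adicSum_coeff_mul (isAdic_coeff_C y) (isAdic_expGen hΞ), adicSum_expGen, adicSum_coeff_C]
  rw [h1, h2]
  congr 1
  ext1 k
  rw [coeff_mul_C, coeff_C_mul, expGen, expGen, coeff_mk, coeff_mk, key]

variable {S : Submodule K A}

/-- An invertible power series whose logarithmic derivative has coefficients in `S`, and which
preserves by conjugation the power series with coefficients in `S`. -/
structure IsIntegralOf (S : Submodule K A) (W W' : PowerSeries A) : Prop where
  mul_inv : W * W' = 1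
  inv_mul : W' * W = 1
  euler_mul_inv : euler W * W' ∈ coeffsIn S
  conj : ∀ y ∈ coeffsIn S, W * y * W' ∈ coeffsIn S

/-- The logarithmic derivative of `W V` is that of `W` plus the conjugate by `W` of that of `V`;
this is why stability under conjugation is part of the structure. -/
theorem IsIntegralOf.mul {W W' V V' : PowerSeries A} (hW : IsIntegralOf S W W')
    (hV : IsIntegralOf S V V') : IsIntegralOf S (W * V) (V' * W') where
  mul_inv := by rw [mul_assoc, ← mul_assoc V, hV.mul_inv, one_mul, hW.mul_inv]
  inv_mul := by rw [mul_assoc, ← mul_assoc W', hW.inv_mul, one_mul, hV.inv_mul]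
  euler_mul_inv := by
    have : euler (W * V) * (V' * W') =
        euler W * (V * V') * W' + W * (euler V * V') * W' := by
      rw [euler_mul]
      noncomm_ring
    rw [this, hV.mul_inv, mul_one]
    exact Submodule.add_mem _ hW.euler_mul_inv (hW.conj _ hV.euler_mul_inv)
  conj y hy := by
    have : W * V * y * (V' * W') = W * (V * y * V') * W' := by noncomm_ring
    rw [this]
    exact hW.conj _ (hV.conj _ hy)

variable [CharZero K]

variable (K) in
/-- A power series with zero Euler derivative is constant. -/
theorem eq_C_of_euler_eq_zero {R : Type*} [Ring R] [Module K R] {a : PowerSeries R}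
    (h : euler a = 0) : a = C (constantCoeff a) := by
  ext n
  rw [coeff_C]
  split_ifs with hn
  · rw [hn, coeff_zero_eq_constantCoeff]
  · have : n • coeff n a = 0 := by rw [← coeff_euler, h, map_zero]
    rw [← Nat.cast_smul_eq_nsmul K] at this
    exact (smul_eq_zero.mp this).resolve_left (by exact_mod_cast hn)

/-- The product `exp(zΘ) exp(-zΘ)` has zero derivative in `z`, since the two contributions `exp(zΘ)
Θ exp(-zΘ)` cancel, and its constant term is `1`. -/
theorem expGen_mul_expGen_neg (Θ : PowerSeries A) : expGen K Θ * expGen K (-Θ) = 1 := by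
  have h : euler (expGen K Θ * expGen K (-Θ)) = 0 := by
    rw [euler_mul, euler_expGen', euler_expGen (-Θ), map_neg, mul_assoc, mul_assoc,
      ← mul_assoc (expGen K Θ) X, (commute_X (expGen K Θ)).eq, mul_assoc]
    simp
  rw [eq_C_of_euler_eq_zero K h, map_mul, constantCoeff_expGen, constantCoeff_expGen, mul_one,
    map_one]

theorem formalExp_mul_formalExp_neg {Θ : PowerSeries A} (h : constantCoeff Θ = 0) :
    formalExp K Θ * formalExp K (-Θ) = 1 := by
  rw [← adicSum_expGen, ← adicSum_expGen, adicSum_coeff_mul (isAdic_expGen h)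
    (isAdic_expGen (by rw [map_neg, h, neg_zero])), expGen_mul_expGen_neg, ← map_one (C (R := PowerSeries A)),
    adicSum_coeff_C]

theorem formalExp_neg_mul_formalExp {Θ : PowerSeries A} (h : constantCoeff Θ = 0) :
    formalExp K (-Θ) * formalExp K Θ = 1 := by
  have := formalExp_mul_formalExp_neg (K := K) (Θ := -Θ) (by rw [map_neg, h, neg_zero])
  rwa [neg_neg] at this

theorem expTerm_add {Θ Ξ : PowerSeries A} (h : Commute Θ Ξ) (m : ℕ) :
    expTerm K (Θ + Ξ) m =
      ∑ p ∈ Finset.HasAntidiagonal.antidiagonal m, expTerm K Θ p.1 * expTerm K Ξ p.2 := by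
  rw [expTerm, h.add_pow', Finset.smul_sum]
  refine Finset.sum_congr rfl ?_
  rintro ⟨p, q⟩ hpq
  rw [Finset.HasAntidiagonal.mem_antidiagonal] at hpq
  simp only at hpq ⊢
  subst hpq
  rw [expTerm, expTerm, smul_mul_smul_comm, ← Nat.cast_smul_eq_nsmul K, smul_smul]
  congr 1
  rw [Nat.cast_add_choose]
  have h1 : ((p + q).factorial : K) ≠ 0 := by exact_mod_cast (p + q).factorial_ne_zero
  have h2 : (p.factorial : K) ≠ 0 := by exact_mod_cast p.factorial_ne_zero
  have h3 : (q.factorial : K) ≠ 0 := by exact_mod_cast q.factorial_ne_zero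
  field_simp

theorem formalExp_add {Θ Ξ : PowerSeries A} (h : Commute Θ Ξ) (hΘ : constantCoeff Θ = 0)
    (hΞ : constantCoeff Ξ = 0) :
    formalExp K (Θ + Ξ) = formalExp K Θ * formalExp K Ξ := by
  rw [formalExp_eq_adicSum, formalExp_eq_adicSum, formalExp_eq_adicSum,
    adicSum_mul (isAdic_expTerm hΘ) (isAdic_expTerm hΞ)]
  congr 1
  ext1 m
  exact expTerm_add h m

theorem mem_of_succ_nsmul_mem {V : Type*} [AddCommGroup V] [Module K V] {S : Submodule K V} {v : V}
    {k : ℕ} (h : (k + 1) • v ∈ S) : v ∈ S := by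
  rw [← Nat.cast_smul_eq_nsmul K] at h
  exact (S.smul_mem_iff (by exact_mod_cast Nat.succ_ne_zero k)).mp h

/-- Conjugation by the exponential of a series with coefficients in a Lie subalgebra preserves the
series with coefficients in this Lie subalgebra. -/
theorem formalExp_conj_mem (hS : ∀ x ∈ S, ∀ y ∈ S, x * y - y * x ∈ S) {x y : PowerSeries A}
    (hx : x ∈ coeffsIn S) (hx0 : constantCoeff x = 0) (hy : y ∈ coeffsIn S) :
    formalExp K x * y * formalExp K (-x) ∈ coeffsIn S := by
  have hx0' : constantCoeff (-x) = 0 := by rw [map_neg, hx0, neg_zero]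
  have h1 : formalExp K x * y * formalExp K (-x) =
      adicSum fun k => coeff k (expGen K x * C y * expGen K (-x)) := by
    rw [← adicSum_coeff_mul (IsAdic.coeff_mul (isAdic_expGen hx0) (isAdic_coeff_C y))
      (isAdic_expGen hx0'), ← adicSum_coeff_mul (isAdic_expGen hx0) (isAdic_coeff_C y),
      adicSum_expGen, adicSum_expGen, adicSum_coeff_C]
  rw [h1]
  apply adicSum_mem_coeffsIn
  set G := expGen K x * C y * expGen K (-x) with hG
  have hC : euler (C y) = 0 := by
    ext1 n
    rw [coeff_euler, coeff_C]
    split_ifs with h <;> simp [h]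
  -- `G(z) = exp(zx) y exp(-zx)` satisfies `G' = [x, G]`. In coefficients, `(k + 1) Gₖ₊₁ = [x, Gₖ]`,
  -- so membership propagates from `G₀ = y`.
  have hGe : euler G = X * (C x * G - G * C x) := by
    rw [hG, euler_mul, euler_mul, hC, euler_expGen, euler_expGen' (-x), map_neg, mul_zero,
      add_zero, mul_neg, mul_neg, mul_neg, ← mul_assoc _ X, (commute_X (expGen K x * C y)).eq]
    noncomm_ring
  intro k
  induction k with
  | zero =>
    have : coeff 0 G = y := by
      rw [coeff_zero_eq_constantCoeff_apply, hG, map_mul, map_mul, constantCoeff_expGen,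
        constantCoeff_expGen, one_mul, mul_one]
      exact constantCoeff_C y
    rwa [this]
  | succ k ih =>
    apply mem_of_succ_nsmul_mem (K := K) (k := k)
    rw [← coeff_euler, hGe, coeff_succ_X_mul, map_sub, coeff_C_mul, coeff_mul_C]
    exact lie_mem_coeffsIn hS hx ih

/-- The logarithmic derivative of the exponential of a series with coefficients in a Lie subalgebra
has coefficients in this Lie subalgebra. -/
theorem euler_formalExp_mul_mem (hS : ∀ x ∈ S, ∀ y ∈ S, x * y - y * x ∈ S) {x : PowerSeries A}
    (hx : x ∈ coeffsIn S) (hx0 : constantCoeff x = 0) :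
    euler (formalExp K x) * formalExp K (-x) ∈ coeffsIn S := by
  have hx0' : constantCoeff (-x) = 0 := by rw [map_neg, hx0, neg_zero]
  set P : PowerSeries (PowerSeries A) := PowerSeries.mk fun k => euler (expTerm K x k) with hP
  have hPa : IsAdic fun k => coeff k P := by
    intro k n hn
    simp only [hP, coeff_mk]
    rw [coeff_euler, isAdic_expTerm hx0 k n hn, smul_zero]
  have hPs : adicSum (fun k => coeff k P) = euler (formalExp K x) := by
    ext n
    simp only [hP, coeff_mk, coeff_euler, adicSum, formalExp_eq_adicSum, Finset.smul_sum]
  rw [← hPs, ← adicSum_expGen, adicSum_coeff_mul hPa (isAdic_expGen hx0')]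
  apply adicSum_mem_coeffsIn
  -- `P` is the `T`-derivative of `exp(zx)`, so `F(z)` is the logarithmic `T`-derivative of
  -- `exp(zx)`. It satisfies `dF/dz = euler x + [x, F]` and `F(0) = 0`, and again the coefficients
  -- are obtained recursively inside `S`.
  set F := P * expGen K (-x) with hF
  have hPe : euler P = X * (C (euler x) * expGen K x + C x * P) := by
    ext1 k
    cases k with
    | zero => simp [coeff_euler]
    | succ k =>
      have h := congrArg euler (expTerm_succ (K := K) x k)
      rw [euler_mul] at h
      rw [coeff_euler, coeff_succ_X_mul, map_add, coeff_C_mul, coeff_C_mul, hP, coeff_mk, coeff_mk,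
        expGen, coeff_mk, ← h]
      ext n
      rw [coeff_euler, map_nsmul, map_nsmul, coeff_euler, smul_comm]
  have hFe : euler F = X * (C (euler x) + (C x * F - F * C x)) := by
    have h1 : X * (C (euler x)) = X * (C (euler x) * (expGen K x * expGen K (-x))) := by
      rw [expGen_mul_expGen_neg, mul_one]
    rw [mul_add, h1, hF, euler_mul, hPe, euler_expGen' (-x), map_neg,
      mul_neg, mul_neg, mul_neg, ← mul_assoc P X, (commute_X P).eq]
    noncomm_ring
  intro k
  induction k with
  | zero =>
    have : coeff 0 F = 0 := by
      rw [hF, coeff_zero_eq_constantCoeff_apply, map_mul, ← coeff_zero_eq_constantCoeff_apply P, hP, coeff_mk, expTerm_zero,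
        euler_one, zero_mul]
    rw [this]
    exact Submodule.zero_mem _
  | succ k ih =>
    apply mem_of_succ_nsmul_mem (K := K) (k := k)
    rw [← coeff_euler, hFe, coeff_succ_X_mul, map_add, map_sub, coeff_C_mul, coeff_mul_C, coeff_C]
    refine Submodule.add_mem _ ?_ (lie_mem_coeffsIn hS hx ih)
    split_ifs
    · exact euler_mem_coeffsIn hx
    · exact Submodule.zero_mem _

theorem isIntegralOf_formalExp (hS : ∀ x ∈ S, ∀ y ∈ S, x * y - y * x ∈ S) {x : PowerSeries A}
    (hx : x ∈ coeffsIn S) (hx0 : constantCoeff x = 0) :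
    IsIntegralOf S (formalExp K x) (formalExp K (-x)) where
  mul_inv := formalExp_mul_formalExp_neg hx0
  inv_mul := formalExp_neg_mul_formalExp hx0
  euler_mul_inv := euler_formalExp_mul_mem hS hx hx0
  conj _ hy := formalExp_conj_mem hS hx hx0 hy

/-- Two products of exponentials of series with coefficients in a Lie subalgebra are equal as soon
as they are congruent modulo a left ideal that meets the Lie subalgebra trivially. -/
theorem formalExp_mul_eq_of_sub_mem (hS : ∀ x ∈ S, ∀ y ∈ S, x * y - y * x ∈ S)
    {J : Submodule K A} (hJ : ∀ x, ∀ y ∈ J, x * y ∈ J) (hSJ : ∀ x ∈ S, x ∈ J → x = 0)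
    {a b c e : PowerSeries A} (ha : a ∈ coeffsIn S) (hb : b ∈ coeffsIn S) (hc : c ∈ coeffsIn S)
    (he : e ∈ coeffsIn S) (ha0 : constantCoeff a = 0) (hb0 : constantCoeff b = 0)
    (hc0 : constantCoeff c = 0) (he0 : constantCoeff e = 0)
    (h : formalExp K a * formalExp K b - formalExp K c * formalExp K e ∈ coeffsIn J) :
    formalExp K a * formalExp K b = formalExp K c * formalExp K e := by
  have hneg : ∀ {x : PowerSeries A}, x ∈ coeffsIn S → constantCoeff x = 0 →
      IsIntegralOf S (formalExp K (-x)) (formalExp K x) := fun {x} hx hx0 => by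
    have := isIntegralOf_formalExp hS (x := -x) (Submodule.neg_mem _ hx)
      (by rw [map_neg, hx0, neg_zero])
    rwa [neg_neg] at this
  have hQ := (hneg he he0).mul (hneg hc hc0)
  have hP := (isIntegralOf_formalExp hS ha ha0).mul (isIntegralOf_formalExp hS hb hb0)
  have hW := hQ.mul hP
  set Q := formalExp K (-e) * formalExp K (-c)
  set R := formalExp K c * formalExp K e
  set P := formalExp K a * formalExp K b
  set P' := formalExp K (-b) * formalExp K (-a)
  -- `Q` is the inverse of `R`, so `Q * P - 1 = Q * (P - R)` lies in the left ideal.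
  have hWJ : Q * P - 1 ∈ coeffsIn J := by
    have : Q * P - 1 = Q * (P - R) := by rw [mul_sub, hQ.mul_inv]
    rw [this]
    exact mul_mem_coeffsIn_of_left hJ _ h
  set w := euler (Q * P) * (P' * R) with hw
  have hwW : w * (Q * P) = euler (Q * P) := by
    rw [hw, mul_assoc, hW.inv_mul, mul_one]
  have hwJ : w ∈ coeffsIn J := by
    -- From `w W = euler W` with `W = Q * P`: write `w = w W - w (W - 1)`. Both terms are in the
    -- left ideal, as the Euler operator acts on each coefficient by a scalar.
    have h1 : w = euler (Q * P - 1) - w * (Q * P - 1) := by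
      have : euler (Q * P - 1) + euler 1 = euler (Q * P) := by rw [← euler_add, sub_add_cancel]
      rw [euler_one, add_zero] at this
      rw [this, mul_sub, hwW, mul_one]
      abel
    rw [h1]
    exact Submodule.sub_mem _ (euler_mem_coeffsIn hWJ) (mul_mem_coeffsIn_of_left hJ _ hWJ)
  have hw0 : w = 0 := by
    ext n
    exact hSJ _ (hW.euler_mul_inv n) (hwJ n)
  -- A vanishing logarithmic derivative makes `Q * P` constant, and every exponential has constant
  -- term `1`.
  have hW1 : Q * P = 1 := by
    rw [hw0, zero_mul] at hwW
    rw [eq_C_of_euler_eq_zero K hwW.symm]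
    simp only [Q, P, map_mul, constantCoeff_formalExp, mul_one, map_one]
  calc P = R * Q * P := by rw [hQ.inv_mul, one_mul]
    _ = R := by rw [mul_assoc, hW1, mul_one]

end FormalExpLie

/-! ### Relations in `U(L ▷ L*)` and the affine representation -/

section Relations

open UniversalEnvelopingAlgebra

variable {K L : Type*} [CommRing K] [LieRing L] [LieAlgebra K L] (ρ : L →ₗ⁅K⁆ Module.End K L)

theorem genH_eq (x : L) : genH ρ x = ι K (LieAlgebra.SemiDirectSum.inr (dualAction ρ) x) := rfl

theorem genH_lie (x y : L) : genH ρ x * genH ρ y - genH ρ y * genH ρ x = genH ρ ⁅x, y⁆ := by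
  rw [genH_eq, genH_eq, genH_eq, LieHom.map_lie, LieHom.map_lie,
    LieRing.of_associative_ring_bracket]

theorem genX_commute (ξ η : Module.Dual K L) : Commute (genX ρ ξ) (genX ρ η) := by
  have h : ⁅LieAlgebra.SemiDirectSum.inl (dualAction ρ) (AbelianDual.ofDual K L ξ),
      LieAlgebra.SemiDirectSum.inl (dualAction ρ) (AbelianDual.ofDual K L η)⁆ = 0 := by
    rw [← LieHom.map_lie, AbelianDual.lie_eq_zero, map_zero]
  have := congrArg (ι K) h
  rw [LieHom.map_lie, map_zero, LieRing.of_associative_ring_bracket, sub_eq_zero] at this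
  exact this

theorem genH_mul_genX (x : L) (ξ : Module.Dual K L) :
    genH ρ x * genX ρ ξ - genX ρ ξ * genH ρ x = -genX ρ (ξ ∘ₗ ρ x) := by
  have h : ⁅LieAlgebra.SemiDirectSum.inr (dualAction ρ) x,
      LieAlgebra.SemiDirectSum.inl (dualAction ρ) (AbelianDual.ofDual K L ξ)⁆ =
      -LieAlgebra.SemiDirectSum.inl (dualAction ρ) (AbelianDual.ofDual K L (ξ ∘ₗ ρ x)) := by
    rw [← map_neg]
    simp only [LieAlgebra.SemiDirectSum.inr_eq_mk, LieAlgebra.SemiDirectSum.inl_eq_mk,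
      LieAlgebra.SemiDirectSum.lie_eq_mk]
    congr 1
    · simp
      rfl
    · simp
  have := congrArg (ι K) h
  rwa [LieHom.map_lie, map_neg, LieRing.of_associative_ring_bracket] at this

theorem comulAlgHom_genX (ξ : Module.Dual K L) :
    Bialgebra.comulAlgHom K (USemidirect ρ) (genX ρ ξ) =
      genX ρ ξ ⊗ₜ[K] 1 + 1 ⊗ₜ[K] genX ρ ξ :=
  comulHom_ι K _ _

theorem comulAlgHom_genH (x : L) :
    Bialgebra.comulAlgHom K (USemidirect ρ) (genH ρ x) =
      genH ρ x ⊗ₜ[K] 1 + 1 ⊗ₜ[K] genH ρ x :=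
  comulHom_ι K _ _

theorem counitAlgHom_genX (ξ : Module.Dual K L) :
    Bialgebra.counitAlgHom K (USemidirect ρ) (genX ρ ξ) = 0 :=
  counitHom_ι K _ _

theorem counitAlgHom_genH (x : L) :
    Bialgebra.counitAlgHom K (USemidirect ρ) (genH ρ x) = 0 :=
  counitHom_ι K _ _

end Relations

section AffineRep

variable {K L : Type*} [CommRing K] [LieRing L] [LieAlgebra K L]

variable (K) in
/-- The projection `(w, c) ↦ (0, c)` of `L × K`. -/
def originProj (L : Type*) [AddCommGroup L] [Module K L] : Module.End K (L × K) :=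
  LinearMap.inr K L K ∘ₗ LinearMap.snd K L K

/-- The infinitesimal translation `(w, c) ↦ (c v, 0)` of `L × K`. -/
def translationEnd (K : Type*) {L : Type*} [CommRing K] [AddCommGroup L] [Module K L] :
    L →ₗ[K] Module.End K (L × K) where
  toFun v := LinearMap.inl K L K ∘ₗ (LinearMap.snd K L K).smulRight v
  map_add' v w := by ext <;> simp
  map_smul' c v := by ext <;> simp

theorem translationEnd_apply (v : L) (w : L × K) : translationEnd K v w = (w.2 • v, 0) := rfl

theorem originProj_apply (w : L × K) : originProj K L w = (0, w.2) := rfl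

/-- The affine representation `x ↦ (w ↦ ρ(x) w + D x)` of a Lie algebra defined by a linear
representation `ρ` and a 1-cocycle `D`, realised on `L × K`. -/
def affineRep (ρ : L →ₗ⁅K⁆ Module.End K L) (D : L →ₗ[K] L)
    (hD : ∀ x y, D ⁅x, y⁆ = ρ x (D y) - ρ y (D x)) : L →ₗ⁅K⁆ Module.End K (L × K) where
  toFun x := LinearMap.inl K L K ∘ₗ ρ x ∘ₗ LinearMap.fst K L K + translationEnd K (D x)
  map_add' x y := by
    simp only [map_add, LinearMap.add_comp, LinearMap.comp_add]
    abel
  map_smul' c x := by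
    simp only [map_smul, LinearMap.smul_comp, LinearMap.comp_smul, smul_add, RingHom.id_apply]
  map_lie' {x y} := by
    refine LinearMap.ext fun w => ?_
    have h : ∀ z w, (LinearMap.inl K L K ∘ₗ ρ z ∘ₗ LinearMap.fst K L K + translationEnd K (D z)) w =
        (ρ z w.1 + w.2 • D z, 0) := fun z w => by simp [translationEnd_apply]
    rw [LieRing.of_associative_ring_bracket, LinearMap.sub_apply, Module.End.mul_apply,
      Module.End.mul_apply, h, h, h, h, h, hD, LieHom.map_lie, LieRing.of_associative_ring_bracket]
    refine Prod.ext ?_ ?_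
    · simp only [LinearMap.sub_apply, Module.End.mul_apply, map_add, map_smul, smul_sub, zero_smul,
        add_zero, Prod.fst_sub]
      abel
    · simp

variable (ρ : L →ₗ⁅K⁆ Module.End K L) (D : L →ₗ[K] L)
    (hD : ∀ x y, D ⁅x, y⁆ = ρ x (D y) - ρ y (D x))

theorem affineRep_apply (x : L) (w : L × K) :
    affineRep ρ D hD x w = (ρ x w.1 + w.2 • D x, 0) := by
  simp [affineRep, translationEnd_apply]

/-- The point `(0, 1)` plays the part of the origin of the affine space `L`, and right
multiplication by `originProj` is evaluation at it. This relation and the next one express the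
action on the origin and on translations inside the algebra of endomorphisms, where series with
coefficients in other algebras can be tensored on. -/
theorem affineRep_mul_originProj (x : L) :
    affineRep ρ D hD x * originProj K L = translationEnd K (D x) := by
  refine LinearMap.ext fun w => ?_
  rw [Module.End.mul_apply, affineRep_apply, originProj_apply, translationEnd_apply, map_zero,
    zero_add]

theorem affineRep_mul_translationEnd (x v : L) :
    affineRep ρ D hD x * translationEnd K v = translationEnd K (ρ x v) := by
  refine LinearMap.ext fun w => ?_
  rw [Module.End.mul_apply, affineRep_apply, translationEnd_apply, translationEnd_apply, map_smul,
    zero_smul, add_zero]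

/-- The representation of `U(L ▷ L*)` defined by the affine representation of `L`. -/
noncomputable def affineUHom : USemidirect ρ →ₐ[K] Module.End K (L × K) :=
  UniversalEnvelopingAlgebra.lift K
    ((affineRep ρ D hD).comp (LieAlgebra.SemiDirectSum.projr (dualAction ρ)))

theorem affineUHom_genH (x : L) : affineUHom ρ D hD (genH ρ x) = affineRep ρ D hD x :=
  UniversalEnvelopingAlgebra.lift_ι_apply _ _ _

end AffineRep

/-! ### The exponent of the twisting element -/

section Exponent

open PowerSeries

variable {𝕜 : Type*} [RCLike 𝕜] {L : Type*} [LieRing L] [LieAlgebra 𝕜 L] {d : ℕ}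
  (b : Module.Basis (Fin d) 𝕜 L) (ψ : L → L)
  {A B : Type*} [Ring A] [Algebra 𝕜 A] [Ring B] [Algebra 𝕜 B]

/-- The part of degree `n` of the Taylor series of `ψ^ν`, evaluated at elements of an algebra. -/
noncomputable def taylorTerm (ν : Fin d) (n : ℕ) (x : Fin d → A) : A :=
  ((n.factorial : 𝕜)⁻¹) • ∑ i : Fin n → Fin d,
    (iteratedFDeriv 𝕜 n (coordFun b ψ ν) 0 fun k => Pi.single (i k) 1) •
      (List.ofFn fun k => x (i k)).prod

theorem map_taylorTerm (f : A →ₐ[𝕜] B) (ν : Fin d) (n : ℕ) (x : Fin d → A) :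
    f (taylorTerm b ψ ν n x) = taylorTerm b ψ ν n (f ∘ x) := by
  simp only [taylorTerm, map_smul, map_sum, map_list_prod, List.map_ofFn]
  rfl

theorem taylorTerm_mem (S : Subalgebra 𝕜 A) (ν : Fin d) (n : ℕ) {x : Fin d → A}
    (hx : ∀ i, x i ∈ S) : taylorTerm b ψ ν n x ∈ S := by
  refine S.smul_mem (S.sum_mem fun i _ => S.smul_mem (S.list_prod_mem ?_) _) _
  intro a ha
  obtain ⟨k, rfl⟩ := (List.mem_ofFn' _ _).mp ha
  exact hx _

theorem commute_taylorTerm {y : A} (ν : Fin d) (n : ℕ) {x : Fin d → A}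
    (hx : ∀ i, Commute y (x i)) : Commute y (taylorTerm b ψ ν n x) := by
  have := taylorTerm_mem b ψ (Subalgebra.centralizer 𝕜 {y}) ν n (x := x) (fun i => by
    rw [Subalgebra.mem_centralizer_iff]
    rintro _ rfl
    exact hx i)
  rw [Subalgebra.mem_centralizer_iff] at this
  exact this y rfl

theorem taylorTerm_zero (hψ : ψ 0 = 0) (ν : Fin d) (x : Fin d → A) :
    taylorTerm b ψ ν 0 x = 0 := by
  simp [taylorTerm, coordFun, hψ]

/-- The series `- ∑_ν ψ^ν(x) h_ν`. -/
noncomputable def twistExponent (x h : Fin d → A) : PowerSeries A :=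
  PowerSeries.mk fun n => -∑ ν, taylorTerm b ψ ν n x * h ν

theorem extend_twistExponent (f : A →ₐ[𝕜] B) (x h : Fin d → A) :
    extend f (twistExponent b ψ x h) = twistExponent b ψ (f ∘ x) (f ∘ h) := by
  ext n
  simp only [extend, twistExponent, coeff_map, coeff_mk]
  change f _ = _
  simp only [map_neg, map_sum, map_mul, map_taylorTerm, Function.comp_apply]

theorem constantCoeff_twistExponent (hψ : ψ 0 = 0) (x h : Fin d → A) :
    constantCoeff (twistExponent b ψ x h) = 0 := by
  rw [← coeff_zero_eq_constantCoeff_apply, twistExponent, coeff_mk]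
  simp [taylorTerm_zero b ψ hψ]

theorem twistExponent_add (x h h' : Fin d → A) :
    twistExponent b ψ x (h + h') = twistExponent b ψ x h + twistExponent b ψ x h' := by
  ext n
  simp only [twistExponent, map_add, coeff_mk, Pi.add_apply, mul_add, Finset.sum_add_distrib,
    neg_add]

theorem twistExponent_zero (x : Fin d → A) : twistExponent b ψ x 0 = 0 := by
  ext n
  simp [twistExponent]

theorem twistExponent_mem_coeffsIn {S : Submodule 𝕜 A} {x h : Fin d → A}
    (H : ∀ ν n, taylorTerm b ψ ν n x * h ν ∈ S) : twistExponent b ψ x h ∈ coeffsIn S := by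
  intro n
  rw [twistExponent, coeff_mk]
  exact S.neg_mem (S.sum_mem fun ν _ => H ν n)

/-- An element that commutes with the `x i` and intertwines `h` and `h'` intertwines the
corresponding exponents. -/
theorem twistExponent_mul_C {y : A} {x h h' : Fin d → A} (hx : ∀ i, Commute y (x i))
    (hh : ∀ ν, h ν * y = y * h' ν) :
    twistExponent b ψ x h * C y = C y * twistExponent b ψ x h' := by
  ext n
  rw [coeff_mul_C, coeff_C_mul, twistExponent, twistExponent, coeff_mk, coeff_mk, neg_mul, mul_neg,
    Finset.sum_mul, Finset.mul_sum]
  congr 1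
  refine Finset.sum_congr rfl fun ν _ => ?_
  rw [mul_assoc, hh, ← mul_assoc, ← mul_assoc, (commute_taylorTerm b ψ ν n hx).eq]

theorem commute_twistExponent {x h x' h' : Fin d → A} (hxx : ∀ i j, Commute (x i) (x' j))
    (hxh : ∀ i j, Commute (x i) (h' j)) (hhx : ∀ i j, Commute (h i) (x' j))
    (hhh : ∀ i j, Commute (h i) (h' j)) :
    Commute (twistExponent b ψ x h) (twistExponent b ψ x' h') := by
  have key : ∀ m n, Commute (coeff m (twistExponent b ψ x h)) (coeff n (twistExponent b ψ x' h')) := by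
    intro m n
    rw [twistExponent, twistExponent, coeff_mk, coeff_mk]
    refine Commute.neg_left (Commute.neg_right (Commute.sum_left _ _ _ fun ν _ =>
      Commute.sum_right _ _ _ fun μ _ => ?_))
    refine Commute.mul_left (Commute.mul_right ?_ ?_) (Commute.mul_right ?_ (hhh _ _))
    · exact commute_taylorTerm b ψ _ _ fun j => (commute_taylorTerm b ψ _ _ fun i =>
        (hxx i j).symm).symm
    · exact (commute_taylorTerm b ψ _ _ fun i => (hxh i μ).symm).symm
    · exact commute_taylorTerm b ψ _ _ fun j => hhx ν j
  ext n
  rw [coeff_mul, coeff_mul, ← Finset.Nat.sum_antidiagonal_swap]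
  exact Finset.sum_congr rfl fun p _ => key _ _

/-- In this form the element is determined by the images of `X ⊗ 1` and `1 ⊗ H`, so that its image
under any algebra homomorphism can be read off. -/
theorem twistingElement_eq (ρ : L →ₗ⁅𝕜⁆ Module.End 𝕜 L) :
    twistingElement ρ b ψ = formalExp 𝕜 (twistExponent b ψ
      (fun i => genX ρ (b.coord i) ⊗ₜ[𝕜] 1) (fun ν => 1 ⊗ₜ[𝕜] genH ρ (b ν))) := by
  rw [twistingElement]
  congr 1
  ext n
  rw [twistExponent, coeff_mk, coeff_mk]
  congr 1
  refine Finset.sum_congr rfl fun ν _ => ?_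
  have h := map_taylorTerm b ψ (Algebra.TensorProduct.includeLeft : USemidirect ρ →ₐ[𝕜]
    USemidirect ρ ⊗[𝕜] USemidirect ρ) ν n (fun i => genX ρ (b.coord i))
  have h' : taylorTerm b ψ ν n (fun i => genX ρ (b.coord i) ⊗ₜ[𝕜] (1 : USemidirect ρ)) =
      coeff n (taylorX ρ b ψ ν) ⊗ₜ[𝕜] 1 := by
    rw [taylorX, coeff_mk]
    exact h.symm
  rw [h', Algebra.TensorProduct.tmul_mul_tmul, mul_one, one_mul]

end Exponent

/-! ### From identities at points to polynomial identities. -/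

section TensorEvaluation

/-- An element of `K[x₁, …, x_d] ⊗ F` that vanishes at all points of `K^d` is zero. -/
theorem MvPolynomial.tensor_eq_of_eval {K : Type*} [Field K] [Infinite K] {σ : Type*} {F : Type*}
    [AddCommGroup F] [Module K F] {s t : MvPolynomial σ K ⊗[K] F}
    (h : ∀ y : σ → K, TensorProduct.lid K F ((MvPolynomial.aeval y).toLinearMap.rTensor F s) =
      TensorProduct.lid K F ((MvPolynomial.aeval y).toLinearMap.rTensor F t)) : s = t := by
  let v := Module.Basis.ofVectorSpace K F
  let w := Algebra.TensorProduct.basis (MvPolynomial σ K) v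
  apply w.repr.injective
  ext1 i
  apply MvPolynomial.funext
  intro y
  -- Relative to a basis of `F` the coordinates are polynomials, and evaluation at `y` commutes with
  -- taking coordinates; over an infinite field a polynomial is determined by its values.
  have key : ∀ u : MvPolynomial σ K ⊗[K] F, MvPolynomial.eval y (w.repr u i) =
      v.repr (TensorProduct.lid K F ((MvPolynomial.aeval y).toLinearMap.rTensor F u)) i := by
    intro u
    induction u with
    | zero => simp
    | add a b ha hb => simp only [map_add, Finsupp.add_apply, ha, hb]
    | tmul p f =>
      simp [w]
  rw [key, key, h]

end TensorEvaluation

/-! ### The twist identity evaluated at the origin of the affine representation. -/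

section Twist

open PowerSeries

variable {𝕜 : Type*} [RCLike 𝕜] {L : Type*} [LieRing L] [LieAlgebra 𝕜 L] {d : ℕ}
  (b : Module.Basis (Fin d) 𝕜 L) (ψ : L → L)

theorem C_mul_extend {A B : Type*} [Ring A] [Algebra 𝕜 A] [Ring B] [Algebra 𝕜 B] (f : A →ₐ[𝕜] B)
    (y : A) : extend f (C y) = C (f y) := by
  rw [extend, PowerSeries.map_C]
  rfl

theorem extend_X {A B : Type*} [Ring A] [Algebra 𝕜 A] [Ring B] [Algebra 𝕜 B] (f : A →ₐ[𝕜] B) :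
    extend f (X : PowerSeries A) = X := by
  rw [extend, PowerSeries.map_X]

open scoped IsMulCommutative in
/-- If the exponential identity `exp(-α(ψ(T y))) p = p - T E_y` holds at all points `y` then it holds
for commuting elements of an algebra in the place of the coordinates of `y`. -/
theorem formalExp_mul_originProj {Q : Type*} [Ring Q] [Algebra 𝕜 Q] {p : Q}
    {α E : Fin d → Q} (hpt : ∀ y : Fin d → 𝕜, formalExp 𝕜 (twistExponent b ψ
      (fun i => algebraMap 𝕜 Q (y i)) α) * C p = C p - X * C (∑ i, y i • E i))
    {B : Type*} [Ring B] [Algebra 𝕜 B] (β : Q →ₐ[𝕜] B) {x : Fin d → B}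
    (hx : ∀ i j, Commute (x i) (x j)) (hβ : ∀ i q, Commute (x i) (β q)) :
    formalExp 𝕜 (twistExponent b ψ x (β ∘ α)) * C (β (p)) =
      C (β (p)) - X * C (∑ i, x i * β (E i)) := by
  let R := MvPolynomial (Fin d) 𝕜
  let inQ : Q →ₐ[𝕜] R ⊗[𝕜] Q := Algebra.TensorProduct.includeRight
  let inR : R →ₐ[𝕜] R ⊗[𝕜] Q := Algebra.TensorProduct.includeLeft
  -- Universal case: the coordinates are the variables of a polynomial ring tensored with `Q`. Each
  -- coefficient of `T` is a single element of `R ⊗ Q`, hence can be tested at points, where the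
  -- identity is `hpt`.
  have univ : formalExp 𝕜 (twistExponent b ψ (fun i => inR (MvPolynomial.X i))
      (fun ν => inQ (α ν))) * C (inQ (p)) =
      C (inQ (p)) -
        X * C (∑ i, inR (MvPolynomial.X i) * inQ (E i)) := by
    ext n
    apply MvPolynomial.tensor_eq_of_eval
    intro y
    let ev : R ⊗[𝕜] Q →ₐ[𝕜] Q := (Algebra.TensorProduct.lid 𝕜 Q).toAlgHom.comp
      (Algebra.TensorProduct.map (MvPolynomial.aeval y) (AlgHom.id 𝕜 Q))
    have hev : ∀ u, TensorProduct.lid 𝕜 Q ((MvPolynomial.aeval y).toLinearMap.rTensor Q u) =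
        ev u := fun u => rfl
    have hevR : ∀ r, ev (inR r) = algebraMap 𝕜 Q (MvPolynomial.aeval y r) := fun r => by
      simp only [ev, inR, Algebra.algebraMap_eq_smul_one]
      simp
      rfl
    have hevQ : ∀ q, ev (inQ q) = q := fun q => by
      simp [ev, inQ]
    have h := hpt y
    have h1 : ∀ P : PowerSeries (R ⊗[𝕜] Q), ev (coeff n P) = coeff n (extend ev P) :=
      fun P => rfl
    rw [hev, hev, h1, h1]
    congr 1
    rw [map_mul, map_sub, map_mul, extend_formalExp, extend_twistExponent, C_mul_extend,
      C_mul_extend, extend_X, hevQ, map_sum]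
    convert h using 3
    · congr 1
      · ext1 i
        simp only [Function.comp_apply, hevR, MvPolynomial.aeval_X]
      · ext1 i
        simp only [Function.comp_apply, hevQ]
    · refine congrArg C (Finset.sum_congr rfl fun i _ => ?_)
      rw [map_mul, hevR, hevQ, MvPolynomial.aeval_X, Algebra.smul_def]
  -- The commuting elements `x i` generate a commutative subalgebra, into which polynomials can be
  -- evaluated. Together with `β` this gives the homomorphism `Γ` that specialises the universal
  -- identity.
  let S : Subalgebra 𝕜 B := Algebra.adjoin 𝕜 (Set.range x)
  have : IsMulCommutative S := Algebra.isMulCommutative_adjoin 𝕜 (by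
    rintro _ ⟨i, rfl⟩ _ ⟨j, rfl⟩
    exact hx i j)
  let γ : R →ₐ[𝕜] B := S.val.comp
    (MvPolynomial.aeval fun i => (⟨x i, Algebra.subset_adjoin ⟨i, rfl⟩⟩ : S))
  have hγ : ∀ i, γ (MvPolynomial.X i) = x i := fun i =>
    congrArg S.val (MvPolynomial.aeval_X _ i)
  have hγβ : ∀ r q, Commute (γ r) (β q) := by
    intro r q
    induction r using MvPolynomial.induction_on with
    | C a =>
      have : γ (MvPolynomial.C a) = algebraMap 𝕜 B a := γ.commutes a
      rw [this]
      exact Algebra.commutes a (β q)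
    | add p p' hp hp' => rw [map_add]; exact hp.add_left hp'
    | mul_X p i hp => rw [map_mul, hγ]; exact hp.mul_left (hβ i q)
  let Γ : R ⊗[𝕜] Q →ₐ[𝕜] B := Algebra.TensorProduct.lift γ β hγβ
  have hΓR : ∀ r, Γ (inR r) = γ r := fun r => by simp [Γ, inR]
  have hΓQ : ∀ q, Γ (inQ q) = β q := fun q => by simp [Γ, inQ]
  have h := congrArg (extend Γ) univ
  rw [map_mul, map_sub, map_mul, extend_formalExp, extend_twistExponent, C_mul_extend,
      C_mul_extend, extend_X, hΓQ, map_sum] at h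
  convert h using 3
  · congr 1
    · ext1 i
      simp only [Function.comp_apply, hΓR, hγ]
    · ext1 i
      simp only [Function.comp_apply, hΓQ]
  · refine congrArg C (Finset.sum_congr rfl fun i _ => ?_)
    rw [map_mul, hΓR, hΓQ, hγ]

/-- Displacements of the origin add up. Write `Ω₁`, `Ω₂` for the sums `∑ x i * β (E i)` and `e` for
the exponential in `x₁` and `h₂`. On the left, `p` becomes `(p - T (Ω₁ + Ω₂)) e`. On the right, the
second factor turns `p` into `p - T Ω₂`; the first factor splits as a product of commuting
exponentials, turns `p` into `(p - T Ω₁) e`, and turns `Ω₂` into `Ω₂ e` by the invariance `hinv`.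
The results coincide. -/
theorem twist_congruence (hψ : ψ 0 = 0) {Q : Type*} [Ring Q] [Algebra 𝕜 Q]
    {p : Q} {α E : Fin d → Q} (hpt : ∀ y : Fin d → 𝕜, formalExp 𝕜 (twistExponent b ψ
      (fun i => algebraMap 𝕜 Q (y i)) α) * C p = C p - X * C (∑ i, y i • E i))
    {B : Type*} [Ring B] [Algebra 𝕜 B] (β : Q →ₐ[𝕜] B) {x₁ x₂ h₂ : Fin d → B}
    (hx₁ : ∀ i j, Commute (x₁ i) (x₁ j)) (hx₂ : ∀ i j, Commute (x₂ i) (x₂ j))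
    (hx₁₂ : ∀ i j, Commute (x₁ i) (x₂ j)) (hβ₁ : ∀ i q, Commute (x₁ i) (β q))
    (hβ₂ : ∀ i q, Commute (x₂ i) (β q)) (hh₁ : ∀ i j, Commute (h₂ i) (x₁ j))
    (hhβ : ∀ i q, Commute (h₂ i) (β q))
    (hinv : ∀ ν, (h₂ ν + β (α ν)) * ∑ i, x₂ i * β (E i) =
      (∑ i, x₂ i * β (E i)) * h₂ ν) :
    formalExp 𝕜 (twistExponent b ψ (x₁ + x₂) (β ∘ α)) *
        formalExp 𝕜 (twistExponent b ψ x₁ h₂) * C (β (p)) =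
      formalExp 𝕜 (twistExponent b ψ x₁ (h₂ + β ∘ α)) *
        formalExp 𝕜 (twistExponent b ψ x₂ (β ∘ α)) * C (β (p)) := by
  have h0 : ∀ x h : Fin d → B, constantCoeff (twistExponent b ψ x h) = 0 :=
    constantCoeff_twistExponent b ψ hψ
  set h₃ : Fin d → B := β ∘ α with hh₃
  set Ω₁ := ∑ i, x₁ i * β (E i) with hΩ₁
  set Ω₂ := ∑ i, x₂ i * β (E i) with hΩ₂
  set e := formalExp 𝕜 (twistExponent b ψ x₁ h₂) with he
  have hep : e * C (β p) = C (β p) * e :=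
    formalExp_intertwine (twistExponent_mul_C b ψ (fun i => (hβ₁ i _).symm)
      (fun ν => hhβ ν _)) (h0 _ _) (h0 _ _)
  have h₁ : formalExp 𝕜 (twistExponent b ψ x₁ h₃) * C (β p) = C (β p) - X * C Ω₁ :=
    formalExp_mul_originProj b ψ hpt β hx₁ hβ₁
  have h₂' : formalExp 𝕜 (twistExponent b ψ x₂ h₃) * C (β p) = C (β p) - X * C Ω₂ :=
    formalExp_mul_originProj b ψ hpt β hx₂ hβ₂
  have h₁₂ : formalExp 𝕜 (twistExponent b ψ (x₁ + x₂) h₃) * C (β p) = C (β p) - X * (C Ω₁ + C Ω₂) := by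
    have := formalExp_mul_originProj b ψ hpt β (x := x₁ + x₂)
      (fun i j => ((hx₁ i j).add_right (hx₁₂ i j)).add_left
        ((hx₁₂ j i).symm.add_right (hx₂ i j)))
      (fun i q => (hβ₁ i q).add_left (hβ₂ i q))
    rw [this, ← map_add, hΩ₁, hΩ₂, ← Finset.sum_add_distrib]
    simp only [Pi.add_apply, add_mul]
  have hΩ : formalExp 𝕜 (twistExponent b ψ x₁ (h₂ + h₃)) * C Ω₂ = C Ω₂ * e := by
    refine formalExp_intertwine (twistExponent_mul_C b ψ (fun i => ?_) hinv) (h0 _ _) (h0 _ _)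
    exact Commute.sum_left _ _ _ fun j _ => ((hx₁₂ i j).mul_right (hβ₁ i _)).symm
  have hsum : formalExp 𝕜 (twistExponent b ψ x₁ (h₂ + h₃)) =
      formalExp 𝕜 (twistExponent b ψ x₁ h₃) * e := by
    rw [add_comm, twistExponent_add]
    refine formalExp_add (commute_twistExponent b ψ hx₁ (fun i j => (hh₁ j i).symm)
      (fun i j => (hβ₁ j _).symm) (fun i j => (hhβ j _).symm)) (h0 _ _) (h0 _ _)
  calc _ = formalExp 𝕜 (twistExponent b ψ (x₁ + x₂) h₃) * C (β p) * e := by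
        rw [mul_assoc, hep, mul_assoc]
    _ = (C (β p) - X * C Ω₁) * e - X * (C Ω₂ * e) := by
        rw [h₁₂]
        noncomm_ring
    _ = formalExp 𝕜 (twistExponent b ψ x₁ (h₂ + h₃)) * C (β p) -
          X * (formalExp 𝕜 (twistExponent b ψ x₁ (h₂ + h₃)) * C Ω₂) := by
        rw [hΩ, hsum, mul_assoc _ e, hep, ← mul_assoc (formalExp 𝕜 (twistExponent b ψ x₁ h₃)), h₁]
    _ = _ := by
        rw [mul_assoc, h₂', mul_sub, ← mul_assoc _ X, (commute_X _).eq, mul_assoc X]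

end Twist

/-! ### Lie subalgebras of the form `C N`. -/

section LieSubmodule

variable {K A : Type*} [CommRing K] [Ring A] [Algebra K A]

/-- The commutator with an element `n` preserves a commutative subalgebra if it maps generators into
this subalgebra. -/
theorem commutator_mem_adjoin {s : Set A} {n : A}
    (h : ∀ a ∈ s, n * a - a * n ∈ Algebra.adjoin K s) {c : A} (hc : c ∈ Algebra.adjoin K s) :
    n * c - c * n ∈ Algebra.adjoin K s := by
  induction hc using Algebra.adjoin_induction with
  | mem x hx => exact h x hx
  | algebraMap r =>
    rw [Algebra.commutes, sub_self]
    exact zero_mem _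
  | add x y _ _ hx hy =>
    have : n * (x + y) - (x + y) * n = (n * x - x * n) + (n * y - y * n) := by noncomm_ring
    rw [this]
    exact add_mem hx hy
  | mul x y hx' hy' hx hy =>
    have : n * (x * y) - x * y * n = (n * x - x * n) * y + x * (n * y - y * n) := by noncomm_ring
    rw [this]
    exact add_mem (mul_mem hx hy') (mul_mem hx' hy)

/-- If `C` is a commutative subalgebra and `N` a space of elements that is closed under commutators
and normalizes `C` then `C N` is closed under commutators. -/
theorem commutator_mem_mul {C : Subalgebra K A} {N : Submodule K A}
    (hC : ∀ c ∈ C, ∀ c' ∈ C, Commute c c') (hN : ∀ n ∈ N, ∀ n' ∈ N, n * n' - n' * n ∈ N)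
    (hNC : ∀ n ∈ N, ∀ c ∈ C, n * c - c * n ∈ C) :
    ∀ x ∈ Subalgebra.toSubmodule C * N, ∀ y ∈ Subalgebra.toSubmodule C * N,
      x * y - y * x ∈ Subalgebra.toSubmodule C * N := by
  intro x hx y hy
  induction hx using Submodule.mul_induction_on' with
  | add x _ x' _ hx hx' =>
    have : (x + x') * y - y * (x + x') = (x * y - y * x) + (x' * y - y * x') := by noncomm_ring
    rw [this]
    exact add_mem hx hx'
  | mem_mul_mem c hc n hn =>
    induction hy using Submodule.mul_induction_on' with
    | add y _ y' _ hy hy' =>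
      have : c * n * (y + y') - (y + y') * (c * n) =
        (c * n * y - y * (c * n)) + (c * n * y' - y' * (c * n)) := by noncomm_ring
      rw [this]
      exact add_mem hy hy'
    | mem_mul_mem c' hc' n' hn' =>
      -- Moving the elements of `C` to the left produces commutators in `N`, commutators that land
      -- in `C`, and a last term that vanishes because `C` is commutative.
      have : c * n * (c' * n') - c' * n' * (c * n) =
          c * c' * (n * n' - n' * n) + c * (n * c' - c' * n) * n' - c' * (n' * c - c * n') * n
            + (c * c' - c' * c) * n' * n := by noncomm_ring
      rw [this, (hC c hc c' hc').eq, sub_self, zero_mul, zero_mul, add_zero]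
      refine sub_mem (add_mem ?_ ?_) ?_
      · exact Submodule.mul_mem_mul (C.mul_mem hc' hc) (hN n hn n' hn')
      · exact Submodule.mul_mem_mul (C.mul_mem hc (hNC n hn c' hc')) hn'
      · exact Submodule.mul_mem_mul (C.mul_mem hc' (hNC n' hn' c hc)) hn

end LieSubmodule

/-! ### The Lie subalgebra and the left ideal in the tensor cube. -/

section Legs

variable {K L : Type*} [CommRing K] [LieRing L] [LieAlgebra K L] (ρ : L →ₗ⁅K⁆ Module.End K L)

/-- `ξ ⊗ 1 ⊗ 1`. -/
noncomputable def legX₁ : Module.Dual K L →ₗ[K]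
    USemidirect ρ ⊗[K] (USemidirect ρ ⊗[K] USemidirect ρ) :=
  (Algebra.TensorProduct.includeLeft : USemidirect ρ →ₐ[K] USemidirect ρ ⊗[K]
    (USemidirect ρ ⊗[K] USemidirect ρ)).toLinearMap ∘ₗ genX ρ

/-- The embedding of the second and third factors. -/
noncomputable abbrev leg₂₃ : USemidirect ρ ⊗[K] USemidirect ρ →ₐ[K]
    USemidirect ρ ⊗[K] (USemidirect ρ ⊗[K] USemidirect ρ) :=
  Algebra.TensorProduct.includeRight

/-- `1 ⊗ ξ ⊗ 1`. -/
noncomputable def legX₂ : Module.Dual K L →ₗ[K]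
    USemidirect ρ ⊗[K] (USemidirect ρ ⊗[K] USemidirect ρ) :=
  ((leg₂₃ ρ).comp Algebra.TensorProduct.includeLeft).toLinearMap ∘ₗ genX ρ

/-- `1 ⊗ x ⊗ 1`. -/
noncomputable def legH₂ : L →ₗ[K] USemidirect ρ ⊗[K] (USemidirect ρ ⊗[K] USemidirect ρ) :=
  ((leg₂₃ ρ).comp Algebra.TensorProduct.includeLeft).toLinearMap ∘ₗ genH ρ

/-- `1 ⊗ 1 ⊗ x`. -/
noncomputable def legH₃ : L →ₗ[K] USemidirect ρ ⊗[K] (USemidirect ρ ⊗[K] USemidirect ρ) :=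
  ((leg₂₃ ρ).comp Algebra.TensorProduct.includeRight).toLinearMap ∘ₗ genH ρ

theorem legX₁_apply (ξ : Module.Dual K L) : legX₁ ρ ξ = genX ρ ξ ⊗ₜ[K] 1 := rfl

theorem legX₂_apply (ξ : Module.Dual K L) : legX₂ ρ ξ = 1 ⊗ₜ[K] (genX ρ ξ ⊗ₜ[K] 1) := rfl

theorem legH₂_apply (x : L) : legH₂ ρ x = 1 ⊗ₜ[K] (genH ρ x ⊗ₜ[K] 1) := rfl

theorem legH₃_apply (x : L) : legH₃ ρ x = 1 ⊗ₜ[K] (1 ⊗ₜ[K] genH ρ x) := rfl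

/-- The algebra generated by `L*` in the first two factors. -/
noncomputable def legsX : Subalgebra K (USemidirect ρ ⊗[K] (USemidirect ρ ⊗[K] USemidirect ρ)) :=
  Algebra.adjoin K (Set.range (legX₁ ρ) ∪ Set.range (legX₂ ρ))

/-- The space spanned by `L` in the last two factors. -/
noncomputable def legsH : Submodule K (USemidirect ρ ⊗[K] (USemidirect ρ ⊗[K] USemidirect ρ)) :=
  LinearMap.range (legH₂ ρ) ⊔ LinearMap.range (legH₃ ρ)

theorem legX₁_mem (ξ : Module.Dual K L) : legX₁ ρ ξ ∈ legsX ρ :=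
  Algebra.subset_adjoin (Or.inl ⟨ξ, rfl⟩)

theorem legX₂_mem (ξ : Module.Dual K L) : legX₂ ρ ξ ∈ legsX ρ :=
  Algebra.subset_adjoin (Or.inr ⟨ξ, rfl⟩)

theorem legH₂_mem (x : L) : legH₂ ρ x ∈ legsH ρ := Submodule.mem_sup_left ⟨x, rfl⟩

theorem legH₃_mem (x : L) : legH₃ ρ x ∈ legsH ρ := Submodule.mem_sup_right ⟨x, rfl⟩

theorem legsX_commute : ∀ c ∈ legsX ρ, ∀ c' ∈ legsX ρ, Commute c c' := by
  have : IsMulCommutative (legsX ρ) := Algebra.isMulCommutative_adjoin K (by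
    rintro _ (⟨ξ, rfl⟩ | ⟨ξ, rfl⟩) _ (⟨η, rfl⟩ | ⟨η, rfl⟩)
    all_goals
      simp only [legX₁_apply, legX₂_apply, Algebra.TensorProduct.tmul_mul_tmul, one_mul, mul_one,
        (genX_commute ρ ξ η).eq])
  intro c hc c' hc'
  exact congrArg Subtype.val (mul_comm' (⟨c, hc⟩ : legsX ρ) ⟨c', hc'⟩)

theorem legsH_lie : ∀ n ∈ legsH ρ, ∀ n' ∈ legsH ρ, n * n' - n' * n ∈ legsH ρ := by
  intro n hn n' hn'
  obtain ⟨_, ⟨x, rfl⟩, _, ⟨y, rfl⟩, rfl⟩ := Submodule.mem_sup.mp hn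
  obtain ⟨_, ⟨x', rfl⟩, _, ⟨y', rfl⟩, rfl⟩ := Submodule.mem_sup.mp hn'
  have : (legH₂ ρ x + legH₃ ρ y) * (legH₂ ρ x' + legH₃ ρ y') -
      (legH₂ ρ x' + legH₃ ρ y') * (legH₂ ρ x + legH₃ ρ y) = legH₂ ρ ⁅x, x'⁆ + legH₃ ρ ⁅y, y'⁆ := by
    simp only [legH₂_apply, legH₃_apply, mul_add, add_mul, Algebra.TensorProduct.tmul_mul_tmul,
      one_mul, mul_one, ← genH_lie, TensorProduct.tmul_sub, TensorProduct.sub_tmul]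
    abel
  rw [this]
  exact add_mem (legH₂_mem ρ _) (legH₃_mem ρ _)

/-- The only nontrivial commutators of generators are those of `1 ⊗ x ⊗ 1` with `1 ⊗ ξ ⊗ 1`, and
they are given by the dual action, so they stay in `L*`. -/
theorem legsH_normalize : ∀ n ∈ legsH ρ, ∀ c ∈ legsX ρ, n * c - c * n ∈ legsX ρ := by
  intro n hn c hc
  obtain ⟨_, ⟨x, rfl⟩, _, ⟨y, rfl⟩, rfl⟩ := Submodule.mem_sup.mp hn
  refine commutator_mem_adjoin ?_ hc
  rintro _ (⟨ξ, rfl⟩ | ⟨ξ, rfl⟩)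
  · have : (legH₂ ρ x + legH₃ ρ y) * legX₁ ρ ξ - legX₁ ρ ξ * (legH₂ ρ x + legH₃ ρ y) = 0 := by
      simp only [legH₂_apply, legH₃_apply, legX₁_apply, mul_add, add_mul,
        Algebra.TensorProduct.tmul_mul_tmul, one_mul, mul_one, sub_self]
    rw [this]
    exact zero_mem _
  · have : (legH₂ ρ x + legH₃ ρ y) * legX₂ ρ ξ - legX₂ ρ ξ * (legH₂ ρ x + legH₃ ρ y) =
        -legX₂ ρ (ξ ∘ₗ ρ x) := by
      rw [← map_neg]
      have h : genX ρ (-(ξ ∘ₗ ρ x)) = genH ρ x * genX ρ ξ - genX ρ ξ * genH ρ x := by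
        rw [genH_mul_genX, map_neg]
      simp only [legH₂_apply, legH₃_apply, legX₂_apply, mul_add, add_mul,
        Algebra.TensorProduct.tmul_mul_tmul, one_mul, mul_one, h, TensorProduct.tmul_sub,
        TensorProduct.sub_tmul]
      abel
    rw [this]
    exact neg_mem (legX₂_mem ρ _)

/-- Only the shape `w ⊗ 1` of these elements matters when homomorphisms are applied to the third
factor; it permits an induction on pure tensors. -/
theorem legsX_le : legsX ρ ≤ (embed₁₂ : USemidirect ρ ⊗[K] USemidirect ρ →ₐ[K] _).range := by
  refine Algebra.adjoin_le ?_
  rintro _ (⟨ξ, rfl⟩ | ⟨ξ, rfl⟩)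
  · exact ⟨genX ρ ξ ⊗ₜ 1, by simp [embed₁₂, legX₁_apply, Algebra.TensorProduct.one_def]⟩
  · exact ⟨1 ⊗ₜ genX ρ ξ, by simp [embed₁₂, legX₂_apply]⟩

/-- `id ⊗ id ⊗ ε`, with values in the tensor cube. -/
noncomputable def counitThird : USemidirect ρ ⊗[K] (USemidirect ρ ⊗[K] USemidirect ρ) →ₐ[K]
    USemidirect ρ ⊗[K] (USemidirect ρ ⊗[K] USemidirect ρ) :=
  Algebra.TensorProduct.map (AlgHom.id K _) (Algebra.TensorProduct.map (AlgHom.id K _)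
    ((Algebra.ofId K (USemidirect ρ)).comp (Bialgebra.counitAlgHom K (USemidirect ρ))))

variable {Q : Type*} [Ring Q] [Algebra K Q] (α : USemidirect ρ →ₐ[K] Q) (p : Q)

/-- The homomorphism `id ⊗ id ⊗ α`. -/
noncomputable def mapThird : USemidirect ρ ⊗[K] (USemidirect ρ ⊗[K] USemidirect ρ) →ₐ[K]
    USemidirect ρ ⊗[K] (USemidirect ρ ⊗[K] Q) :=
  Algebra.TensorProduct.map (AlgHom.id K _) (Algebra.TensorProduct.map (AlgHom.id K _) α)

/-- The embedding `q ↦ 1 ⊗ 1 ⊗ q`. -/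
noncomputable def inThird (Q : Type*) [Ring Q] [Algebra K Q] :
    Q →ₐ[K] USemidirect ρ ⊗[K] (USemidirect ρ ⊗[K] Q) :=
  Algebra.TensorProduct.includeRight.comp Algebra.TensorProduct.includeRight

theorem inThird_apply (q : Q) : inThird ρ Q q = 1 ⊗ₜ[K] (1 ⊗ₜ[K] q) := rfl

/-- The elements `m` of the tensor cube for which `(id ⊗ id ⊗ α)(m) (1 ⊗ 1 ⊗ p)` and
`(id ⊗ id ⊗ ε)(m)` vanish. -/
noncomputable def thirdAnnihilator :
    Submodule K (USemidirect ρ ⊗[K] (USemidirect ρ ⊗[K] USemidirect ρ)) :=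
  LinearMap.ker (LinearMap.mulRight K (inThird ρ Q p) ∘ₗ (mapThird ρ α).toLinearMap) ⊓
    LinearMap.ker (counitThird ρ).toLinearMap

theorem mem_thirdAnnihilator {m : USemidirect ρ ⊗[K] (USemidirect ρ ⊗[K] USemidirect ρ)} :
    m ∈ thirdAnnihilator ρ α p ↔
      mapThird ρ α m * inThird ρ Q p = 0 ∧ counitThird ρ m = 0 := Iff.rfl

/-- Both conditions are stable under left multiplication, because `p` stands on the right and the
two maps are multiplicative. -/
theorem mul_mem_thirdAnnihilator (x : USemidirect ρ ⊗[K] (USemidirect ρ ⊗[K] USemidirect ρ)) :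
    ∀ y ∈ thirdAnnihilator ρ α p, x * y ∈ thirdAnnihilator ρ α p := by
  intro y hy
  rw [mem_thirdAnnihilator] at hy ⊢
  rw [map_mul, map_mul, mul_assoc, hy.1, hy.2, mul_zero, mul_zero]
  exact ⟨rfl, rfl⟩

/-- An element `f H₂ + g H₃` is recovered from its two images. The counit in the third factor kills
`g H₃` and leaves `f H₂`. After multiplication by `p`, the map `r` in the third factor kills `f H₂`,
since `r p = 0`, and returns the argument `y` of `H₃`, since `r (α (genH ρ y) * p) = y`. -/
theorem eq_zero_of_mem_thirdAnnihilator {r : Q →ₗ[K] L} (hr : r p = 0)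
    (hr' : ∀ y, r (α (genH ρ y) * p) = y) :
    ∀ l ∈ Subalgebra.toSubmodule (legsX ρ) * legsH ρ, l ∈ thirdAnnihilator ρ α p → l = 0 := by
  let κ : USemidirect ρ ⊗[K] (USemidirect ρ ⊗[K] Q) →ₗ[K]
      USemidirect ρ ⊗[K] (USemidirect ρ ⊗[K] USemidirect ρ) :=
    TensorProduct.map LinearMap.id (TensorProduct.map LinearMap.id (genH ρ ∘ₗ r))
  -- The map `κ` rebuilds the `H₃` part, the counit supplies the `H₂` part. Both sides are linear,
  -- so it suffices to check products of a pure tensor with `legH₂ x + legH₃ y`.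
  have key : ∀ l ∈ Subalgebra.toSubmodule (legsX ρ) * legsH ρ,
      l = κ (mapThird ρ α l * inThird ρ Q p) + counitThird ρ l := by
    intro l hl
    induction hl using Submodule.mul_induction_on' with
    | add x _ y _ hx hy =>
      rw [map_add, map_add, add_mul, map_add, add_add_add_comm, ← hx, ← hy]
    | mem_mul_mem c hc n hn =>
      obtain ⟨w, rfl⟩ := legsX_le ρ hc
      obtain ⟨_, ⟨x, rfl⟩, _, ⟨y, rfl⟩, rfl⟩ := Submodule.mem_sup.mp hn
      clear hc hn
      change embed₁₂ w * _ = κ (mapThird ρ α (embed₁₂ w * _) * _) +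
        counitThird ρ (embed₁₂ w * _)
      induction w with
      | zero => simp
      | add w w' h h' =>
        simp only [map_add, add_mul] at h h' ⊢
        rw [add_add_add_comm, ← h, ← h']
      | tmul u v =>
        simp only [embed₁₂, Algebra.TensorProduct.map_tmul, AlgHom.id_apply,
          Algebra.TensorProduct.includeLeft_apply, legH₂_apply, legH₃_apply, mul_add,
          Algebra.TensorProduct.tmul_mul_tmul, mul_one, one_mul, map_add, mapThird, counitThird,
          inThird_apply, add_mul, κ, TensorProduct.map_tmul, LinearMap.id_apply,
          LinearMap.comp_apply, map_one, hr, hr', map_zero,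
          TensorProduct.tmul_zero, AlgHom.comp_apply, counitAlgHom_genH, zero_add, add_zero]
        abel
  intro l hl hl'
  rw [mem_thirdAnnihilator] at hl'
  rw [key l hl, hl'.1, hl'.2, map_zero, add_zero]

end Legs

/-! ### Homogeneity of the exponential. -/

section Homogeneous

open PowerSeries

variable {K H : Type*} [CommRing K] [Ring H] [Algebra K H]

theorem mul_mem_map₂_mk {S T S' T' S'' T'' : Submodule K H} (hS : S * S' ≤ S'') (hT : T * T' ≤ T'')
    {x y : H ⊗[K] H} (hx : x ∈ Submodule.map₂ (TensorProduct.mk K H H) S T)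
    (hy : y ∈ Submodule.map₂ (TensorProduct.mk K H H) S' T') :
    x * y ∈ Submodule.map₂ (TensorProduct.mk K H H) S'' T'' := by
  rw [Submodule.map₂_eq_span_image2] at hx hy
  induction hx using Submodule.span_induction with
  | zero => rw [zero_mul]; exact zero_mem _
  | add a b _ _ ha hb => rw [add_mul]; exact add_mem ha hb
  | smul c a _ ha => rw [smul_mul_assoc]; exact Submodule.smul_mem _ _ ha
  | mem a ha =>
    obtain ⟨s, hs, t, ht, rfl⟩ := ha
    induction hy using Submodule.span_induction with
    | zero => rw [mul_zero]; exact zero_mem _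
    | add a b _ _ ha hb => rw [mul_add]; exact add_mem ha hb
    | smul c a _ ha => rw [mul_smul_comm]; exact Submodule.smul_mem _ _ ha
    | mem a ha =>
      obtain ⟨s', hs', t', ht', rfl⟩ := ha
      simp only [TensorProduct.mk_apply, Algebra.TensorProduct.tmul_mul_tmul]
      exact Submodule.apply_mem_map₂ _ (hS (Submodule.mul_mem_mul hs hs'))
        (hT (Submodule.mul_mem_mul ht ht'))

/-- If the coefficients of a series lie in the components `Sⁿ ⊗ T`, where `T` is a subalgebra, then so
do those of its exponential. -/
theorem coeff_formalExp_mem {K H : Type*} [Field K] [Ring H] [Algebra K H] {S : Submodule K H}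
    {T : Subalgebra K H} {Θ : PowerSeries (H ⊗[K] H)}
    (h : ∀ n, coeff n Θ ∈ Submodule.map₂ (TensorProduct.mk K H H) (S ^ n)
      (Subalgebra.toSubmodule T)) (n : ℕ) :
    coeff n (formalExp K Θ) ∈
      Submodule.map₂ (TensorProduct.mk K H H) (S ^ n) (Subalgebra.toSubmodule T) := by
  have hpow : ∀ k n, coeff n (Θ ^ k) ∈
      Submodule.map₂ (TensorProduct.mk K H H) (S ^ n) (Subalgebra.toSubmodule T) := by
    intro k
    induction k with
    | zero =>
      intro n
      rw [pow_zero, coeff_one]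
      split_ifs with hn
      · rw [hn, pow_zero]
        exact Submodule.apply_mem_map₂ _ (Submodule.one_le.mp le_rfl) T.one_mem
      · exact zero_mem _
    | succ k ih =>
      intro n
      rw [pow_succ, coeff_mul]
      refine Submodule.sum_mem _ ?_
      rintro ⟨i, j⟩ hij
      rw [Finset.HasAntidiagonal.mem_antidiagonal] at hij
      refine mul_mem_map₂_mk ?_ ?_ (ih i) (h j)
      · rw [← pow_add, hij]
      · rw [Submodule.mul_le]
        exact fun a ha b hb => T.mul_mem ha hb
  rw [formalExp, coeff_mk]
  exact Submodule.sum_mem _ fun k _ => Submodule.smul_mem _ _ (hpow k n)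

theorem map₂_le_tensorDegreePart {K L : Type*} [CommRing K] [LieRing L] [LieAlgebra K L]
    (ρ : L →ₗ⁅K⁆ Module.End K L) (n : ℕ) :
    Submodule.map₂ (TensorProduct.mk K (USemidirect ρ) (USemidirect ρ))
      (LinearMap.range (genX ρ) ^ n)
      (Subalgebra.toSubmodule (Algebra.adjoin K (Set.range (genH ρ)))) ≤
      tensorDegreePart (degreePart ρ) n := by
  have h1 : LinearMap.range (genX ρ) ^ n ≤ degreePart ρ n := by
    intro x hx
    rw [degreePart, ← mul_one x]
    exact Submodule.mul_mem_mul hx (one_mem (Algebra.adjoin K (Set.range (genH ρ))))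
  have h2 : Subalgebra.toSubmodule (Algebra.adjoin K (Set.range (genH ρ))) ≤ degreePart ρ 0 := by
    rw [degreePart, pow_zero, one_mul]
  refine (Submodule.map₂_le_map₂ h1 h2).trans ?_
  exact le_iSup₂_of_le (f := fun (p : ℕ × ℕ) (_ : p ∈ Finset.HasAntidiagonal.antidiagonal n) =>
    Submodule.map₂ (TensorProduct.mk K (USemidirect ρ) (USemidirect ρ)) (degreePart ρ p.1)
      (degreePart ρ p.2)) (n, 0) (by simp) le_rfl

end Homogeneous

/-! ### The twisting cocycle from an abstract affine representation. -/

section Cocycle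

open PowerSeries

variable {𝕜 : Type*} [RCLike 𝕜] {L : Type*} [LieRing L] [LieAlgebra 𝕜 L] {d : ℕ}
  (b : Module.Basis (Fin d) 𝕜 L) (ψ : L → L) (ρ : L →ₗ⁅𝕜⁆ Module.End 𝕜 L)

/-- The canonical element of `L* ⊗ L` is invariant under `L`: moving `genH ρ x` past `genX` yields
the dual action with a minus sign, left multiplication by `α (genH ρ x)` yields `ρ x` on the other
factor, and the two cancel. -/
theorem sum_legX_intertwine {Q : Type*} [Ring Q] [Algebra 𝕜 Q] (α : USemidirect ρ →ₐ[𝕜] Q)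
    (E : L →ₗ[𝕜] Q) (hE : ∀ x v, α (genH ρ x) * E v = E (ρ x v)) (x : L) :
    ((1 : USemidirect ρ) ⊗ₜ[𝕜] (genH ρ x ⊗ₜ[𝕜] (1 : Q)) + inThird ρ Q (α (genH ρ x))) *
        ∑ i, 1 ⊗ₜ[𝕜] (genX ρ (b.coord i) ⊗ₜ[𝕜] 1) * inThird ρ Q (E (b i)) =
      (∑ i, 1 ⊗ₜ[𝕜] (genX ρ (b.coord i) ⊗ₜ[𝕜] 1) * inThird ρ Q (E (b i))) *
        1 ⊗ₜ[𝕜] (genH ρ x ⊗ₜ[𝕜] 1) := by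
  have h1 : ∑ i, genX ρ (b.coord i ∘ₗ ρ x) ⊗ₜ[𝕜] E (b i) =
      ∑ i, genX ρ (b.coord i) ⊗ₜ[𝕜] E (ρ x (b i)) := by
    have hX : ∀ i, genX ρ (b.coord i ∘ₗ ρ x) =
        ∑ j, b.coord i (ρ x (b j)) • genX ρ (b.coord j) := by
      intro i
      simp only [← map_smul, ← map_sum]
      congr 1
      refine b.ext fun j => ?_
      simp [Finsupp.single_apply]
    have hEb : ∀ j, E (ρ x (b j)) = ∑ i, b.coord i (ρ x (b j)) • E (b i) := by
      intro j
      conv_lhs => rw [← b.sum_repr (ρ x (b j))]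
      simp only [map_sum, map_smul, Module.Basis.coord_apply]
    simp only [hX, hEb, TensorProduct.sum_tmul, TensorProduct.tmul_sum, TensorProduct.smul_tmul]
    exact Finset.sum_comm
  have h2 : ∀ ξ, genH ρ x * genX ρ ξ = genX ρ ξ * genH ρ x - genX ρ (ξ ∘ₗ ρ x) := by
    intro ξ
    rw [sub_eq_add_neg, ← genH_mul_genX]
    abel
  simp only [inThird_apply, Algebra.TensorProduct.tmul_mul_tmul, one_mul, mul_one, Finset.mul_sum,
    Finset.sum_mul, add_mul, h2, hE, TensorProduct.sub_tmul, TensorProduct.tmul_sub,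
    Finset.sum_add_distrib, Finset.sum_sub_distrib]
  have h3 := congrArg (fun t => (1 : USemidirect ρ) ⊗ₜ[𝕜] t) h1
  simp only [TensorProduct.tmul_sum] at h3
  rw [h3, sub_add_cancel]

end Cocycle

section Cocycle

open PowerSeries

variable {𝕜 : Type*} [RCLike 𝕜] {L : Type*} [LieRing L] [LieAlgebra 𝕜 L] {d : ℕ}
  (b : Module.Basis (Fin d) 𝕜 L) (ψ : L → L) (ρ : L →ₗ⁅𝕜⁆ Module.End 𝕜 L)

theorem extend_twistingElement {A : Type*} [Ring A] [Algebra 𝕜 A]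
    (f : USemidirect ρ ⊗[𝕜] USemidirect ρ →ₐ[𝕜] A) {x h : Fin d → A}
    (hx : ∀ i, f (genX ρ (b.coord i) ⊗ₜ[𝕜] 1) = x i) (hh : ∀ ν, f (1 ⊗ₜ[𝕜] genH ρ (b ν)) = h ν) :
    extend f (twistingElement ρ b ψ) = formalExp 𝕜 (twistExponent b ψ x h) := by
  rw [twistingElement_eq, extend_formalExp, extend_twistExponent]
  congr 2
  · ext1 i
    exact hx i
  · ext1 ν
    exact hh ν

theorem coeff_twistExponent_mem (n : ℕ) :
    coeff n (twistExponent b ψ (fun i => genX ρ (b.coord i) ⊗ₜ[𝕜] (1 : USemidirect ρ))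
      (fun ν => 1 ⊗ₜ[𝕜] genH ρ (b ν))) ∈
    Submodule.map₂ (TensorProduct.mk 𝕜 (USemidirect ρ) (USemidirect ρ))
      (LinearMap.range (genX ρ) ^ n)
      (Subalgebra.toSubmodule (Algebra.adjoin 𝕜 (Set.range (genH ρ)))) := by
  rw [twistExponent, coeff_mk]
  refine Submodule.neg_mem _ (Submodule.sum_mem _ fun ν _ => ?_)
  have h := map_taylorTerm b ψ (Algebra.TensorProduct.includeLeft : USemidirect ρ →ₐ[𝕜]
    USemidirect ρ ⊗[𝕜] USemidirect ρ) ν n (fun i => genX ρ (b.coord i))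
  have h' : taylorTerm b ψ ν n (fun i => genX ρ (b.coord i) ⊗ₜ[𝕜] (1 : USemidirect ρ)) =
      taylorTerm b ψ ν n (fun i => genX ρ (b.coord i)) ⊗ₜ[𝕜] 1 := h.symm
  rw [h', Algebra.TensorProduct.tmul_mul_tmul, mul_one, one_mul]
  refine Submodule.apply_mem_map₂ _ ?_ (Algebra.subset_adjoin ⟨_, rfl⟩)
  refine Submodule.smul_mem _ _ (Submodule.sum_mem _ fun i _ => Submodule.smul_mem _ _ ?_)
  have key : ∀ (m : ℕ) (g : Fin m → USemidirect ρ), (∀ k, g k ∈ LinearMap.range (genX ρ)) →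
      (List.ofFn g).prod ∈ LinearMap.range (genX ρ) ^ m := by
    intro m
    induction m with
    | zero =>
      intro g _
      rw [List.ofFn_zero, List.prod_nil, pow_zero]
      exact Submodule.one_le.mp le_rfl
    | succ m ih =>
      intro g hg
      rw [List.ofFn_succ, List.prod_cons, pow_succ']
      exact Submodule.mul_mem_mul (hg 0) (ih _ fun k => hg _)
  exact key n _ fun k => ⟨_, rfl⟩

/-- The twist identity. -/
theorem twistingElement_twist (hψ : ψ 0 = 0) {Q : Type*} [Ring Q] [Algebra 𝕜 Q]
    (α : USemidirect ρ →ₐ[𝕜] Q) {p : Q} {E : L →ₗ[𝕜] Q}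
    (hE : ∀ x v, α (genH ρ x) * E v = E (ρ x v)) {r : Q →ₗ[𝕜] L} (hr : r p = 0)
    (hr' : ∀ y, r (α (genH ρ y) * p) = y)
    (hpt : ∀ y : Fin d → 𝕜, formalExp 𝕜 (twistExponent b ψ (fun i => algebraMap 𝕜 Q (y i))
      fun ν => α (genH ρ (b ν))) * C p = C p - X * C (∑ i, y i • E (b i))) :
    extend comulLeft (twistingElement ρ b ψ) * extend embed₁₂ (twistingElement ρ b ψ) =
      extend comulRight (twistingElement ρ b ψ) * extend embed₂₃ (twistingElement ρ b ψ) := by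
  let X₁ : Fin d → USemidirect ρ ⊗[𝕜] (USemidirect ρ ⊗[𝕜] USemidirect ρ) :=
    fun i => legX₁ ρ (b.coord i)
  let X₂ : Fin d → USemidirect ρ ⊗[𝕜] (USemidirect ρ ⊗[𝕜] USemidirect ρ) :=
    fun i => legX₂ ρ (b.coord i)
  let H₂ : Fin d → USemidirect ρ ⊗[𝕜] (USemidirect ρ ⊗[𝕜] USemidirect ρ) :=
    fun i => legH₂ ρ (b i)
  let H₃ : Fin d → USemidirect ρ ⊗[𝕜] (USemidirect ρ ⊗[𝕜] USemidirect ρ) :=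
    fun i => legH₃ ρ (b i)
  have e1 : extend comulLeft (twistingElement ρ b ψ) =
      formalExp 𝕜 (twistExponent b ψ (X₁ + X₂) H₃) := by
    refine extend_twistingElement b ψ ρ _ (fun i => ?_) fun ν => ?_
    · simp [comulLeft, comulAlgHom_genX, -Bialgebra.comulAlgHom_apply, X₁, X₂, legX₁_apply, legX₂_apply, TensorProduct.add_tmul,
        Algebra.TensorProduct.one_def]
    · simp [comulLeft, H₃, legH₃_apply, -Bialgebra.comulAlgHom_apply, Algebra.TensorProduct.one_def]
  have e2 : extend embed₁₂ (twistingElement ρ b ψ) =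
      formalExp 𝕜 (twistExponent b ψ X₁ H₂) := by
    refine extend_twistingElement b ψ ρ _ (fun i => ?_) fun ν => ?_
    · simp [embed₁₂, X₁, legX₁_apply, Algebra.TensorProduct.one_def]
    · simp [embed₁₂, H₂, legH₂_apply]
  have e3 : extend comulRight (twistingElement ρ b ψ) =
      formalExp 𝕜 (twistExponent b ψ X₁ (H₂ + H₃)) := by
    refine extend_twistingElement b ψ ρ _ (fun i => ?_) fun ν => ?_
    · simp [comulRight, X₁, legX₁_apply, -Bialgebra.comulAlgHom_apply, Algebra.TensorProduct.one_def]
    · simp [comulRight, H₂, H₃, legH₂_apply, legH₃_apply, comulAlgHom_genH, -Bialgebra.comulAlgHom_apply,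
        TensorProduct.tmul_add]
  have e4 : extend embed₂₃ (twistingElement ρ b ψ) =
      formalExp 𝕜 (twistExponent b ψ X₂ H₃) := by
    refine extend_twistingElement b ψ ρ _ (fun i => ?_) fun ν => ?_
    · simp [embed₂₃, X₂, legX₂_apply]
    · simp [embed₂₃, H₃, legH₃_apply]
  rw [e1, e2, e3, e4]
  have h0 : ∀ x h : Fin d → USemidirect ρ ⊗[𝕜] (USemidirect ρ ⊗[𝕜] USemidirect ρ),
      constantCoeff (twistExponent b ψ x h) = 0 := constantCoeff_twistExponent b ψ hψ
  have hmem : ∀ x h : Fin d → USemidirect ρ ⊗[𝕜] (USemidirect ρ ⊗[𝕜] USemidirect ρ),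
      (∀ i, x i ∈ legsX ρ) → (∀ ν, h ν ∈ legsH ρ) →
      twistExponent b ψ x h ∈ coeffsIn (Subalgebra.toSubmodule (legsX ρ) * legsH ρ) :=
    fun x h hx hh => twistExponent_mem_coeffsIn b ψ fun ν n =>
      Submodule.mul_mem_mul (taylorTerm_mem b ψ _ ν n hx) (hh ν)
  have hX₁ : ∀ i, X₁ i ∈ legsX ρ := fun i => legX₁_mem ρ _
  have hX₂ : ∀ i, X₂ i ∈ legsX ρ := fun i => legX₂_mem ρ _
  have hH₂ : ∀ i, H₂ i ∈ legsH ρ := fun i => legH₂_mem ρ _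
  have hH₃ : ∀ i, H₃ i ∈ legsH ρ := fun i => legH₃_mem ρ _
  -- It remains to prove the congruence modulo the left ideal, which has two components: the counit
  -- in the third factor and the action on `p` through `α`.
  refine formalExp_mul_eq_of_sub_mem
    (commutator_mem_mul (legsX_commute ρ) (legsH_lie ρ) (legsH_normalize ρ))
    (J := thirdAnnihilator ρ α p) (mul_mem_thirdAnnihilator ρ α p)
    (eq_zero_of_mem_thirdAnnihilator ρ α p hr hr')
    (hmem _ _ (fun i => add_mem (hX₁ i) (hX₂ i)) hH₃) (hmem _ _ hX₁ hH₂)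
    (hmem _ _ hX₁ fun i => add_mem (hH₂ i) (hH₃ i)) (hmem _ _ hX₂ hH₃)
    (h0 _ _) (h0 _ _) (h0 _ _) (h0 _ _) ?_
  have hε₃ : counitThird ρ ∘ H₃ = 0 := by
    ext1 ν
    simp [counitThird, H₃, legH₃_apply, counitAlgHom_genH, -Bialgebra.counitAlgHom_apply]
  have hε₂ : counitThird ρ ∘ H₂ = H₂ := by
    ext1 ν
    simp [counitThird, H₂, legH₂_apply]
  have hε₁ : counitThird ρ ∘ X₁ = X₁ := by
    ext1 ν
    simp [counitThird, X₁, legX₁_apply]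
  -- The counit removes `H₃`; both sides reduce to the exponential in `X₁` and `H₂`.
  have hcounit : extend (counitThird ρ) (formalExp 𝕜 (twistExponent b ψ (X₁ + X₂) H₃) *
        formalExp 𝕜 (twistExponent b ψ X₁ H₂) - formalExp 𝕜 (twistExponent b ψ X₁ (H₂ + H₃)) *
        formalExp 𝕜 (twistExponent b ψ X₂ H₃)) = 0 := by
    have hε₂₃ : counitThird ρ ∘ (H₂ + H₃) = H₂ := by
      ext1 ν
      have h2 := congrFun hε₂ ν
      have h3 := congrFun hε₃ ν
      simp only [Function.comp_apply, Pi.add_apply, Pi.zero_apply, map_add] at h2 h3 ⊢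
      rw [h2, h3, add_zero]
    simp only [map_sub, map_mul, extend_formalExp, extend_twistExponent, hε₁, hε₂, hε₃, hε₂₃,
      twistExponent_zero, formalExp_zero, one_mul, mul_one, sub_self]
  have hmap : extend (mapThird ρ α) (formalExp 𝕜 (twistExponent b ψ (X₁ + X₂) H₃) *
        formalExp 𝕜 (twistExponent b ψ X₁ H₂) - formalExp 𝕜 (twistExponent b ψ X₁ (H₂ + H₃)) *
        formalExp 𝕜 (twistExponent b ψ X₂ H₃)) * C (inThird ρ Q p) = 0 := by
    let x₁ : Fin d → USemidirect ρ ⊗[𝕜] (USemidirect ρ ⊗[𝕜] Q) :=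
      fun i => genX ρ (b.coord i) ⊗ₜ[𝕜] 1
    let x₂ : Fin d → USemidirect ρ ⊗[𝕜] (USemidirect ρ ⊗[𝕜] Q) :=
      fun i => 1 ⊗ₜ[𝕜] (genX ρ (b.coord i) ⊗ₜ[𝕜] 1)
    let h₂ : Fin d → USemidirect ρ ⊗[𝕜] (USemidirect ρ ⊗[𝕜] Q) :=
      fun i => 1 ⊗ₜ[𝕜] (genH ρ (b i) ⊗ₜ[𝕜] 1)
    have m1 : mapThird ρ α ∘ X₁ = x₁ := by
      ext1 i
      simp [mapThird, X₁, x₁, legX₁_apply]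
    have m2 : mapThird ρ α ∘ X₂ = x₂ := by
      ext1 i
      simp [mapThird, X₂, x₂, legX₂_apply]
    have m3 : mapThird ρ α ∘ H₂ = h₂ := by
      ext1 i
      simp [mapThird, H₂, h₂, legH₂_apply]
    have m4 : mapThird ρ α ∘ H₃ = inThird ρ Q ∘ fun ν => α (genH ρ (b ν)) := by
      ext1 i
      simp [mapThird, H₃, inThird_apply, legH₃_apply]
    have m12 : mapThird ρ α ∘ (X₁ + X₂) = x₁ + x₂ := by
      rw [← m1, ← m2]
      ext1 i
      exact map_add (mapThird ρ α) _ _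
    have m34 : mapThird ρ α ∘ (H₂ + H₃) = h₂ + inThird ρ Q ∘ fun ν => α (genH ρ (b ν)) := by
      rw [← m3, ← m4]
      ext1 i
      exact map_add (mapThird ρ α) _ _
    rw [map_sub, sub_mul, sub_eq_zero]
    simp only [map_mul, extend_formalExp, extend_twistExponent, m1, m2, m3, m4, m12, m34]
    refine twist_congruence b ψ hψ (E := fun i => E (b i)) hpt (inThird ρ Q) ?_ ?_ ?_ ?_ ?_ ?_ ?_ ?_
    · intro i j
      simp only [x₁, Commute, SemiconjBy, Algebra.TensorProduct.tmul_mul_tmul, (genX_commute ρ _ _).eq]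
    · intro i j
      simp only [x₂, Commute, SemiconjBy, Algebra.TensorProduct.tmul_mul_tmul, (genX_commute ρ _ _).eq]
    · intro i j
      simp only [x₁, x₂, Commute, SemiconjBy, Algebra.TensorProduct.tmul_mul_tmul, one_mul, mul_one]
    · intro i q
      simp only [x₁, inThird_apply, Commute, SemiconjBy, Algebra.TensorProduct.tmul_mul_tmul, one_mul, mul_one]
    · intro i q
      simp only [x₂, inThird_apply, Commute, SemiconjBy, Algebra.TensorProduct.tmul_mul_tmul, one_mul, mul_one]
    · intro i j
      simp only [h₂, x₁, Commute, SemiconjBy, Algebra.TensorProduct.tmul_mul_tmul, one_mul, mul_one]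
    · intro i q
      simp only [h₂, inThird_apply, Commute, SemiconjBy, Algebra.TensorProduct.tmul_mul_tmul, one_mul, mul_one]
    · intro ν
      exact sum_legX_intertwine b ρ α E hE (b ν)
  intro n
  rw [mem_thirdAnnihilator]
  constructor
  · have := congrArg (coeff n) hmap
    rwa [coeff_mul_C, map_zero] at this
  · have := congrArg (coeff n) hcounit
    rwa [map_zero] at this

theorem isTwistingCocycle_twistingElement (hψ : ψ 0 = 0) {Q : Type*} [Ring Q] [Algebra 𝕜 Q]
    (α : USemidirect ρ →ₐ[𝕜] Q) {p : Q} {E : L →ₗ[𝕜] Q}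
    (hE : ∀ x v, α (genH ρ x) * E v = E (ρ x v)) {r : Q →ₗ[𝕜] L} (hr : r p = 0)
    (hr' : ∀ y, r (α (genH ρ y) * p) = y)
    (hpt : ∀ y : Fin d → 𝕜, formalExp 𝕜 (twistExponent b ψ (fun i => algebraMap 𝕜 Q (y i))
      fun ν => α (genH ρ (b ν))) * C p = C p - X * C (∑ i, y i • E (b i))) :
    IsTwistingCocycle (degreePart ρ) (twistingElement ρ b ψ) where
  homogeneous n := by
    rw [twistingElement_eq]
    exact map₂_le_tensorDegreePart ρ n (coeff_formalExp_mem (coeff_twistExponent_mem b ψ ρ) n)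
  invertible := by
    rw [twistingElement_eq]
    refine ⟨formalExp 𝕜 (-_), fun n => map₂_le_tensorDegreePart ρ n
      (coeff_formalExp_mem (fun m => ?_) n),
      formalExp_mul_formalExp_neg (constantCoeff_twistExponent b ψ hψ _ _),
      formalExp_neg_mul_formalExp (constantCoeff_twistExponent b ψ hψ _ _)⟩
    rw [map_neg]
    exact Submodule.neg_mem _ (coeff_twistExponent_mem b ψ ρ m)
  twist := twistingElement_twist b ψ ρ hψ α hE hr hr' hpt
  counit_left := by
    rw [extend_twistingElement b ψ ρ counitLeft (x := 0) (h := fun ν => genH ρ (b ν))]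
    · have : twistExponent b ψ 0 (fun ν => genH ρ (b ν)) = 0 := by
        ext n
        rw [twistExponent, coeff_mk, map_zero, neg_eq_zero]
        refine Finset.sum_eq_zero fun ν _ => ?_
        -- In degree zero the Taylor term vanishes because `ψ 0 = 0`; in positive degree each
        -- monomial contains a factor `0`.
        cases n with
        | zero => rw [taylorTerm_zero b ψ hψ, zero_mul]
        | succ n => simp [taylorTerm, List.ofFn_succ]
      rw [this, formalExp_zero]
    · intro i
      simp [counitLeft, counitAlgHom_genX, -Bialgebra.counitAlgHom_apply]
    · intro ν
      simp [counitLeft]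
  counit_right := by
    rw [extend_twistingElement b ψ ρ counitRight (x := fun i => genX ρ (b.coord i)) (h := 0),
      twistExponent_zero, formalExp_zero]
    · intro i
      simp [counitRight]
    · intro ν
      simp [counitRight, counitAlgHom_genH, -Bialgebra.counitAlgHom_apply]

end Cocycle

/-! ### Asymptotic expansions -/

section Expansion

open PowerSeries Asymptotics Filter

variable {𝕜 : Type*} [RCLike 𝕜] {A : Type*} [NormedRing A] [NormedAlgebra 𝕜 A]

/-- `∑ aₙ sⁿ` is the asymptotic expansion of `g s` at `s = 0`. -/
def HasExpansion (g : 𝕜 → A) (a : PowerSeries A) : Prop :=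
  ∀ n, (fun s => g s - ∑ k ∈ Finset.range n, s ^ k • coeff k a) =O[𝓝 0] fun s : 𝕜 => s ^ n

theorem HasExpansion.add {g h : 𝕜 → A} {a b : PowerSeries A} (hg : HasExpansion g a)
    (hh : HasExpansion h b) : HasExpansion (fun s => g s + h s) (a + b) := by
  intro n
  refine ((hg n).add (hh n)).congr_left fun s => ?_
  simp only [map_add, smul_add, Finset.sum_add_distrib]
  abel

theorem HasExpansion.const_smul {g : 𝕜 → A} {a : PowerSeries A} (hg : HasExpansion g a) (c : 𝕜) :
    HasExpansion (fun s => c • g s) (c • a) := by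
  intro n
  refine ((hg n).const_smul_left c).congr_left fun s => ?_
  simp only [Pi.smul_apply, coeff_smul, smul_sub, Finset.smul_sum, smul_comm c]

theorem HasExpansion.neg {g : 𝕜 → A} {a : PowerSeries A} (hg : HasExpansion g a) :
    HasExpansion (fun s => -g s) (-a) := by
  simpa using hg.const_smul (-1)

theorem hasExpansion_const (y : A) : HasExpansion (fun _ : 𝕜 => y) (C y) := by
  intro n
  cases n with
  | zero =>
    simp only [Finset.range_zero, Finset.sum_empty, sub_zero, pow_zero]
    exact isBigO_const_const _ one_ne_zero _
  | succ n =>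
    refine (isBigO_zero _ _).congr_left fun s => ?_
    rw [Finset.sum_range_succ', Finset.sum_eq_zero]
    · simp
    · intro k _
      rw [coeff_C, if_neg (Nat.succ_ne_zero k), smul_zero]

theorem hasExpansion_smul (y : A) : HasExpansion (fun s : 𝕜 => s • y) (X * C y) := by
  intro n
  match n with
  | 0 =>
    simp only [Finset.range_zero, Finset.sum_empty, sub_zero, pow_zero]
    have : Continuous fun s : 𝕜 => s • y := by fun_prop
    exact this.continuousAt.isBigO_one 𝕜
  | 1 =>
    simp only [Finset.range_one, Finset.sum_singleton, pow_zero, one_smul, pow_one]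
    refine (IsBigO.of_bound ‖y‖ (Eventually.of_forall fun s => ?_))
    simp [norm_smul, mul_comm]
  | n + 2 =>
    refine (isBigO_zero _ _).congr_left fun s => ?_
    rw [Finset.sum_range_succ', Finset.sum_range_succ', Finset.sum_eq_zero]
    · simp
    · intro k _
      rw [coeff_succ_X_mul, coeff_C, if_neg (Nat.succ_ne_zero k), smul_zero]

theorem HasExpansion.isBigO_one {g : 𝕜 → A} {a : PowerSeries A} (hg : HasExpansion g a) :
    g =O[𝓝 0] fun _ => (1 : 𝕜) := by
  simpa using hg 0

theorem isBigO_pow_of_le {m n : ℕ} (h : n ≤ m) : (fun s : 𝕜 => s ^ m) =O[𝓝 0] fun s => s ^ n := by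
  obtain ⟨k, rfl⟩ := Nat.exists_eq_add_of_le h
  have h1 : (fun s : 𝕜 => s ^ k) =O[𝓝 0] fun _ => (1 : 𝕜) :=
    (continuous_pow k).continuousAt.isBigO_one 𝕜
  refine ((isBigO_refl (fun s : 𝕜 => s ^ n) (𝓝 0)).mul h1).congr (fun s => ?_) fun s => ?_
  · rw [pow_add]
  · rw [mul_one]

theorem HasExpansion.mul {g h : 𝕜 → A} {a b : PowerSeries A} (hg : HasExpansion g a)
    (hh : HasExpansion h b) : HasExpansion (fun s => g s * h s) (a * b) := by
  intro n
  set P : 𝕜 → A := fun s => ∑ k ∈ Finset.range n, s ^ k • coeff k a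
  set R : 𝕜 → A := fun s => ∑ k ∈ Finset.range n, s ^ k • coeff k b
  have h1 : (fun s => (g s - P s) * h s) =O[𝓝 0] fun s : 𝕜 => s ^ n := by
    simpa using (hg n).mul hh.isBigO_one
  have hP : P =O[𝓝 0] fun _ => (1 : 𝕜) := by
    have : Continuous P := by fun_prop
    exact this.continuousAt.isBigO_one 𝕜
  have h2 : (fun s => P s * (h s - R s)) =O[𝓝 0] fun s : 𝕜 => s ^ n := by
    simpa using hP.mul (hh n)
  have h3 : (fun s => P s * R s - ∑ k ∈ Finset.range n, s ^ k • coeff k (a * b)) =O[𝓝 0]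
      fun s : 𝕜 => s ^ n := by
    -- The product of the truncations differs from the truncation of the product by the terms with
    -- `i + j ≥ n`, which are all `O(s ^ n)`.
    have e : ∀ s : 𝕜, P s * R s - ∑ k ∈ Finset.range n, s ^ k • coeff k (a * b) =
        ∑ p ∈ (Finset.range n ×ˢ Finset.range n).filter (fun p => ¬ p.1 + p.2 < n),
          s ^ (p.1 + p.2) • (coeff p.1 a * coeff p.2 b) := by
      intro s
      have e1 : P s * R s = ∑ p ∈ Finset.range n ×ˢ Finset.range n,
          s ^ (p.1 + p.2) • (coeff p.1 a * coeff p.2 b) := by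
        rw [Finset.sum_mul_sum, Finset.sum_product]
        simp only [smul_mul_smul_comm, pow_add]
      have e2 : ∑ k ∈ Finset.range n, s ^ k • coeff k (a * b) =
          ∑ p ∈ (Finset.range n ×ˢ Finset.range n).filter (fun p => p.1 + p.2 < n),
          s ^ (p.1 + p.2) • (coeff p.1 a * coeff p.2 b) := by
        simp only [coeff_mul, Finset.smul_sum]
        rw [Finset.sum_sigma']
        refine Finset.sum_bij' (fun x _ => x.2) (fun p _ => ⟨p.1 + p.2, p⟩) ?_ ?_ ?_ ?_ ?_
        · rintro ⟨m, p⟩ h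
          simp only [Finset.mem_sigma, Finset.mem_range,
            Finset.HasAntidiagonal.mem_antidiagonal] at h
          simp only [Finset.mem_filter, Finset.mem_product, Finset.mem_range]
          omega
        · rintro p h
          simp only [Finset.mem_filter] at h
          simp only [Finset.mem_sigma, Finset.mem_range,
            Finset.HasAntidiagonal.mem_antidiagonal]
          exact ⟨h.2, trivial⟩
        · rintro ⟨m, p⟩ h
          simp only [Finset.mem_sigma, Finset.HasAntidiagonal.mem_antidiagonal] at h
          obtain ⟨_, rfl⟩ := h
          rfl
        · intro p h
          rfl
        · rintro ⟨m, p⟩ h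
          simp only [Finset.mem_sigma, Finset.HasAntidiagonal.mem_antidiagonal] at h
          rw [h.2]
      rw [e1, e2, ← Finset.sum_filter_add_sum_filter_not _ (fun p : ℕ × ℕ => p.1 + p.2 < n),
        add_sub_cancel_left]
    simp only [e]
    refine IsBigO.fun_sum fun p hp => ?_
    simp only [Finset.mem_filter, not_lt] at hp
    have := (isBigO_pow_of_le (𝕜 := 𝕜) hp.2).smul
      (isBigO_const_const (coeff p.1 a * coeff p.2 b) (one_ne_zero (α := 𝕜)) (𝓝 (0 : 𝕜)))
    simpa using this
  refine ((h1.add h2).add h3).congr_left fun s => ?_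
  noncomm_ring

theorem HasExpansion.pow {g : 𝕜 → A} {a : PowerSeries A} (hg : HasExpansion g a) (n : ℕ) :
    HasExpansion (fun s => g s ^ n) (a ^ n) := by
  induction n with
  | zero => simpa using hasExpansion_const (𝕜 := 𝕜) (1 : A)
  | succ n ih => simpa only [pow_succ] using ih.mul hg

theorem HasExpansion.sum {ι : Type*} (t : Finset ι) {g : ι → 𝕜 → A} {a : ι → PowerSeries A}
    (h : ∀ i ∈ t, HasExpansion (g i) (a i)) :
    HasExpansion (fun s => ∑ i ∈ t, g i s) (∑ i ∈ t, a i) := by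
  classical
  induction t using Finset.induction_on with
  | empty => simpa using hasExpansion_const (𝕜 := 𝕜) (0 : A)
  | insert i t hi ih =>
    simp only [Finset.sum_insert hi]
    exact (h i (Finset.mem_insert_self i t)).add
      (ih fun j hj => h j (Finset.mem_insert_of_mem hj))

theorem HasExpansion.congr {g h : 𝕜 → A} {a : PowerSeries A} (hg : HasExpansion g a)
    (e : g =ᶠ[𝓝 0] h) : HasExpansion h a := by
  intro n
  refine (hg n).congr' ?_ EventuallyEq.rfl
  filter_upwards [e] with s hs
  rw [hs]

/-- If all lower coefficients vanish, the expansion to order `n + 1` reads `s ^ n aₙ = O(s ^ (n +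
1))`. Dividing by `s ^ n` away from `0` and letting `s → 0` gives `aₙ = 0`. -/
theorem HasExpansion.eq_zero {a : PowerSeries A} (h : HasExpansion (fun _ : 𝕜 => (0 : A)) a) :
    a = 0 := by
  ext n
  rw [map_zero]
  induction n using Nat.strong_induction_on with
  | _ n ih =>
    have h1 := h (n + 1)
    have h2 : (fun s : 𝕜 => s ^ n • coeff n a) =O[𝓝 0] fun s : 𝕜 => s ^ (n + 1) := by
      refine h1.neg_left.congr_left fun s => ?_
      rw [Finset.sum_range_succ, Finset.sum_eq_zero]
      · simp
      · intro k hk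
        rw [ih k (Finset.mem_range.mp hk), smul_zero]
    have h3 : (fun _ : 𝕜 => coeff n a) =O[𝓝[≠] 0] fun s : 𝕜 => s := by
      obtain ⟨c, hc⟩ := (h2.mono (nhdsWithin_le_nhds (s := {0}ᶜ))).bound
      refine IsBigO.of_bound c ?_
      filter_upwards [hc, self_mem_nhdsWithin] with s hs hs0
      have hs0' : 0 < ‖s ^ n‖ := norm_pos_iff.mpr (pow_ne_zero n hs0)
      rw [norm_smul, pow_succ, norm_mul] at hs
      refine le_of_mul_le_mul_left ?_ hs0'
      linarith
    have h4 : Tendsto (fun _ : 𝕜 => coeff n a) (𝓝[≠] 0) (𝓝 0) :=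
      h3.trans_tendsto (tendsto_id.mono_left nhdsWithin_le_nhds)
    exact tendsto_nhds_unique tendsto_const_nhds h4

theorem HasExpansion.unique {g : 𝕜 → A} {a b : PowerSeries A} (ha : HasExpansion g a)
    (hb : HasExpansion g b) : a = b := by
  have := (ha.add hb.neg).congr (h := fun _ => 0) (Eventually.of_forall fun s => by simp)
  exact sub_eq_zero.mp (by simpa [sub_eq_add_neg] using this.eq_zero)

theorem HasExpansion.exp [CompleteSpace A] {g : 𝕜 → A} {a : PowerSeries A} (hg : HasExpansion g a)
    (ha : constantCoeff a = 0) : HasExpansion (fun s => NormedSpace.exp (g s)) (formalExp 𝕜 a) := by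
  intro n
  have hO : g =O[𝓝 0] fun s : 𝕜 => s := by
    simpa [ha] using hg 1
  have h0 : Tendsto g (𝓝 0) (𝓝 0) := hO.trans_tendsto tendsto_id
  have h1 : (fun s => NormedSpace.exp (g s) -
      ∑ k ∈ Finset.range n, ((k.factorial : 𝕜)⁻¹) • g s ^ k) =O[𝓝 0] fun s : 𝕜 => s ^ n := by
    have := (NormedSpace.exp_hasFPowerSeriesAt_zero (𝕂 := 𝕜) (𝔸 := A)).isBigO_sub_partialSum_pow n
    have := this.comp_tendsto h0
    refine (IsBigO.trans this (k := fun s : 𝕜 => s ^ n) ?_).congr_left fun s => ?_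
    · exact hO.norm_left.pow n
    · simp [FormalMultilinearSeries.partialSum, NormedSpace.expSeries_apply_eq]
  have h2 := HasExpansion.sum (Finset.range n) (g := fun k s => ((k.factorial : 𝕜)⁻¹) • g s ^ k)
    (fun k _ => (hg.pow k).const_smul ((k.factorial : 𝕜)⁻¹)) n
  refine (h1.add h2).congr_left fun s => ?_
  rw [sub_add_sub_cancel]
  congr 1
  refine Finset.sum_congr rfl fun k hk => ?_
  -- For coefficients of degree less than `n` the exponential may be truncated to the powers below
  -- `n`, as the `k`-th power is divisible by `T ^ k`. This matches the truncation of the analytic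
  -- exponential in `h1`.
  rw [formalExp_eq_adicSum, (isAdic_expTerm ha).coeff_adicSum (Finset.mem_range.mp hk), map_sum]
  rfl

end Expansion

/-! ### From analytic identities for `ψ` to formal ones. -/

section TaylorExpansion

open PowerSeries Asymptotics Filter

variable {𝕜 : Type*} [RCLike 𝕜] {L : Type*} [LieRing L] [LieAlgebra 𝕜 L] {d : ℕ}
  (b : Module.Basis (Fin d) 𝕜 L) (ψ : L → L)

/-- At scalar arguments the sum over multi-indices collapses, by multilinearity, to the value of the
`n`-th derivative on the diagonal. -/
theorem taylorTerm_algebraMap {A : Type*} [Ring A] [Algebra 𝕜 A] (ν : Fin d) (n : ℕ)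
    (y : Fin d → 𝕜) : taylorTerm b ψ ν n (fun i => algebraMap 𝕜 A (y i)) =
      algebraMap 𝕜 A (((n.factorial : 𝕜)⁻¹) *
        iteratedFDeriv 𝕜 n (coordFun b ψ ν) 0 fun _ => y) := by
  have h1 := map_taylorTerm b ψ (Algebra.ofId 𝕜 A) ν n y
  have h2 : taylorTerm b ψ ν n y = ((n.factorial : 𝕜)⁻¹) *
        iteratedFDeriv 𝕜 n (coordFun b ψ ν) 0 fun _ => y := by
    rw [taylorTerm, smul_eq_mul]
    congr 1
    have hy : (fun _ : Fin n => y) = fun _ => ∑ i, y i • Pi.single i (1 : 𝕜) := by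
      ext1 _
      ext j
      simp [Finset.sum_apply, Pi.single_apply]
    rw [hy, ContinuousMultilinearMap.map_sum]
    refine Finset.sum_congr rfl fun i _ => ?_
    rw [ContinuousMultilinearMap.map_smul_univ, smul_eq_mul, smul_eq_mul, mul_comm, List.prod_ofFn]
  rw [← h2]
  exact h1.symm

variable {A : Type*} [NormedRing A] [NormedAlgebra 𝕜 A]

theorem hasExpansion_coordFun {ν : Fin d} (h : AnalyticAt 𝕜 (coordFun b ψ ν) 0) (y : Fin d → 𝕜)
    (q : A) : HasExpansion (fun s : 𝕜 => coordFun b ψ ν (s • y) • q)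
      (PowerSeries.mk fun n => taylorTerm b ψ ν n (fun i => algebraMap 𝕜 A (y i)) * q) := by
  obtain ⟨p, r, hp⟩ := h
  intro n
  have h0 : Tendsto (fun s : 𝕜 => s • y) (𝓝 0) (𝓝 0) := by
    have : Continuous fun s : 𝕜 => s • y := by fun_prop
    simpa using this.tendsto 0
  have h1 := ((hp.hasFPowerSeriesAt).isBigO_sub_partialSum_pow n).comp_tendsto h0
  have h2 : (fun s : 𝕜 => coordFun b ψ ν (s • y) - p.partialSum n (s • y)) =O[𝓝 0]
      fun s : 𝕜 => s ^ n := by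
    refine (IsBigO.trans h1 (k := fun s : 𝕜 => s ^ n) ?_).congr_left fun s => by simp
    refine IsBigO.of_bound (‖y‖ ^ n) (Eventually.of_forall fun s => ?_)
    simp [norm_smul, mul_pow, mul_comm]
  have h3 := h2.smul (isBigO_const_const q (one_ne_zero (α := 𝕜)) (𝓝 (0 : 𝕜)))
  refine (h3.congr_left fun s => ?_).congr_right fun s => by simp
  rw [sub_smul, FormalMultilinearSeries.partialSum, Finset.sum_smul]
  congr 1
  refine Finset.sum_congr rfl fun k _ => ?_
  rw [coeff_mk, taylorTerm_algebraMap, ← hp.factorial_smul y k, nsmul_eq_mul, ← mul_assoc,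
    inv_mul_cancel₀ (by exact_mod_cast k.factorial_ne_zero), one_mul, ← Algebra.smul_def, smul_smul,
    ContinuousMultilinearMap.map_smul_univ (p k) (fun _ => s) (fun _ => y)]
  simp

/-- An identity `exp(-∑_ν ψ^ν(y) A_ν) p = p - ∑ y_i E_i` of analytic functions yields the
corresponding identity of formal power series. -/
theorem formalExp_twistExponent_of_exp [CompleteSpace A] (hψ : ψ 0 = 0)
    (h : ∀ ν, AnalyticAt 𝕜 (coordFun b ψ ν) 0) {α E : Fin d → A} {p : A}
    (hexp : ∀ᶠ y in 𝓝 (0 : Fin d → 𝕜),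
      NormedSpace.exp (-∑ ν, coordFun b ψ ν y • α ν) * p = p - ∑ i, y i • E i)
    (y : Fin d → 𝕜) :
    formalExp 𝕜 (twistExponent b ψ (fun i => algebraMap 𝕜 A (y i)) α) * C p =
      C p - X * C (∑ i, y i • E i) := by
  have h1 : HasExpansion (fun s : 𝕜 => -∑ ν, coordFun b ψ ν (s • y) • α ν)
      (twistExponent b ψ (fun i => algebraMap 𝕜 A (y i)) α) := by
    have := (HasExpansion.sum Finset.univ fun ν _ => hasExpansion_coordFun b ψ (h ν) y (α ν)).neg
    convert this using 1
    ext n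
    simp [twistExponent, map_sum]
  have h2 := (h1.exp (constantCoeff_twistExponent b ψ hψ _ _)).mul (hasExpansion_const p)
  have h3 : HasExpansion (fun s : 𝕜 => p - s • ∑ i, y i • E i)
      (C p - X * C (∑ i, y i • E i)) := by
    simpa only [sub_eq_add_neg] using (hasExpansion_const p).add (hasExpansion_smul _).neg
  -- Both sides expand the same function of `s`, namely the identity `hexp` at the point `s • y`;
  -- uniqueness of expansions then gives the formal identity.
  refine HasExpansion.unique h2 (h3.congr ?_)
  have h0 : Tendsto (fun s : 𝕜 => s • y) (𝓝 0) (𝓝 0) := by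
    have : Continuous fun s : 𝕜 => s • y := by fun_prop
    simpa using this.tendsto 0
  filter_upwards [h0.eventually hexp] with s hs
  rw [hs]
  simp [Finset.smul_sum, smul_smul]

end TaylorExpansion

/-! ### The local inverse of the orbit map of an affine representation -/

section Inverse

open Filter

variable {𝕜 : Type*} [RCLike 𝕜] {X : Type*} [NormedAddCommGroup X] [NormedSpace 𝕜 X]
  [FiniteDimensional 𝕜 X]

/-- Let `a x` be linear endomorphisms of `X × 𝕜`, depending linearly on `x`, for which the map
`g x = - exp(- a x) (0, 1)` has an injective differential at the origin. Then a left inverse `ψ` of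
`g` near the origin is analytic, and a right inverse. -/
theorem analyticAt_of_leftInverse_exp (a : X →L[𝕜] (X × 𝕜 →L[𝕜] X × 𝕜))
    (hinj : ∀ x, (a x (0, 1)).1 = 0 → x = 0) {g ψ : X → X}
    (hg : ∀ᶠ x in 𝓝 0, NormedSpace.exp (-a x) (0, 1) = (-g x, 1))
    (hψ : ∀ᶠ x in 𝓝 0, ψ (g x) = x) :
    ψ 0 = 0 ∧ AnalyticAt 𝕜 ψ 0 ∧
      ∀ᶠ y in 𝓝 0, NormedSpace.exp (-a (ψ y)) (0, 1) = (-y, 1) := by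
  have : CompleteSpace X := FiniteDimensional.complete 𝕜 X
  let ev : (X × 𝕜 →L[𝕜] X × 𝕜) →L[𝕜] X :=
    (ContinuousLinearMap.fst 𝕜 X 𝕜).comp (ContinuousLinearMap.apply 𝕜 (X × 𝕜) ((0, 1) : X × 𝕜))
  let f : X → X := fun x => -ev (NormedSpace.exp (-a x))
  have hfg : ∀ᶠ x in 𝓝 0, f x = g x := by
    filter_upwards [hg] with x hx
    simp [f, ev, hx]
  have hf0 : f 0 = 0 := by
    simp [f, ev]
  have hg0 : g 0 = 0 := by rw [← hfg.self_of_nhds, hf0]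
  have hψ0 : ψ 0 = 0 := by
    have := hψ.self_of_nhds
    rwa [hg0] at this
  let D : X →L[𝕜] X := ev.comp a
  have hD : Function.Injective D.toLinearMap := by
    rw [injective_iff_map_eq_zero]
    exact hinj
  let D' : X ≃L[𝕜] X := (LinearEquiv.ofInjectiveEndo D.toLinearMap hD).toContinuousLinearEquiv
  have hD' : (D' : X →L[𝕜] X) = D := by
    ext x
    rfl
  have hfan : AnalyticAt 𝕜 f 0 := by
    have h1 : AnalyticAt 𝕜 (fun x => -a x) 0 := (a.analyticAt 0).neg
    have h2 : AnalyticAt 𝕜 (fun x => NormedSpace.exp (-a x)) 0 :=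
      AnalyticAt.comp (g := NormedSpace.exp) (f := fun x => -a x)
        (NormedSpace.exp_analytic (𝕂 := 𝕜) (-a 0)) h1
    exact ((ev.analyticAt _).comp h2).neg
  -- Since `exp` has derivative `1` at `0`, the two minus signs cancel and the derivative of `f` is
  -- `x ↦ (a x (0, 1)).1`, which is bijective in finite dimension.
  have hfd : HasStrictFDerivAt f (D' : X →L[𝕜] X) 0 := by
    rw [hD']
    have h1 : HasStrictFDerivAt (fun x => -a x) (-a) 0 := a.hasStrictFDerivAt.neg
    have h0 : -a 0 = 0 := by simp
    have h2 : HasStrictFDerivAt (NormedSpace.exp : (X × 𝕜 →L[𝕜] X × 𝕜) → _)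
        (1 : (X × 𝕜 →L[𝕜] X × 𝕜) →L[𝕜] _) (-a 0) := by
      rw [h0]
      exact hasStrictFDerivAt_exp_zero
    have h3 := (ev.hasStrictFDerivAt (x := NormedSpace.exp (-a 0))).comp 0 (h2.comp 0 h1)
    have h4 : D = -ev.comp ((1 : (X × 𝕜 →L[𝕜] X × 𝕜) →L[𝕜] _).comp (-a)) := by
      ext x
      simp [D]
    rw [h4]
    exact h3.neg
  let e := hfd.toOpenPartialHomeomorph f
  have he0 : (0 : X) ∈ e.source := hfd.mem_toOpenPartialHomeomorph_source
  have hsymm : AnalyticAt 𝕜 e.symm 0 := by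
    have := e.analyticAt_symm' (i := D') he0 hfan hfd.hasFDerivAt.fderiv
    have h' : e 0 = 0 := hf0
    rwa [h'] at this
  have hsymm0 : e.symm 0 = 0 := by
    have := e.left_inv he0
    have h' : e 0 = 0 := hf0
    rwa [h'] at this
  have htend : Tendsto e.symm (𝓝 0) (𝓝 0) := by
    have := hsymm.continuousAt.tendsto
    rwa [hsymm0] at this
  have hright : ∀ᶠ y in 𝓝 0, f (e.symm y) = y := by
    have := hfd.eventually_right_inverse
    rwa [hf0] at this
  have hψe : ∀ᶠ y in 𝓝 0, ψ y = e.symm y := by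
    -- A left inverse agrees with the local inverse: `ψ y = ψ (g (e.symm y)) = e.symm y`.
    filter_upwards [hright, htend.eventually hψ, htend.eventually hfg] with y h1 h2 h3
    rw [← h2, ← h3, h1]
  refine ⟨hψ0, hsymm.congr (hψe.mono fun y hy => hy.symm), ?_⟩
  filter_upwards [hright, hψe, htend.eventually hg, htend.eventually hfg] with y h1 h2 h3 h4
  rw [h2, h3, ← h4, h1]

end Inverse

/-! ### The twisting element of an affine representation -/

section AffineTwist

open Filter

variable {𝕜 : Type*} [RCLike 𝕜] {L : Type*} [LieRing L] [LieAlgebra 𝕜 L] {d : ℕ}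
  (b : Module.Basis (Fin d) 𝕜 L) (ρ : L →ₗ⁅𝕜⁆ Module.End 𝕜 L) (D : L →ₗ[𝕜] L)
  (hD : ∀ x y, D ⁅x, y⁆ = ρ x (D y) - ρ y (D x))

/-- The coordinates of `L × 𝕜` defined by a basis of `L`. -/
noncomputable def prodCoords : (L × 𝕜) ≃ₗ[𝕜] ((Fin d → 𝕜) × 𝕜) :=
  b.equivFun.prodCongr (LinearEquiv.refl 𝕜 𝕜)

/-- Endomorphisms of `L × 𝕜` as bounded operators in coordinates. -/
noncomputable def endCoords : Module.End 𝕜 (L × 𝕜) ≃ₐ[𝕜]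
    ((Fin d → 𝕜) × 𝕜 →L[𝕜] (Fin d → 𝕜) × 𝕜) :=
  ((prodCoords b).conjAlgEquiv 𝕜).trans (Module.End.toContinuousLinearMap ((Fin d → 𝕜) × 𝕜))

theorem endCoords_apply (F : Module.End 𝕜 (L × 𝕜)) (w : (Fin d → 𝕜) × 𝕜) :
    endCoords b F w = prodCoords b (F ((prodCoords b).symm w)) := rfl

theorem prodCoords_apply (w : L × 𝕜) : prodCoords b w = (b.equivFun w.1, w.2) := rfl

theorem prodCoords_symm_apply (w : (Fin d → 𝕜) × 𝕜) :
    (prodCoords b).symm w = (b.equivFun.symm w.1, w.2) := rfl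

/-- The affine representation in coordinates. -/
noncomputable def affineCoords : (Fin d → 𝕜) →L[𝕜] ((Fin d → 𝕜) × 𝕜 →L[𝕜] (Fin d → 𝕜) × 𝕜) :=
  LinearMap.toContinuousLinearMap ((endCoords b).toLinearMap ∘ₗ
    (affineRep ρ D hD).toLinearMap ∘ₗ b.equivFun.symm.toLinearMap)

theorem affineCoords_eq (x : Fin d → 𝕜) :
    affineCoords b ρ D hD x = endCoords b (affineRep ρ D hD (b.equivFun.symm x)) := rfl

theorem affineCoords_apply (x : Fin d → 𝕜) (w : (Fin d → 𝕜) × 𝕜) :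
    affineCoords b ρ D hD x w =
      (b.equivFun (ρ (b.equivFun.symm x) (b.equivFun.symm w.1) + w.2 • D (b.equivFun.symm x)), 0) := by
  rw [affineCoords_eq, endCoords_apply, affineRep_apply, prodCoords_apply, prodCoords_symm_apply]

/-- After composition with the projection onto the line through `(0, 1)` only the value of `T` at
that point counts, so the motion of a single point becomes an identity in the algebra. -/
theorem mul_endCoords_originProj {T : (Fin d → 𝕜) × 𝕜 →L[𝕜] (Fin d → 𝕜) × 𝕜} {y : Fin d → 𝕜}
    (hT : T (0, 1) = (-y, 1)) : T * endCoords b (originProj 𝕜 L) =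
      endCoords b (originProj 𝕜 L) - ∑ i, y i • endCoords b (translationEnd 𝕜 (b i)) := by
  refine ContinuousLinearMap.ext fun w => ?_
  have h2 : endCoords b (originProj 𝕜 L) w = w.2 • ((0, 1) : (Fin d → 𝕜) × 𝕜) := by
    rw [endCoords_apply, originProj_apply, prodCoords_apply, prodCoords_symm_apply]
    simp
  have h3 : (∑ i, y i • endCoords b (translationEnd 𝕜 (b i))) w = w.2 • (y, 0) := by
    simp only [← map_smul, ← map_sum]
    rw [← b.equivFun_symm_apply y, endCoords_apply, translationEnd_apply, prodCoords_apply,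
      prodCoords_symm_apply]
    simp only [map_smul, LinearEquiv.apply_symm_apply, Prod.smul_mk, smul_zero]
  change T (endCoords b (originProj 𝕜 L) w) = endCoords b (originProj 𝕜 L) w -
    (∑ i, y i • endCoords b (translationEnd 𝕜 (b i))) w
  rw [h2, h3, map_smul, hT, ← smul_sub]
  simp

/-- If the orbit map of the origin under the affine representation defined by `ρ` and a bijective
cocycle `D` is inverse to `ψ`, then the twisting element of `ψ` is a twisting cocycle. -/
theorem isTwistingCocycle_of_affineCoords (hinj : Function.Injective D) {g ψ : L → L}
    (hg : ∀ᶠ x in 𝓝 (0 : Fin d → 𝕜), NormedSpace.exp (-affineCoords b ρ D hD x) (0, 1) =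
      (-b.equivFun (g (b.equivFun.symm x)), 1))
    (hψ : ∀ᶠ x in 𝓝 (0 : Fin d → 𝕜), ψ (g (b.equivFun.symm x)) = b.equivFun.symm x) :
    IsTwistingCocycle (degreePart ρ) (twistingElement ρ b ψ) := by
  obtain ⟨a, ha⟩ : ∃ a, a = affineCoords b ρ D hD := ⟨_, rfl⟩
  rw [← ha] at hg
  have hinj' : ∀ x, (a x (0, 1)).1 = 0 → x = 0 := fun x hx => by
    rw [ha, affineCoords_apply, LinearEquiv.map_eq_zero_iff, map_zero, map_zero, zero_add, one_smul,
      ← map_zero D] at hx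
    exact b.equivFun.symm.map_eq_zero_iff.1 (hinj hx)
  have : FiniteDimensional 𝕜 L := Module.Finite.of_basis b
  have hcoord : ∀ y : Fin d → 𝕜, ∑ i, y i • b i = b.equivFun.symm y := fun y =>
    (b.equivFun_symm_apply y).symm
  obtain ⟨h0, han, hexp⟩ := analyticAt_of_leftInverse_exp a hinj'
    (g := fun x => b.equivFun (g (b.equivFun.symm x)))
    (ψ := fun y => b.equivFun (ψ (b.equivFun.symm y))) hg
    (hψ.mono fun x hx => by
      rw [LinearEquiv.symm_apply_apply, hx, LinearEquiv.apply_symm_apply])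
  have hψ0 : ψ 0 = 0 := by simpa using h0
  let D' : L ≃ₗ[𝕜] L := LinearEquiv.ofInjectiveEndo D hinj
  have hD' : ∀ x, D'.symm (D x) = x := fun x => D'.symm_apply_apply x
  let α : USemidirect ρ →ₐ[𝕜] ((Fin d → 𝕜) × 𝕜 →L[𝕜] (Fin d → 𝕜) × 𝕜) :=
    (endCoords b).toAlgHom.comp (affineUHom ρ D hD)
  have hα : ∀ x, α (genH ρ x) = endCoords b (affineRep ρ D hD x) := fun x => by
    rw [← affineUHom_genH]; rfl
  -- Evaluation at the origin followed by `D⁻¹`. It kills `originProj`, whose value at the origin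
  -- has zero component in `L`, and recovers `y` from `affineRep y * originProj`, whose value there
  -- is `D y`.
  let r : Module.End 𝕜 (L × 𝕜) →ₗ[𝕜] L :=
    D'.symm.toLinearMap ∘ₗ LinearMap.fst 𝕜 L 𝕜 ∘ₗ LinearMap.applyₗ ((0, 1) : L × 𝕜)
  refine isTwistingCocycle_twistingElement b ψ ρ hψ0 α (p := endCoords b (originProj 𝕜 L))
    (E := (endCoords b).toLinearMap ∘ₗ translationEnd 𝕜)
    (r := r ∘ₗ (endCoords b).symm.toLinearMap) (fun x v => ?_) ?_ (fun y => ?_) (fun y => ?_)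
  · rw [hα]
    change endCoords b _ * endCoords b _ = endCoords b _
    rw [← map_mul, affineRep_mul_translationEnd]
  · change r ((endCoords b).symm (endCoords b _)) = 0
    rw [AlgEquiv.symm_apply_apply]
    change D'.symm 0 = 0
    simp
  · rw [hα, ← map_mul, affineRep_mul_originProj]
    change r ((endCoords b).symm (endCoords b _)) = y
    rw [AlgEquiv.symm_apply_apply]
    change D'.symm ((1 : 𝕜) • D y) = y
    rw [one_smul, hD']
  · refine formalExp_twistExponent_of_exp b ψ hψ0 (fun ν => ?_)
      (E := fun i => endCoords b (translationEnd 𝕜 (b i))) ?_ y |>.trans ?_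
    · have h1 : coordFun b ψ ν = fun y => b.equivFun (ψ (b.equivFun.symm y)) ν := by
        funext y
        simp only [coordFun, hcoord, b.coord_apply, b.equivFun_apply]
      rw [h1]
      exact ((ContinuousLinearMap.proj (R := 𝕜) (φ := fun _ : Fin d => 𝕜) ν).analyticAt _).comp han
    · filter_upwards [hexp] with y hy
      have h1 : ∑ ν, coordFun b ψ ν y • α (genH ρ (b ν)) =
          a (b.equivFun (ψ (b.equivFun.symm y))) := by
        rw [ha, affineCoords_eq, LinearEquiv.symm_apply_apply]
        simp only [hα, coordFun, hcoord, b.coord_apply, ← map_smul, ← map_sum]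
        rw [← b.equivFun_apply, LinearEquiv.symm_apply_apply]
      rw [h1]
      exact mul_endCoords_originProj b hy
    · simp

end AffineTwist

/-! ### Differentiating a group cocycle -/

section LinearODE

variable {𝕜 : Type*} [RCLike 𝕜] {V : Type*} [NormedAddCommGroup V] [NormedSpace 𝕜 V]
  [CompleteSpace V]

/-- The value at `1` of a solution of the linear differential equation `u' = - A u`. -/
theorem exp_neg_apply_of_hasDerivAt (A : V →L[𝕜] V) {u : 𝕜 → V}
    (hu : ∀ t, HasDerivAt u (-A (u t)) t) : NormedSpace.exp (-A) (u 0) = u 1 := by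
  let : NormedAlgebra ℚ (V →L[𝕜] V) := NormedAlgebra.restrictScalars ℚ 𝕜 _
  -- `exp(tA) u(t)` is constant; comparison of `t = 0` and `t = 1` gives the claim.
  have hd : ∀ t, HasDerivAt (fun s : 𝕜 => NormedSpace.exp (s • A) (u s)) 0 t := fun t => by
    have h := (hasDerivAt_exp_smul_const A t).clm_apply (hu t)
    simpa using h
  have hc := is_const_of_deriv_eq_zero (fun t => (hd t).differentiableAt) (fun t => (hd t).deriv) 0 1
  have h0 : u 0 = NormedSpace.exp A (u 1) := by simpa using hc
  have h1 : NormedSpace.exp (-A) * NormedSpace.exp A = 1 := by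
    rw [← NormedSpace.exp_add_of_commute (Commute.refl A).neg_left, neg_add_cancel,
      NormedSpace.exp_zero]
  rw [h0]
  exact DFunLike.congr_fun h1 (u 1)

end LinearODE

theorem Module.Basis.coord_end_apply {K L : Type*} [CommRing K] [AddCommGroup L] [Module K L] {d : ℕ}
    (b : Module.Basis (Fin d) K L) (T : Module.End K L) (v : L) (i : Fin d) :
    b.coord i (T v) = ∑ k, b.coord i (T (b k)) * b.coord k v := by
  conv_lhs => rw [← b.sum_repr v]
  rw [map_sum, map_sum]
  exact Finset.sum_congr rfl fun k _ => by
    rw [map_smul, map_smul, smul_eq_mul, mul_comm, b.coord_apply k]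

section PiDeriv

variable {𝕜 : Type*} [RCLike 𝕜] {E : Type*} [NormedAddCommGroup E] [NormedSpace 𝕜 E]
  {M : Type*} [TopologicalSpace M] [ChartedSpace E M] {d : ℕ}

theorem mfderiv_pi_apply {f : M → Fin d → 𝕜} {z : M}
    (hf : MDifferentiableAt 𝓘(𝕜, E) 𝓘(𝕜, Fin d → 𝕜) f z) (u : TangentSpace 𝓘(𝕜, E) z) (i : Fin d) :
    (mfderiv 𝓘(𝕜, E) 𝓘(𝕜, Fin d → 𝕜) f z u : Fin d → 𝕜) i =
      mfderiv 𝓘(𝕜, E) 𝓘(𝕜, 𝕜) (fun g => f g i) z u := by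
  have h := ((ContinuousLinearMap.proj (R := 𝕜) (φ := fun _ : Fin d => 𝕜) i).hasMFDerivAt).comp z
    hf.hasMFDerivAt
  exact (DFunLike.congr_fun h.mfderiv u).symm

end PiDeriv

/-! ### Derivatives of a group cocycle along invariant vector fields. -/

section GroupCocycle

variable {𝕜 : Type*} [RCLike 𝕜] {E : Type*} [NormedAddCommGroup E] [NormedSpace 𝕜 E]
  {G : Type*} [TopologicalSpace G] [ChartedSpace E G] [Group G]
  {d : ℕ} (H : Module.Basis (Fin d) 𝕜 (GroupLieAlgebra 𝓘(𝕜, E) G))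
  {φ : G → GroupLieAlgebra 𝓘(𝕜, E) G}

theorem IsSmoothVec.contMDiff_coords {f : G → GroupLieAlgebra 𝓘(𝕜, E) G}
    (hf : IsSmoothVec 𝕜 E f) :
    ContMDiff 𝓘(𝕜, E) 𝓘(𝕜, Fin d → 𝕜) ∞ fun g => H.equivFun (f g) :=
  contMDiff_pi_space.2 fun i => hf (H.coord i)

theorem IsSmoothVec.mdifferentiableAt_coords {f : G → GroupLieAlgebra 𝓘(𝕜, E) G}
    (hf : IsSmoothVec 𝕜 E f) (g : G) :
    MDifferentiableAt 𝓘(𝕜, E) 𝓘(𝕜, Fin d → 𝕜) (fun g => H.equivFun (f g)) g :=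
  (hf.contMDiff_coords H).mdifferentiableAt (by simp)

theorem IsGroupCocycle.apply_one {π : Representation 𝕜 G (GroupLieAlgebra 𝓘(𝕜, E) G)}
    (hφ : IsGroupCocycle π φ) : φ 1 = 0 := by
  have h := hφ.cocycle 1 1
  rw [mul_one, inv_one, map_one, Module.End.one_apply] at h
  exact left_eq_add.1 h

/-- The differential of a group cocycle at the identity. -/
noncomputable def cocycleDiff (φ : G → GroupLieAlgebra 𝓘(𝕜, E) G) :
    GroupLieAlgebra 𝓘(𝕜, E) G →ₗ[𝕜] GroupLieAlgebra 𝓘(𝕜, E) G :=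
  H.equivFun.symm.toLinearMap ∘ₗ
    (mfderiv 𝓘(𝕜, E) 𝓘(𝕜, Fin d → 𝕜) (fun g => H.equivFun (φ g)) 1 :
      GroupLieAlgebra 𝓘(𝕜, E) G →L[𝕜] (Fin d → 𝕜)).toLinearMap

theorem equivFun_cocycleDiff (x : GroupLieAlgebra 𝓘(𝕜, E) G) :
    H.equivFun (cocycleDiff H φ x) =
      mfderiv 𝓘(𝕜, E) 𝓘(𝕜, Fin d → 𝕜) (fun g => H.equivFun (φ g)) 1 x :=
  H.equivFun.apply_symm_apply _

theorem IsSmoothVec.hasMFDerivAt_coords {f : G → GroupLieAlgebra 𝓘(𝕜, E) G}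
    (hf : IsSmoothVec 𝕜 E f) {g h : G} (hgh : h = g) :
    HasMFDerivAt 𝓘(𝕜, E) 𝓘(𝕜, Fin d → 𝕜) (fun g => H.equivFun (f g)) h
      (mfderiv 𝓘(𝕜, E) 𝓘(𝕜, Fin d → 𝕜) (fun g => H.equivFun (f g)) g : E →L[𝕜] (Fin d → 𝕜)) := by
  subst hgh
  exact (hf.mdifferentiableAt_coords H h).hasMFDerivAt

variable [LieGroup 𝓘(𝕜, E) ∞ G]

theorem IsSmoothVec.comp_inv {f : G → GroupLieAlgebra 𝓘(𝕜, E) G}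
    (hf : IsSmoothVec 𝕜 E f) : IsSmoothVec 𝕜 E fun g => f g⁻¹ :=
  fun ξ => (hf ξ).comp (contMDiff_inv 𝓘(𝕜, E) ∞)

/-- The derivative of a group cocycle along a right invariant vector field. -/
theorem IsGroupCocycle.mfderiv_mul_right
    {π : Representation 𝕜 G (GroupLieAlgebra 𝓘(𝕜, E) G)} (hφ : IsGroupCocycle π φ)
    (x : GroupLieAlgebra 𝓘(𝕜, E) G) (g : G) :
    (mfderiv 𝓘(𝕜, E) 𝓘(𝕜, Fin d → 𝕜) (fun g => H.equivFun (φ g)) g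
      (mfderiv 𝓘(𝕜, E) 𝓘(𝕜, E) (fun a => a * g) 1 x : E) : Fin d → 𝕜) =
      H.equivFun (π g⁻¹ (cocycleDiff H φ x)) := by
  have h1 := (hφ.smooth.hasMFDerivAt_coords H (one_mul g)).comp (1 : G)
    ((contMDiff_mul_right (I := 𝓘(𝕜, E)) (n := ∞) (a := g)).mdifferentiableAt (by simp)).hasMFDerivAt
  let P : (Fin d → 𝕜) →L[𝕜] (Fin d → 𝕜) := LinearMap.toContinuousLinearMap
    (H.equivFun.toLinearMap ∘ₗ π g⁻¹ ∘ₗ H.equivFun.symm.toLinearMap)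
  have hP : ∀ v, P (H.equivFun v) = H.equivFun (π g⁻¹ v) := fun v => by
    change H.equivFun (π g⁻¹ (H.equivFun.symm (H.equivFun v))) = _
    rw [LinearEquiv.symm_apply_apply]
  have h2 := (hasMFDerivAt_const (I := 𝓘(𝕜, E)) (I' := 𝓘(𝕜, Fin d → 𝕜)) (H.equivFun (φ g))
    (1 : G)).add (P.hasMFDerivAt.comp (1 : G) (hφ.smooth.hasMFDerivAt_coords H (rfl : (1 : G) = 1)))
  -- In `φ(ag) = φ(g) + g⁻¹ ▷ φ(a)` the variable `a` enters only through `φ(a)`, to which a fixed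
  -- linear map is applied.
  have h3 : (fun a => H.equivFun (φ a)) ∘ (fun a => a * g) =
      (fun _ => H.equivFun (φ g)) + P ∘ fun a => H.equivFun (φ a) := by
    funext a
    simp only [Function.comp_apply, hφ.cocycle g a, map_add, Pi.add_apply, hP]
  rw [h3] at h1
  refine (DFunLike.congr_fun (hasMFDerivAt_unique h1 h2) x).trans ?_
  rw [← hP, equivFun_cocycleDiff]
  exact zero_add _

variable [CompleteSpace E]
  {ρ : GroupLieAlgebra 𝓘(𝕜, E) G →ₗ⁅𝕜⁆ Module.End 𝕜 (GroupLieAlgebra 𝓘(𝕜, E) G)}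
  {π : Representation 𝕜 G (GroupLieAlgebra 𝓘(𝕜, E) G)}

/-- The differential at the identity of `a ↦ a⁻¹ ▷ v`. -/
theorem IntegratesAction.mfderiv_inv (hπ : IntegratesAction ρ π) (v x : GroupLieAlgebra 𝓘(𝕜, E) G)
    (i : Fin d) :
    mfderiv 𝓘(𝕜, E) 𝓘(𝕜, 𝕜) (fun g => H.coord i (π g⁻¹ v)) 1 x = -H.coord i (ρ x v) := by
  let T : Fin d → GroupLieAlgebra 𝓘(𝕜, E) G →L[𝕜] 𝕜 := fun k =>
    mfderiv 𝓘(𝕜, E) 𝓘(𝕜, 𝕜) (fun g : G => H.coord k (π g⁻¹ v)) 1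
  let A : Fin d → GroupLieAlgebra 𝓘(𝕜, E) G →L[𝕜] 𝕜 := fun k =>
    mfderiv 𝓘(𝕜, E) 𝓘(𝕜, 𝕜) (fun g : G => H.coord i (π g (H k))) 1
  have hT : ∀ k, HasMFDerivAt 𝓘(𝕜, E) 𝓘(𝕜, 𝕜) (fun g : G => H.coord k (π g⁻¹ v)) 1 (T k) := fun k =>
    (((hπ.smooth v).comp_inv (H.coord k)).mdifferentiableAt (by simp)).hasMFDerivAt
  have hA : ∀ k, HasMFDerivAt 𝓘(𝕜, E) 𝓘(𝕜, 𝕜) (fun g : G => H.coord i (π g (H k))) 1 (A k) :=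
    fun k => ((hπ.smooth (H k) (H.coord i)).mdifferentiableAt (by simp)).hasMFDerivAt
  have hsum := HasMFDerivAt.sum (t := Finset.univ) fun k _ => (hA k).mul (hT k)
  -- Matrix form of `g ▷ (g⁻¹ ▷ v) = v`: the product rule applied to this constant gives the
  -- derivative of `g⁻¹ ▷ v` at the identity as minus that of `g ▷ v`.
  have hconst : (∑ k, (fun g : G => H.coord i (π g (H k))) * fun g => H.coord k (π g⁻¹ v)) =
      fun _ => H.coord i v := by
    funext g
    have h1 : π g (π g⁻¹ v) = v := by
      rw [← Module.End.mul_apply, ← map_mul, mul_inv_cancel, map_one, Module.End.one_apply]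
    conv_rhs => rw [← h1, H.coord_end_apply]
    simp only [Finset.sum_apply, Pi.mul_apply]
  rw [hconst] at hsum
  have h0 : (∑ k, (H.coord i (π 1 (H k)) • T k + H.coord k (π 1⁻¹ v) • A k)) x = 0 :=
    DFunLike.congr_fun (hasMFDerivAt_unique hsum (hasMFDerivAt_const _ _)) x
  have hAx : ∀ k, A k x = H.coord i (ρ x (H k)) := fun k => hπ.deriv x (H k) (H.coord i)
  have h1 : ∑ k, (H.coord i (H k) * T k x + H.coord k v * H.coord i (ρ x (H k))) = 0 := by
    simp only [inv_one, map_one, Module.End.one_apply] at h0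
    rw [sum_apply] at h0
    simp only [← hAx]
    exact h0
  change T i x = -H.coord i (ρ x v)
  rw [H.coord_end_apply (ρ x) v i, eq_neg_iff_add_eq_zero, ← h1, Finset.sum_add_distrib]
  congr 1
  · simp [Finsupp.single_apply]
  · exact Finset.sum_congr rfl fun k _ => mul_comm _ _

theorem IntegratesAction.mfderiv_inv_coords (hπ : IntegratesAction ρ π)
    (v x : GroupLieAlgebra 𝓘(𝕜, E) G) :
    (mfderiv 𝓘(𝕜, E) 𝓘(𝕜, Fin d → 𝕜) (fun g => H.equivFun (π g⁻¹ v)) 1 x : Fin d → 𝕜) =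
      -H.equivFun (ρ x v) := by
  funext i
  rw [mfderiv_pi_apply ((hπ.smooth v).comp_inv.mdifferentiableAt_coords H 1)]
  exact hπ.mfderiv_inv H v x i

/-- The derivative of a group cocycle along a left invariant vector field. -/
theorem IsGroupCocycle.mfderiv_mulInvariantVectorField (hφ : IsGroupCocycle π φ)
    (hπ : IntegratesAction ρ π) (x : GroupLieAlgebra 𝓘(𝕜, E) G) (g : G) :
    (mfderiv 𝓘(𝕜, E) 𝓘(𝕜, Fin d → 𝕜) (fun g => H.equivFun (φ g)) g (mulInvariantVectorField x g) :
      Fin d → 𝕜) = H.equivFun (cocycleDiff H φ x - ρ x (φ g)) := by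
  have h1 := (hφ.smooth.hasMFDerivAt_coords H (mul_one g)).comp (1 : G)
    ((contMDiff_mul_left (I := 𝓘(𝕜, E)) (n := ∞) (a := g)).mdifferentiableAt (by simp)).hasMFDerivAt
  have h2 := (hφ.smooth.hasMFDerivAt_coords H (rfl : (1 : G) = 1)).add
    ((hπ.smooth (φ g)).comp_inv.hasMFDerivAt_coords H (rfl : (1 : G) = 1))
  -- In `φ(ga) = φ(a) + a⁻¹ ▷ φ(g)` both summands vary with `a`; their derivatives at `a = 1` are `D
  -- x` and `-ρ(x) φ(g)`.
  have h3 : (fun a => H.equivFun (φ a)) ∘ (fun a => g * a) =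
      (fun a => H.equivFun (φ a)) + fun a => H.equivFun (π a⁻¹ (φ g)) := by
    funext a
    simp only [Function.comp_apply, hφ.cocycle a g, map_add, Pi.add_apply]
  rw [h3] at h1
  refine (DFunLike.congr_fun (hasMFDerivAt_unique h1 h2) x).trans ?_
  rw [map_sub, sub_eq_add_neg, ← hπ.mfderiv_inv_coords H (φ g) x, equivFun_cocycleDiff]
  rfl

end GroupCocycle

/-! ### The differential of a group cocycle is a bijective Lie algebra cocycle -/

theorem hasDerivAt_of_hasMFDerivAt {𝕜 E F : Type*} [NontriviallyNormedField 𝕜]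
    [NormedAddCommGroup E] [NormedSpace 𝕜 E] [NormedAddCommGroup F] [NormedSpace 𝕜 F] {f : 𝕜 → F}
    {T : E →L[𝕜] F} {v : E} {t : 𝕜}
    (h : HasMFDerivAt 𝓘(𝕜, 𝕜) 𝓘(𝕜, F) f t (T.comp ((1 : 𝕜 →L[𝕜] 𝕜).smulRight v))) :
    HasDerivAt f (T v) t := by
  have h1 : HasFDerivAt f (T.comp ((1 : 𝕜 →L[𝕜] 𝕜).smulRight v)) t := h.hasFDerivAt
  simpa using h1.hasDerivAt

section CocycleDiff

open VectorField Filter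

variable {𝕜 : Type*} [RCLike 𝕜] {E : Type*} [NormedAddCommGroup E] [NormedSpace 𝕜 E]
  {G : Type*} [TopologicalSpace G] [ChartedSpace E G] [Group G]
  {d : ℕ} (H : Module.Basis (Fin d) 𝕜 (GroupLieAlgebra 𝓘(𝕜, E) G))

theorem isOneParameterSubgroup_zero :
    IsOneParameterSubgroup (0 : GroupLieAlgebra 𝓘(𝕜, E) G) fun _ : 𝕜 => (1 : G) := by
  refine ⟨rfl, fun t => ?_⟩
  have h : (1 : 𝕜 →L[𝕜] 𝕜).smulRight (mulInvariantVectorField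
      (0 : GroupLieAlgebra 𝓘(𝕜, E) G) (1 : G)) = 0 := by
    refine ContinuousLinearMap.ext fun c => ?_
    rw [ContinuousLinearMap.smulRight_apply, mulInvariantVectorField, map_zero]
    exact smul_zero (A := E) c
  exact h ▸ hasMFDerivAt_const (I := 𝓘(𝕜, 𝕜)) (I' := 𝓘(𝕜, E)) (1 : G) t

theorem lieExp_eq_one {x : GroupLieAlgebra 𝓘(𝕜, E) G}
    (h : ¬∃ γ : 𝕜 → G, IsOneParameterSubgroup x γ) : lieExp x = 1 :=
  dif_neg h

theorem exists_lieExp {x : GroupLieAlgebra 𝓘(𝕜, E) G}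
    (h : ∃ γ : 𝕜 → G, IsOneParameterSubgroup x γ) :
    ∃ γ : 𝕜 → G, IsOneParameterSubgroup x γ ∧ lieExp x = γ 1 :=
  ⟨h.choose, h.choose_spec, dif_pos h⟩

variable [LieGroup 𝓘(𝕜, E) ∞ G] [CompleteSpace E]
  {ρ : GroupLieAlgebra 𝓘(𝕜, E) G →ₗ⁅𝕜⁆ Module.End 𝕜 (GroupLieAlgebra 𝓘(𝕜, E) G)}
  {π : Representation 𝕜 G (GroupLieAlgebra 𝓘(𝕜, E) G)}
  {φ : G → GroupLieAlgebra 𝓘(𝕜, E) G}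

/-- The linear field `v ↦ x ▷ v`, in coordinates. -/
noncomputable def actionCoords
    (ρ : GroupLieAlgebra 𝓘(𝕜, E) G →ₗ⁅𝕜⁆ Module.End 𝕜 (GroupLieAlgebra 𝓘(𝕜, E) G))
    (x : GroupLieAlgebra 𝓘(𝕜, E) G) : (Fin d → 𝕜) →L[𝕜] (Fin d → 𝕜) :=
  LinearMap.toContinuousLinearMap (H.equivFun.toLinearMap ∘ₗ ρ x ∘ₗ H.equivFun.symm.toLinearMap)

theorem actionCoords_apply (x v : GroupLieAlgebra 𝓘(𝕜, E) G) :
    actionCoords H ρ x (H.equivFun v) = H.equivFun (ρ x v) := by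
  change H.equivFun (ρ x (H.equivFun.symm (H.equivFun v))) = _
  rw [LinearEquiv.symm_apply_apply]

/-- A group cocycle satisfies a linear differential equation along a one-parameter subgroup. -/
theorem IsGroupCocycle.hasDerivAt_comp (hφ : IsGroupCocycle π φ) (hπ : IntegratesAction ρ π)
    {x : GroupLieAlgebra 𝓘(𝕜, E) G} {γ : 𝕜 → G} (hγ : IsOneParameterSubgroup x γ) (t : 𝕜) :
    HasDerivAt (fun s => H.equivFun (φ (γ s))) (H.equivFun (cocycleDiff H φ x - ρ x (φ (γ t)))) t := by
  rw [← hφ.mfderiv_mulInvariantVectorField H hπ x (γ t)]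
  exact hasDerivAt_of_hasMFDerivAt (E := E) (F := Fin d → 𝕜)
    ((hφ.smooth.hasMFDerivAt_coords H (rfl : γ t = γ t)).comp t (hγ.2 t))

/-- A group cocycle vanishes on the exponentials of the kernel of its differential. -/
theorem IsGroupCocycle.apply_lieExp_eq_zero (hφ : IsGroupCocycle π φ) (hπ : IntegratesAction ρ π)
    {x : GroupLieAlgebra 𝓘(𝕜, E) G} (hx : cocycleDiff H φ x = 0) : φ (lieExp x) = 0 := by
  by_cases h : ∃ γ : 𝕜 → G, IsOneParameterSubgroup x γ
  · obtain ⟨γ, hγ, h1⟩ := exists_lieExp h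
    -- With `D x = 0` the equation along the one-parameter subgroup is the homogeneous one, `u' =
    -- -ρ(x) u`, with initial value `0`.
    have hu := exp_neg_apply_of_hasDerivAt (actionCoords H ρ x) (u := fun s => H.equivFun (φ (γ s)))
      fun t => by
        have h2 := hφ.hasDerivAt_comp H hπ hγ t
        rwa [hx, zero_sub, map_neg, ← actionCoords_apply] at h2
    rw [hγ.1, hφ.apply_one, map_zero, map_zero] at hu
    rw [h1]
    exact H.equivFun.map_eq_zero_iff.1 hu.symm
  · rw [lieExp_eq_one h, hφ.apply_one]

/-- A group cocycle which is invertible near the origin has an injective differential. -/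
theorem IsGroupCocycle.injective_cocycleDiff (hφ : IsGroupCocycle π φ) (hπ : IntegratesAction ρ π)
    {ψ : GroupLieAlgebra 𝓘(𝕜, E) G → GroupLieAlgebra 𝓘(𝕜, E) G} (hψ : IsInverseNearOrigin φ ψ) :
    Function.Injective (cocycleDiff H φ) := by
  rw [injective_iff_map_eq_zero]
  intro x hx
  have h0 : ψ 0 = 0 := by
    have := hψ.left_inv.self_of_nhds
    rwa [hφ.apply_lieExp_eq_zero H hπ (map_zero _)] at this
  have hc : Tendsto (fun t : 𝕜 => t • x) (𝓝 0) (𝓝 0) := by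
    have : Continuous fun t : 𝕜 => t • x := continuous_id.smul continuous_const
    simpa using this.tendsto 0
  -- If `D x = 0` then `φ(exp(tx)) = 0` for all `t`, so the left inverse gives `tx = ψ(0) = 0` for
  -- small `t`; one nonzero `t` suffices.
  have h1 : ∀ᶠ t : 𝕜 in 𝓝[≠] 0, t • x = 0 := by
    filter_upwards [nhdsWithin_le_nhds (hc.eventually hψ.left_inv)] with t ht
    rw [← ht, hφ.apply_lieExp_eq_zero H hπ (by rw [map_smul, hx, smul_zero]), h0]
  obtain ⟨t, ht, ht0⟩ := (h1.and self_mem_nhdsWithin).exists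
  exact (smul_eq_zero.1 ht).resolve_left ht0

end CocycleDiff

/-! ### The Lie algebra cocycle condition from related vector fields. -/

section CocycleBracket

open VectorField Filter

theorem ContinuousLinearMap.isInvertible_of_surjective {𝕜 E F : Type*} [RCLike 𝕜]
    [NormedAddCommGroup E] [NormedSpace 𝕜 E] [FiniteDimensional 𝕜 E]
    [NormedAddCommGroup F] [NormedSpace 𝕜 F] [FiniteDimensional 𝕜 F] {T : E →L[𝕜] F}
    (hT : Function.Surjective T) (hd : Module.finrank 𝕜 E = Module.finrank 𝕜 F) :
    T.IsInvertible := by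
  have hinj : Function.Injective T.toLinearMap :=
    (LinearMap.injective_iff_surjective_of_finrank_eq_finrank hd).2 hT
  exact ⟨(LinearEquiv.ofBijective T.toLinearMap ⟨hinj, hT⟩).toContinuousLinearEquiv, by ext; rfl⟩

theorem lieBracket_affine {𝕜 F : Type*} [NontriviallyNormedField 𝕜] [NormedAddCommGroup F]
    [NormedSpace 𝕜 F] (A B : F →L[𝕜] F) (v w : F) :
    lieBracket 𝕜 (fun y => v - A y) (fun y => w - B y) 0 = A w - B v := by
  rw [lieBracket_eq]
  have h : ∀ (u : F) (C : F →L[𝕜] F), fderiv 𝕜 (fun y => u - C y) 0 = -C := fun u C =>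
    (C.hasFDerivAt.const_sub u).fderiv
  simp [h]
  abel

variable {𝕜 : Type*} [RCLike 𝕜] {E : Type*} [NormedAddCommGroup E] [NormedSpace 𝕜 E]
  {G : Type*} [TopologicalSpace G] [ChartedSpace E G] [Group G] [LieGroup 𝓘(𝕜, E) ∞ G]
  {d : ℕ} (H : Module.Basis (Fin d) 𝕜 (GroupLieAlgebra 𝓘(𝕜, E) G))
  {π : Representation 𝕜 G (GroupLieAlgebra 𝓘(𝕜, E) G)}
  {φ : G → GroupLieAlgebra 𝓘(𝕜, E) G}

/-- The differential at `g` sends the right translate of `x` to `g⁻¹ ▷ D x`. As `D` is surjective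
and `g⁻¹` acts invertibly, it is surjective between spaces of equal dimension. -/
theorem IsGroupCocycle.isInvertible_mfderiv [FiniteDimensional 𝕜 E] (hφ : IsGroupCocycle π φ)
    (hinj : Function.Injective (cocycleDiff H φ)) (g : G) :
    (mfderiv 𝓘(𝕜, E) 𝓘(𝕜, Fin d → 𝕜) (fun g => H.equivFun (φ g)) g).IsInvertible := by
  have hfin : FiniteDimensional 𝕜 (GroupLieAlgebra 𝓘(𝕜, E) G) := Module.Finite.of_basis H
  have hsurj := LinearMap.injective_iff_surjective.1 hinj
  have hdim : Module.finrank 𝕜 E = Module.finrank 𝕜 (Fin d → 𝕜) :=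
    (H.equivFun.finrank_eq : Module.finrank 𝕜 (GroupLieAlgebra 𝓘(𝕜, E) G) = _)
  refine ContinuousLinearMap.isInvertible_of_surjective (E := E) (F := Fin d → 𝕜) (fun y => ?_) hdim
  obtain ⟨x, hx⟩ := hsurj (π g (H.equivFun.symm y))
  refine ⟨_, (hφ.mfderiv_mul_right H x g).trans ?_⟩
  rw [hx, ← Module.End.mul_apply, ← map_mul, inv_mul_cancel, map_one, Module.End.one_apply,
    LinearEquiv.apply_symm_apply]

variable [CompleteSpace E]
  {ρ : GroupLieAlgebra 𝓘(𝕜, E) G →ₗ⁅𝕜⁆ Module.End 𝕜 (GroupLieAlgebra 𝓘(𝕜, E) G)}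

/-- The affine vector field on the coordinate space to which a group cocycle maps a left invariant
vector field. -/
noncomputable def affineField (D : GroupLieAlgebra 𝓘(𝕜, E) G →ₗ[𝕜] GroupLieAlgebra 𝓘(𝕜, E) G)
    (ρ : GroupLieAlgebra 𝓘(𝕜, E) G →ₗ⁅𝕜⁆ Module.End 𝕜 (GroupLieAlgebra 𝓘(𝕜, E) G))
    (x : GroupLieAlgebra 𝓘(𝕜, E) G) (y : Fin d → 𝕜) : TangentSpace 𝓘(𝕜, Fin d → 𝕜) y :=
  (H.equivFun (D x) - actionCoords H ρ x y : Fin d → 𝕜)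

theorem mdifferentiableAt_affineField
    (D : GroupLieAlgebra 𝓘(𝕜, E) G →ₗ[𝕜] GroupLieAlgebra 𝓘(𝕜, E) G)
    (x : GroupLieAlgebra 𝓘(𝕜, E) G) (y : Fin d → 𝕜) :
    MDifferentiableAt 𝓘(𝕜, Fin d → 𝕜) 𝓘(𝕜, Fin d → 𝕜).tangent
      (fun y => (⟨y, affineField H D ρ x y⟩ : TangentBundle 𝓘(𝕜, Fin d → 𝕜) (Fin d → 𝕜))) y := by
  have h : ContDiffAt 𝕜 1 (fun y => H.equivFun (D x) - actionCoords H ρ x y) y :=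
    contDiffAt_const.sub (actionCoords H ρ x).contDiff.contDiffAt
  exact (contMDiffAt_vectorSpace_iff_contDiffAt.2 h).mdifferentiableAt (by simp)

theorem mlieBracket_affineField
    (D : GroupLieAlgebra 𝓘(𝕜, E) G →ₗ[𝕜] GroupLieAlgebra 𝓘(𝕜, E) G)
    (x y : GroupLieAlgebra 𝓘(𝕜, E) G) :
    (mlieBracket 𝓘(𝕜, Fin d → 𝕜) (affineField H D ρ x) (affineField H D ρ y) 0 : Fin d → 𝕜) =
      H.equivFun (ρ x (D y) - ρ y (D x)) := by
  rw [← mlieBracketWithin_univ, mlieBracketWithin_eq_lieBracketWithin, map_sub,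
    ← actionCoords_apply, ← actionCoords_apply, ← lieBracket_affine, ← lieBracketWithin_univ]
  rfl

/-- A group cocycle along a one-parameter subgroup is the orbit of the origin under an affine
action. -/
theorem IsGroupCocycle.exp_affineCoords (hφ : IsGroupCocycle π φ) (hπ : IntegratesAction ρ π)
    (hD : ∀ x y, cocycleDiff H φ ⁅x, y⁆ = ρ x (cocycleDiff H φ y) - ρ y (cocycleDiff H φ x))
    {x : GroupLieAlgebra 𝓘(𝕜, E) G} (hx : ∃ γ : 𝕜 → G, IsOneParameterSubgroup x γ) :
    NormedSpace.exp (-affineCoords H ρ (cocycleDiff H φ) hD (H.equivFun x)) (0, 1) =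
      (-H.equivFun (φ (lieExp x)), 1) := by
  obtain ⟨γ, hγ, h1⟩ := exists_lieExp hx
  have hu := exp_neg_apply_of_hasDerivAt (affineCoords H ρ (cocycleDiff H φ) hD (H.equivFun x))
    -- The sign makes the equation linear in the right form: `w = -φ(γ(s))` satisfies `w' = -(ρ(x) w
    -- + D x)`, which is `-A(x)` applied to `(w, 1)`.
    (u := fun s => (-H.equivFun (φ (γ s)), 1)) fun t => by
      refine ((hφ.hasDerivAt_comp H hπ hγ t).neg.prodMk (hasDerivAt_const t (1 : 𝕜))).congr_deriv ?_
      rw [affineCoords_apply]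
      simp only [LinearEquiv.symm_apply_apply, map_neg, one_smul, Prod.neg_mk, neg_zero]
      rw [← map_neg, ← map_neg, neg_sub, neg_add_rev, neg_neg, neg_add_eq_sub]
  rw [hγ.1, hφ.apply_one, map_zero, neg_zero] at hu
  rw [hu, h1]

variable [FiniteDimensional 𝕜 E]

/-- The derivative of `φ` along a left invariant field depends on `g` only through `φ(g)`, in an
affine way. The two fields are therefore related by `φ`, and since its differential is invertible
everywhere, one is the pullback of the other. -/
theorem IsGroupCocycle.mpullback_affineField (hφ : IsGroupCocycle π φ) (hπ : IntegratesAction ρ π)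
    (hinj : Function.Injective (cocycleDiff H φ)) (x : GroupLieAlgebra 𝓘(𝕜, E) G) :
    mpullback 𝓘(𝕜, E) 𝓘(𝕜, Fin d → 𝕜) (fun g => H.equivFun (φ g))
      (affineField H (cocycleDiff H φ) ρ x) = mulInvariantVectorField x := by
  funext g
  rw [mpullback_apply, (hφ.isInvertible_mfderiv H hinj g).inverse_apply_eq]
  refine Eq.trans ?_ (hφ.mfderiv_mulInvariantVectorField H hπ x g).symm
  rw [map_sub, ← actionCoords_apply]
  rfl

/-- The differential of a group cocycle is a Lie algebra cocycle. -/
theorem IsGroupCocycle.cocycleDiff_lie (hφ : IsGroupCocycle π φ) (hπ : IntegratesAction ρ π)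
    (hinj : Function.Injective (cocycleDiff H φ)) (x y : GroupLieAlgebra 𝓘(𝕜, E) G) :
    cocycleDiff H φ ⁅x, y⁆ = ρ x (cocycleDiff H φ y) - ρ y (cocycleDiff H φ x) := by
  have h0 : H.equivFun (φ 1) = 0 := by rw [hφ.apply_one, map_zero]
  -- Pullback commutes with brackets. At the identity the bracket of left invariant fields is that
  -- of `L`, while the bracket of the affine fields is taken at `φ(1) = 0`, where it equals `ρ(x) D
  -- y - ρ(y) D x`.
  have h1 := mpullback_mlieBracket (x₀ := (1 : G)) (n := ∞)
    (mdifferentiableAt_affineField H (ρ := ρ) (cocycleDiff H φ) x _)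
    (mdifferentiableAt_affineField H (ρ := ρ) (cocycleDiff H φ) y _)
    (hφ.smooth.contMDiff_coords H).contMDiffAt
    (by rw [minSmoothness_of_isRCLikeNormedField]; exact ENat.LEInfty.out)
  rw [hφ.mpullback_affineField H hπ hinj, hφ.mpullback_affineField H hπ hinj,
    ← GroupLieAlgebra.bracket_def, mpullback_apply,
    (hφ.isInvertible_mfderiv H hinj 1).inverse_apply_eq] at h1
  apply H.equivFun.injective
  rw [equivFun_cocycleDiff]
  refine h1.symm.trans ?_
  rw [h0]
  exact mlieBracket_affineField H _ x y

end CocycleBracket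

theorem theorem3 {𝕜 : Type*} [RCLike 𝕜]
    {E : Type*} [NormedAddCommGroup E] [NormedSpace 𝕜 E] [FiniteDimensional 𝕜 E] [CompleteSpace E]
    {G : Type*} [TopologicalSpace G] [ChartedSpace E G] [Group G] [LieGroup 𝓘(𝕜, E) ∞ G]
    {d : ℕ} (H : Module.Basis (Fin d) 𝕜 (GroupLieAlgebra 𝓘(𝕜, E) G))
    (ρ : GroupLieAlgebra 𝓘(𝕜, E) G →ₗ⁅𝕜⁆ Module.End 𝕜 (GroupLieAlgebra 𝓘(𝕜, E) G))
    (π : Representation 𝕜 G (GroupLieAlgebra 𝓘(𝕜, E) G)) (hπ : IntegratesAction ρ π)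
    (φ : G → GroupLieAlgebra 𝓘(𝕜, E) G) (hφ : IsGroupCocycle π φ)
    (ψ : GroupLieAlgebra 𝓘(𝕜, E) G → GroupLieAlgebra 𝓘(𝕜, E) G)
    (hψ : IsInverseNearOrigin φ ψ) :
    IsTwistingCocycle (degreePart ρ) (twistingElement ρ H ψ) := by
  have hinj := hφ.injective_cocycleDiff H hπ hψ
  have hD := hφ.cocycleDiff_lie H hπ hinj
  have hcont : Filter.Tendsto (fun x => H.equivFun.symm x) (𝓝 (0 : Fin d → 𝕜)) (𝓝 0) := by
    have : Continuous fun x : Fin d → 𝕜 => ∑ i, x i • H i :=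
      continuous_finsetSum _ fun i _ => (continuous_apply i).smul continuous_const
    simpa [H.equivFun_symm_apply] using this.tendsto 0
  have hleft := hcont.eventually hψ.left_inv
  refine isTwistingCocycle_of_affineCoords H ρ (cocycleDiff H φ) hD hinj
    (g := fun x => φ (lieExp x)) ?_ hleft
  have h0 : ψ 0 = 0 := by
    have := hψ.left_inv.self_of_nhds
    rwa [hφ.apply_lieExp_eq_zero H hπ (map_zero _)] at this
  filter_upwards [hleft] with x hx
  -- Where no one-parameter subgroup exists, `lieExp` has the default value `1`. Then `φ` vanishes
  -- there and the left inverse forces `x = ψ(0) = 0`; but the zero vector has the constant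
  -- one-parameter subgroup.
  have hex : ∃ γ : 𝕜 → G, IsOneParameterSubgroup (H.equivFun.symm x) γ := by
    by_contra h
    rw [lieExp_eq_one h, hφ.apply_one, h0] at hx
    exact h (hx ▸ ⟨_, isOneParameterSubgroup_zero⟩)
  have := hφ.exp_affineCoords H hπ hD hex
  rwa [LinearEquiv.apply_symm_apply] at this
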